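/- **Setting.** Let $G$ be a second countable, locally compact Hausdorff groupoid with object space $G^0$, range and source maps $r,s$, unit map $u$, and a (left invariant, continuous) Haar system $\alpha=(\alpha^x)_{x\in G^0}$. Let $G^2=\{(g,h): s(g)=r(h)\}$, with product $(g,h)\mapsto gh$. A *twisted partial action* of $G$ consists of an upper semicontinuous field of C*-algebras $B=(B_x)_{x\in G^0}$, closed two-sided ideals $D_g\subseteq B_{r(g)}$, $^*$-isomorphisms $\mathfrak a_g\colon D_{g^{-1}}\to D_g$ ($g\in G$), and unitary multipliers $w(g,h)$ of $D_g\cap D_{gh}$ for $(g,h)\in G^2$, such that * $D_{u(x)}=B_x$, $\mathfrak a_{u(x)}=\mathrm{id}$, $w(g,u(s(g)))=1=w(u(r(g)),g)$; * $\mathfrak a_g(D_{g^{-1}}\cap D_h)\subseteq D_{gh}$; * $\mathfrak a_g(\mathfrak a_h(a))=w(g,h)\,\mathfrak a_{gh}(a)\,w(g,h)^*$ for $a\in \mathfrak a_{h^{-1}}(D_{g^{-1}}\cap D_h)$; * $\mathfrak a_g(a\,w(h,k))\,w(g,hk)=\mathfrak a_g(a)\,w(g,h)\,w(gh,k)$ for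 $a\in D_{g^{-1}}\cap D_h\cap D_{hk}$; * $D=(D_g)_{g\in G}$ is a continuous family of ideals in $r^*B$, and $\mathfrak a_g$ and $w(g,h)$ depend continuously on $g$ and $(g,h)$ (they give an isomorphism $\mathrm{inv}^*D\cong D$, and a multiplier of the field $(D_g\cap D_{gh})_{(g,h)\in G^2}$). The *associated Fell bundle* $\mathcal A$ has fibres $\mathcal A_g=D_g$, as continuous sections those of $D$, and the operations $$a\cdot b=\mathfrak a_g(\mathfrak a_g^{-1}(a)\,b)\,w(g,h)\in \mathcal A_{gh},\qquad a^*_{\mathcal A}=\mathfrak a_g^{-1}(a^*)\,w(g^{-1},g)^*\in \mathcal A_{g^{-1}}\qquad(a\in \mathcal A_g,\ b\in \mathcal A_h).$$ Assume that the field $B$ is *separable*: there is a sequence of continuous sections whose values are dense in $B_x$ for every $x\in G^0$ (equivalently, the C*-algebra $C_0(G^0,B)$ is separable). Let $\nu$ be a $\sigma$-finite Borel measure on $G^0$ and let $H=(H_x)_{x\in G^0}$ be a $\nu$-measurable field of (separable) Hilbert spaces. Write $(\nu\circ\alpha)(E)=\int\alpha^x(E)\,d\nu(x)$, and let $\nu\circ\tilde\alpha$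 be the image of $\nu\circ\alpha$ under inversion. Measurable sections of $s^*H$ and of $r^*H$ over $G$ are taken with respect to $\nu\circ\tilde\alpha$ and $\nu\circ\alpha$, respectively. A measure on $G$ is *symmetric* if it is equivalent to its image under inversion. *Measurable Fell-bundle representation of $\mathcal A$ on $(\nu,H)$:* $H_x\ne0$ for $\nu$-almost all $x$, and linear maps $S_g\colon\mathcal A_g\to\mathbb B(H_{s(g)},H_{r(g)})$ for all $g\in G$ such that (i) $S_g(a)S_h(b)=S_{gh}(a\cdot b)$ for $(g,h)\in G^2$; (ii) $S_g(a)^*=S_{g^{-1}}(a^*_{\mathcal A})$; (iii) for all $x\in G^0$ the vectors $S_{u(x)}(a)\xi$ span a dense subspace of $H_x$; (iv) for every continuous section $f$ of $\mathcal A$ with compact support and every measurable section $\xi$ of $s^*H$, $g\mapsto S_g(f(g))\xi(g)$ is a measurable section of $r^*H$; (v) the restriction of $\nu\circ\alpha$ to $\{g: S_{u(r(g))}(\mathcal A_g\mathcal A_g^*)H_{r(g)}\neq0\}$ is symmetric. *Measurable covariant representation of the twisted partial action on $(\nu,H)$:* $H_x\neq0$ for $\nu$-almost all $x$; nondegenerate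 $^*$-representations $\varphi_x\colon B_x\to\mathbb B(H_x)$ for all $x\in G^0$; and, with $\varphi(I)H$ denoting the closed linear span of $\{\varphi(a)\xi: a\in I,\ \xi\in H\}$, unitary operators $U_g\colon\varphi_{s(g)}(D_{g^{-1}})H_{s(g)}\to\varphi_{r(g)}(D_g)H_{r(g)}$ for all $g\in G$, such that (i) the restriction of $\nu\circ\alpha$ to $\{g:\varphi_{r(g)}(D_g)H_{r(g)}\ne0\}$ is symmetric; (ii) $U_g\varphi_{s(g)}(a)U_g^*=\varphi_{r(g)}(\mathfrak a_g(a))$ on $\varphi_{r(g)}(D_g)H_{r(g)}$ for all $g\in G$, $a\in D_{g^{-1}}$; (iii) for $(g,h)\in G^2$, the operator $U_gU_h$ (on its natural domain) is a restriction of $\varphi_{r(g)}(w(g,h))U_{gh}$, where $\varphi_{r(g)}$ is extended to multipliers of $D_g\cap D_{gh}$ by their action on $\varphi_{r(g)}(D_g\cap D_{gh})H_{r(g)}$ and by $0$ on the orthogonal complement; (iv) for every continuous section $a$ of $B$ vanishing at infinity and every measurable section $\xi$ of $H$, $x\mapsto\varphi_x(a(x))\xi(x)$ is a measurable section of $H$,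 and for every measurable section $\xi$ of $s^*H$ with $\xi(g)\in\varphi_{s(g)}(D_{g^{-1}})H_{s(g)}$ for all $g$, $g\mapsto U_g\xi(g)$ is a measurable section of $r^*H$. **Theorem.** Measurable covariant representations of the twisted partial action are equivalent to measurable Fell-bundle representations of $\mathcal A$, in the following sense. For a unitary $U_g$ as above, let $\bar U_g\colon H_{s(g)}\to H_{r(g)}$ be the partial isometry that extends $U_g$ by $0$ on the orthogonal complement of its domain. 1. For fixed $\nu$ and $H$, the assignment $(\varphi,U)\mapsto S$, $S_g(a):=\varphi_{r(g)}(a)\bar U_g$ for $a\in D_g$, is a bijection from the set of measurable covariant representations of the twisted partial action on $(\nu,H)$ onto the set of measurable Fell-bundle representations of $\mathcal A$ on $(\nu,H)$. 2. The inverse bijection is given by $\varphi_x=S_{u(x)}$ and $U_g(\varphi_{s(g)}(a)\xi)=S_g(\mathfrak a_g(a))\xi$ for $a\in D_{g^{-1}}$, $\xi\in H_{s(g)}$. 3. The bijections are compatible with intertwiners: let $(\varphi,U)$ and $(\varphi',U')$ be measurable covariant representations on $(\nu,H)$ and $(\nu',H')$, with associated Fell-bundle representations $S$ and $S'$; let $E\subseteq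 G^0$ and let $V_x\colon H_x\to H'_x$ be bounded operators. Then $V_x\varphi_x(b)=\varphi'_x(b)V_x$ for all $x\in E$, $b\in B_x$, and, for all $g$ with $s(g),r(g)\in E$, $V_{s(g)}$ maps the domain of $U_g$ into that of $U'_g$ and $V_{r(g)}U_g=U'_gV_{s(g)}$ there, if and only if $V_{r(g)}S_g(a)=S'_g(a)V_{s(g)}$ for all $g$ with $s(g),r(g)\in E$ and $a\in\mathcal A_g$. 4. If $\nu$ is replaced by an equivalent $\sigma$-finite measure, $H$ remains a measurable field with the same measurable sections, and the sets of measurable covariant representations and of measurable Fell-bundle representations do not change. -/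

import Mathlib

open CategoryTheory MeasureTheory Filter Topology
open scoped MultiplierAlgebra ENNReal

noncomputable section

namespace FellBundles

universe u v t

/-! ### Locally compact groupoids -/

/-- The arrow space of a groupoid with object space `X`.  An arrow `g : x ⟶ y` has source `x` and
range `y`, and the product `g · h` of groupoid theory is `h ≫ g`. -/
@[ext]
structure Arr (X : Type u) [Groupoid.{v} X] where
  src : X
  rng : X
  hom : src ⟶ rng

/-- The space of composable pairs `(g, h)`, that is, `s(g) = r(h)`. -/
structure CompPair (X : Type u) [Groupoid.{v} X] where
  {x y z : X}
  fst : y ⟶ z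
  snd : x ⟶ y

section Groupoid

variable {X : Type u} [Groupoid.{v} X]

/-- The unit arrow at an object. -/
abbrev Arr.unit (x : X) : Arr X := ⟨x, x, 𝟙 x⟩

/-- The inversion on the arrow space. -/
abbrev Arr.inverse (g : Arr X) : Arr X := ⟨g.rng, g.src, inv g.hom⟩

/-- `(g, h) ↦ g`. -/
abbrev CompPair.left (p : CompPair X) : Arr X := ⟨p.y, p.z, p.fst⟩

/-- `(g, h) ↦ h`. -/
abbrev CompPair.right (p : CompPair X) : Arr X := ⟨p.x, p.y, p.snd⟩

/-- `(g, h) ↦ g · h`. -/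
abbrev CompPair.prod (p : CompPair X) : Arr X := ⟨p.x, p.z, p.snd ≫ p.fst⟩

/-- The space of composable pairs carries the subspace topology from `G × G`. -/
instance [TopologicalSpace (Arr X)] : TopologicalSpace (CompPair X) :=
  TopologicalSpace.induced (fun p => (p.left, p.right)) inferInstance

end Groupoid

/-- A groupoid with topologies on its object and arrow spaces such that all structure maps are
continuous. -/
class IsTopologicalGroupoid (X : Type u) [Groupoid.{v} X] [TopologicalSpace X]
    [TopologicalSpace (Arr X)] : Prop where
  continuous_src : Continuous (Arr.src : Arr X → X)
  continuous_rng : Continuous (Arr.rng : Arr X → X)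
  continuous_unit : Continuous (Arr.unit : X → Arr X)
  continuous_inverse : Continuous (Arr.inverse : Arr X → Arr X)
  continuous_prod : Continuous (CompPair.prod : CompPair X → Arr X)

/-- A left invariant Haar system: a continuous family of fully supported (Radon) measures on the
range fibres of the arrow space. -/
structure HaarSystem (X : Type u) [Groupoid.{v} X] [TopologicalSpace (Arr X)] [TopologicalSpace X]
    [MeasurableSpace (Arr X)] where
  measure : X → Measure (Arr X)
  finite_on_compacts : ∀ (x : X) (K : Set (Arr X)), IsCompact K → measure x K < ∞
  supported : ∀ x, measure x {g | g.rng ≠ x} = 0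
  full_support : ∀ (g : Arr X) (V : Set (Arr X)), IsOpen V → g ∈ V → measure g.rng V ≠ 0
  continuous_integral : ∀ f : Arr X → ℝ, Continuous f → HasCompactSupport f →
    Continuous fun x => ∫ g, f g ∂(measure x)
  left_invariant : ∀ {x y : X} (g : x ⟶ y) (E : Set (Arr X)), MeasurableSet E →
    measure x {a | ∃ (z : X) (h : z ⟶ x), a = ⟨z, x, h⟩ ∧ (⟨z, y, h ≫ g⟩ : Arr X) ∈ E} =
      measure y E

section Haar

variable {X : Type u} [Groupoid.{v} X] [TopologicalSpace (Arr X)] [TopologicalSpace X]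
  [MeasurableSpace (Arr X)] [MeasurableSpace X]

/-- The measure `ν ∘ α` on the arrow space, `(ν ∘ α)(E) = ∫ α^x(E) dν(x)`. -/
def HaarSystem.comp (α : HaarSystem X) (ν : Measure X) : Measure (Arr X) :=
  ν.bind α.measure

/-- The measure `ν ∘ α̃` on the arrow space, where `α̃` is the right invariant Haar system
corresponding to `α`; it is the image of `ν ∘ α` under the inversion. -/
def HaarSystem.compTilde (α : HaarSystem X) (ν : Measure X) : Measure (Arr X) :=
  (α.comp ν).map Arr.inverse

/-- A measure on the arrow space is symmetric if it is equivalent to its image under inversion. -/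
def IsSymmetricMeasure (μ : Measure (Arr X)) : Prop :=
  μ ≪ μ.map Arr.inverse ∧ μ.map Arr.inverse ≪ μ

end Haar

/-! ### Upper semicontinuous fields -/

/-- `Γ` is the space of all continuous sections of an upper semicontinuous field of Banach spaces
over `B` with fibres `E b`. -/
structure IsBanachField {B : Type*} [TopologicalSpace B] {E : B → Type*}
    [∀ b, NormedAddCommGroup (E b)] [∀ b, NormedSpace ℂ (E b)] (Γ : Submodule ℂ (∀ b, E b)) :
    Prop where
  exists_eq : ∀ (b : B) (e : E b), ∃ f ∈ Γ, f b = e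
  upperSemicontinuous : ∀ f ∈ Γ, UpperSemicontinuous fun b => ‖f b‖
  of_locally_approx : ∀ f : ∀ b, E b,
    (∀ (b : B) (ε : ℝ), 0 < ε → ∃ e ∈ Γ, ∀ᶠ b' in 𝓝 b, ‖f b' - e b'‖ < ε) → f ∈ Γ

/-- An upper semicontinuous field of C*-algebras over `B` with fibres `A b`, given by its continuous
sections, which are closed under the pointwise operations. -/
structure CStarField {B : Type*} [TopologicalSpace B] (A : B → Type*)
    [∀ b, NonUnitalCStarAlgebra (A b)] where
  sections : NonUnitalStarSubalgebra ℂ (∀ b, A b)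
  isBanachField : IsBanachField sections.toSubmodule

/-- Continuity of a section `η` of the pull-back of a field of C*-algebras along `p`. -/
def CStarField.IsContSection {B : Type*} [TopologicalSpace B] {A : B → Type*}
    [∀ b, NonUnitalCStarAlgebra (A b)] (F : CStarField A) {Y : Type*} [TopologicalSpace Y]
    (p : Y → B) (η : ∀ y, A (p y)) : Prop :=
  ∀ (y : Y) (ε : ℝ), 0 < ε → ∃ e ∈ F.sections, ∀ᶠ y' in 𝓝 y, ‖η y' - e (p y')‖ < ε

/-- A section of a field of normed spaces vanishes at infinity. -/
def VanishesAtInfinity {B : Type*} [TopologicalSpace B] {E : B → Type*}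
    [∀ b, NormedAddCommGroup (E b)] (f : ∀ b, E b) : Prop :=
  ∀ ε : ℝ, 0 < ε → ∃ K : Set B, IsCompact K ∧ ∀ b ∉ K, ‖f b‖ < ε

/-- A section of a field of normed spaces has compact support. -/
def HasCompactSupp {B : Type*} [TopologicalSpace B] {E : B → Type*}
    [∀ b, NormedAddCommGroup (E b)] (f : ∀ b, E b) : Prop :=
  ∃ K : Set B, IsCompact K ∧ ∀ b ∉ K, f b = 0

/-! ### Fell bundles -/

/-- A Fell bundle over a topological groupoid: an upper semicontinuous field of Banach spaces over
the arrow space with a multiplication and an involution.  Identities between elements of fibres over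
arrows that are equal, but not by definition, are stated as heterogeneous equalities. -/
structure FellBundle (X : Type u) [Groupoid.{v} X] [TopologicalSpace (Arr X)] where
  fib : ∀ {x y : X}, (x ⟶ y) → Type t
  [normedGroup : ∀ {x y : X} (g : x ⟶ y), NormedAddCommGroup (fib g)]
  [normedSpace : ∀ {x y : X} (g : x ⟶ y), NormedSpace ℂ (fib g)]
  [complete : ∀ {x y : X} (g : x ⟶ y), CompleteSpace (fib g)]
  /-- the continuous sections of the field -/
  sections : Submodule ℂ (∀ g : Arr X, fib g.hom)
  isBanachField : IsBanachField sections
  mul : ∀ {x y z : X} {g : y ⟶ z} {h : x ⟶ y}, fib g →ₗ[ℂ] fib h →ₗ[ℂ] fib (h ≫ g)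
  invol : ∀ {x y : X} {g : x ⟶ y}, fib g →ₗ⋆[ℂ] fib (inv g)
  mul_assoc : ∀ {v x y z : X} {g : y ⟶ z} {h : x ⟶ y} {k : v ⟶ x} (a : fib g) (b : fib h)
    (c : fib k), HEq (mul (mul a b) c) (mul a (mul b c))
  invol_mul : ∀ {x y z : X} {g : y ⟶ z} {h : x ⟶ y} (a : fib g) (b : fib h),
    HEq (invol (mul a b)) (mul (invol b) (invol a))
  invol_invol : ∀ {x y : X} {g : x ⟶ y} (a : fib g), HEq (invol (invol a)) a
  norm_mul_le : ∀ {x y z : X} {g : y ⟶ z} {h : x ⟶ y} (a : fib g) (b : fib h),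
    ‖mul a b‖ ≤ ‖a‖ * ‖b‖
  norm_invol_mul_self : ∀ {x y : X} {g : x ⟶ y} (a : fib g), ‖mul (invol a) a‖ = ‖a‖ ^ 2
  positive : ∀ {x y : X} {g : x ⟶ y} (a : fib g), ∃ b : fib (𝟙 x),
    HEq (mul (invol b) b) (mul (invol a) a)
  /-- continuity of the multiplication -/
  mul_continuous : ∀ f₁ ∈ sections, ∀ f₂ ∈ sections, ∀ (p : CompPair X) (ε : ℝ), 0 < ε →
    ∃ f ∈ sections, ∀ᶠ q in 𝓝 p, ‖mul (g := q.fst) (h := q.snd) (f₁ q.left) (f₂ q.right) - f q.prod‖ < ε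
  /-- continuity of the involution -/
  invol_continuous : ∀ f₁ ∈ sections, ∀ (g : Arr X) (ε : ℝ), 0 < ε →
    ∃ f ∈ sections, ∀ᶠ g' in 𝓝 g, ‖invol (g := g'.hom) (f₁ g') - f g'.inverse‖ < ε

attribute [instance] FellBundle.normedGroup FellBundle.normedSpace FellBundle.complete

/-! ### Twisted partial actions -/

/-- Closed two-sided ideals in a C*-algebra (these are always self-adjoint). -/
structure IsClosedIdeal {B : Type*} [NonUnitalCStarAlgebra B] (I : NonUnitalStarSubalgebra ℂ B) :
    Prop where
  isClosed : IsClosed (I : Set B)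
  mul_mem_left : ∀ (b : B) {a : B}, a ∈ I → b * a ∈ I
  mul_mem_right : ∀ (b : B) {a : B}, a ∈ I → a * b ∈ I

instance {B : Type*} [NonUnitalCStarAlgebra B] (I : NonUnitalStarSubalgebra ℂ B) :
    NormedStarGroup I where
  norm_star_le a := (norm_star (a : B)).le

section Multiplier

variable {B : Type*} [NonUnitalCStarAlgebra B] {J : NonUnitalStarSubalgebra ℂ B}

open Classical in
/-- Left multiplication `b ↦ m · b` by a multiplier of `J`, for `b ∈ J` (extended by `0`). -/
def multL (m : 𝓜(ℂ, J)) (b : B) : B := if hb : b ∈ J then (m.fst ⟨b, hb⟩ : B) else 0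

open Classical in
/-- Right multiplication `b ↦ b · m` by a multiplier of `J`, for `b ∈ J` (extended by `0`). -/
def multR (m : 𝓜(ℂ, J)) (b : B) : B := if hb : b ∈ J then (m.snd ⟨b, hb⟩ : B) else 0

end Multiplier

/-- The data of a twisted partial action: a field of C*-algebras over the objects, ideals `D_g` in
the fibre at `r(g)`, isomorphisms `D_{g⁻¹} ≃ D_g` and unitary multipliers of `D_g ∩ D_{gh}`. -/
structure TwistedPartialActionData (X : Type u) [Groupoid.{v} X] [TopologicalSpace X]
    (A : X → Type t) [∀ x, NonUnitalCStarAlgebra (A x)] where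
  field : CStarField A
  D : ∀ {x y : X}, (x ⟶ y) → NonUnitalStarSubalgebra ℂ (A y)
  iso : ∀ {x y : X} (g : x ⟶ y), D (inv g) ≃⋆ₐ[ℂ] D g
  w : ∀ {x y z : X} (g : y ⟶ z) (h : x ⟶ y), unitary 𝓜(ℂ, ↥(D g ⊓ D (h ≫ g)))

namespace TwistedPartialActionData

variable {X : Type u} [Groupoid.{v} X] [TopologicalSpace X]
    {A : X → Type t} [∀ x, NonUnitalCStarAlgebra (A x)] (T : TwistedPartialActionData X A)

open Classical in
/-- The partial map `𝔞_g` with domain `D_{g⁻¹}` (extended by `0`). -/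
def act {x y : X} (g : x ⟶ y) (a : A x) : A y :=
  if ha : a ∈ T.D (inv g) then (T.iso g ⟨a, ha⟩ : A y) else 0

open Classical in
/-- The partial map `𝔞_g⁻¹` with domain `D_g` (extended by `0`). -/
def actInv {x y : X} (g : x ⟶ y) (a : A y) : A x :=
  if ha : a ∈ T.D g then ((T.iso g).symm ⟨a, ha⟩ : A x) else 0

/-- `b ↦ w(g, h) · b` on `D_g ∩ D_{gh}`. -/
def wL {x y z : X} (g : y ⟶ z) (h : x ⟶ y) (b : A z) : A z := multL (T.w g h).1 b

/-- `b ↦ b · w(g, h)` on `D_g ∩ D_{gh}`. -/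
def wR {x y z : X} (g : y ⟶ z) (h : x ⟶ y) (b : A z) : A z := multR (T.w g h).1 b

/-- `b ↦ b · w(g, h)^*` on `D_g ∩ D_{gh}`. -/
def wRstar {x y z : X} (g : y ⟶ z) (h : x ⟶ y) (b : A z) : A z := multR (star (T.w g h).1) b

end TwistedPartialActionData

/-- Twisted partial actions of a topological groupoid. -/
structure TwistedPartialAction (X : Type u) [Groupoid.{v} X] [TopologicalSpace X]
    [TopologicalSpace (Arr X)] (A : X → Type t) [∀ x, NonUnitalCStarAlgebra (A x)]
    extends TwistedPartialActionData X A where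
  isClosedIdeal : ∀ {x y : X} (g : x ⟶ y), IsClosedIdeal (D g)
  D_unit : ∀ x : X, D (𝟙 x) = ⊤
  act_unit : ∀ (x : X) (a : A x), toTwistedPartialActionData.act (𝟙 x) a = a
  w_unit_right : ∀ {x y : X} (g : x ⟶ y), w g (𝟙 x) = 1
  w_unit_left : ∀ {x y : X} (g : x ⟶ y), w (𝟙 y) g = 1
  act_mem : ∀ {x y z : X} (g : y ⟶ z) (h : x ⟶ y), ∀ a ∈ D (inv g) ⊓ D h,
    toTwistedPartialActionData.act g a ∈ D (h ≫ g)
  act_act : ∀ {x y z : X} (g : y ⟶ z) (h : x ⟶ y),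
    ∀ a ∈ toTwistedPartialActionData.act (inv h) '' (D (inv g) ⊓ D h : NonUnitalStarSubalgebra ℂ _),
      toTwistedPartialActionData.act g (toTwistedPartialActionData.act h a) =
        toTwistedPartialActionData.wL g h
          (toTwistedPartialActionData.wRstar g h (toTwistedPartialActionData.act (h ≫ g) a))
  cocycle : ∀ {v x y z : X} (g : y ⟶ z) (h : x ⟶ y) (k : v ⟶ x),
    ∀ a ∈ D (inv g) ⊓ D h ⊓ D (k ≫ h),
      toTwistedPartialActionData.wR g (k ≫ h)
        (toTwistedPartialActionData.act g (toTwistedPartialActionData.wR h k a)) =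
      toTwistedPartialActionData.wR (h ≫ g) k
        (toTwistedPartialActionData.wR g h (toTwistedPartialActionData.act g a))
  /-- the ideals `D_g` form a continuous family of ideals in the pull-back along the range map -/
  D_continuous : ∀ (g : Arr X), ∀ a ∈ D g.hom, ∃ f : ∀ g : Arr X, A g.rng,
    field.IsContSection Arr.rng f ∧ (∀ g', f g' ∈ D g'.hom) ∧ f g = a
  /-- the isomorphisms `𝔞_g` combine to an isomorphism of fields `inv^* D ≅ D` -/
  act_continuous : ∀ f : ∀ g : Arr X, A g.src, (∀ g, f g ∈ D (inv g.hom)) →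
    (field.IsContSection Arr.src f ↔
      field.IsContSection Arr.rng fun g => toTwistedPartialActionData.act g.hom (f g))
  /-- the unitaries `w(g, h)` form a multiplier of the field of ideals `D_g ∩ D_{gh}` over the
  space of composable pairs -/
  w_continuous : ∀ f : ∀ p : CompPair X, A p.z,
    (∀ p, f p ∈ D p.fst ⊓ D (p.snd ≫ p.fst)) → field.IsContSection CompPair.z f →
      (field.IsContSection CompPair.z
          fun p => toTwistedPartialActionData.wL p.fst p.snd (f p)) ∧
        field.IsContSection CompPair.z
          fun p => toTwistedPartialActionData.wR p.fst p.snd (f p)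

/-! ### The Fell bundle associated to a twisted partial action -/

section MultiplierLemmas

variable {B : Type*} [NonUnitalCStarAlgebra B]

theorem IsClosedIdeal.inf {I J : NonUnitalStarSubalgebra ℂ B} (hI : IsClosedIdeal I)
    (hJ : IsClosedIdeal J) : IsClosedIdeal (I ⊓ J) where
  isClosed := hI.isClosed.inter hJ.isClosed
  mul_mem_left b _ ha := ⟨hI.mul_mem_left b ha.1, hJ.mul_mem_left b ha.2⟩
  mul_mem_right b _ ha := ⟨hI.mul_mem_right b ha.1, hJ.mul_mem_right b ha.2⟩

theorem eq_of_forall_mul_right {J : NonUnitalStarSubalgebra ℂ B} {a b : B} (ha : a ∈ J)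
    (hb : b ∈ J) (h : ∀ e ∈ J, a * e = b * e) : a = b := by
  have h1 := h (star (a - b)) (star_mem (sub_mem ha hb))
  rw [← sub_eq_zero, ← sub_mul, CStarRing.mul_star_self_eq_zero_iff] at h1
  exact sub_eq_zero.mp h1

theorem eq_of_forall_mul_left {J : NonUnitalStarSubalgebra ℂ B} {a b : B} (ha : a ∈ J)
    (hb : b ∈ J) (h : ∀ e ∈ J, e * a = e * b) : a = b := by
  have h1 := h (star (a - b)) (star_mem (sub_mem ha hb))
  rw [← sub_eq_zero, ← mul_sub, CStarRing.star_mul_self_eq_zero_iff] at h1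
  exact sub_eq_zero.mp h1

variable {J : NonUnitalStarSubalgebra ℂ B} (m : 𝓜(ℂ, J))

theorem multL_of_mem {b : B} (hb : b ∈ J) : multL m b = m.fst ⟨b, hb⟩ := dif_pos hb

theorem multR_of_mem {b : B} (hb : b ∈ J) : multR m b = m.snd ⟨b, hb⟩ := dif_pos hb

theorem multL_mem (b : B) : multL m b ∈ J := by
  unfold multL; split_ifs with h
  exacts [Subtype.coe_prop _, zero_mem _]

theorem multR_mem (b : B) : multR m b ∈ J := by
  unfold multR; split_ifs with h
  exacts [Subtype.coe_prop _, zero_mem _]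

theorem mult_central {a b : B} (ha : a ∈ J) (hb : b ∈ J) : multR m a * b = a * multL m b := by
  rw [multL_of_mem m hb, multR_of_mem m ha]
  exact congrArg Subtype.val (m.central ⟨a, ha⟩ ⟨b, hb⟩)

theorem multR_add {a b : B} (ha : a ∈ J) (hb : b ∈ J) :
    multR m (a + b) = multR m a + multR m b := by
  rw [multR_of_mem m ha, multR_of_mem m hb, multR_of_mem m (add_mem ha hb)]
  exact congrArg Subtype.val (m.snd.map_add ⟨a, ha⟩ ⟨b, hb⟩)

theorem multR_smul (c : ℂ) {a : B} (ha : a ∈ J) : multR m (c • a) = c • multR m a := by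
  rw [multR_of_mem m ha, multR_of_mem m (SMulMemClass.smul_mem c ha)]
  exact congrArg Subtype.val (m.snd.map_smul c ⟨a, ha⟩)

theorem multR_sub {a b : B} (ha : a ∈ J) (hb : b ∈ J) :
    multR m (a - b) = multR m a - multR m b := by
  rw [multR_of_mem m ha, multR_of_mem m hb, multR_of_mem m (sub_mem ha hb)]
  exact congrArg Subtype.val (m.snd.map_sub ⟨a, ha⟩ ⟨b, hb⟩)

theorem star_multL {a : B} (ha : a ∈ J) : star (multL m a) = multR (star m) (star a) := by
  rw [multL_of_mem m ha, multR_of_mem _ (star_mem ha)]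
  change _ = ((star (m.fst (star (star (⟨a, ha⟩ : J)))) : J) : B)
  rw [star_star]; rfl

theorem star_multR {a : B} (ha : a ∈ J) : star (multR m a) = multL (star m) (star a) := by
  rw [multR_of_mem m ha, multL_of_mem _ (star_mem ha)]
  change _ = ((star (m.snd (star (star (⟨a, ha⟩ : J)))) : J) : B)
  rw [star_star]; rfl

theorem multR_mul_right (hJ : IsClosedIdeal J) (b : B) {a : B} (ha : a ∈ J) :
    multR m (b * a) = b * multR m a := by
  refine eq_of_forall_mul_right (multR_mem _ _) (hJ.mul_mem_left _ (multR_mem _ _)) fun e he => ?_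
  rw [mult_central m (hJ.mul_mem_left b ha) he, mul_assoc, mul_assoc, mult_central m ha he]

theorem multL_mul_left (hJ : IsClosedIdeal J) (b : B) {a : B} (ha : a ∈ J) :
    multL m (a * b) = multL m a * b := by
  refine eq_of_forall_mul_left (multL_mem _ _) (hJ.mul_mem_right _ (multL_mem _ _)) fun e he => ?_
  rw [← mult_central m he (hJ.mul_mem_right b ha), ← mul_assoc, ← mul_assoc, mult_central m he ha]

theorem multR_multL (hJ : IsClosedIdeal J) (n : 𝓜(ℂ, J)) {a : B} (ha : a ∈ J) :
    multR n (multL m a) = multL m (multR n a) := by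
  refine eq_of_forall_mul_right (multR_mem _ _) (multL_mem _ _) fun e he => ?_
  rw [mult_central n (multL_mem _ _) he, ← multL_mul_left m hJ _ ha,
    ← multL_mul_left m hJ _ (multR_mem n a), mult_central n ha he]

theorem multR_mul (n : 𝓜(ℂ, J)) {a : B} (ha : a ∈ J) :
    multR (m * n) a = multR n (multR m a) := by
  rw [multR_of_mem _ ha, multR_of_mem n (multR_mem _ _)]
  simp only [multR_of_mem m ha]; rfl

theorem multL_mul (n : 𝓜(ℂ, J)) {a : B} (ha : a ∈ J) :
    multL (m * n) a = multL m (multL n a) := by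
  rw [multL_of_mem _ ha, multL_of_mem m (multL_mem _ _)]
  simp only [multL_of_mem n ha]; rfl

theorem multR_one {a : B} (ha : a ∈ J) : multR (1 : 𝓜(ℂ, J)) a = a := by
  rw [multR_of_mem _ ha]; rfl

theorem multL_one {a : B} (ha : a ∈ J) : multL (1 : 𝓜(ℂ, J)) a = a := by
  rw [multL_of_mem _ ha]; rfl

variable {m}

theorem multR_star_multR (hm : m ∈ unitary 𝓜(ℂ, J)) {a : B} (ha : a ∈ J) :
    multR (star m) (multR m a) = a := by
  rw [← multR_mul _ _ ha, Unitary.mul_star_self_of_mem hm, multR_one ha]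

theorem multR_multR_star (hm : m ∈ unitary 𝓜(ℂ, J)) {a : B} (ha : a ∈ J) :
    multR m (multR (star m) a) = a := by
  rw [← multR_mul _ _ ha, Unitary.star_mul_self_of_mem hm, multR_one ha]

theorem multL_star_multL (hm : m ∈ unitary 𝓜(ℂ, J)) {a : B} (ha : a ∈ J) :
    multL (star m) (multL m a) = a := by
  rw [← multL_mul _ _ ha, Unitary.star_mul_self_of_mem hm, multL_one ha]

theorem norm_multR (hm : m ∈ unitary 𝓜(ℂ, J)) {a : B} (ha : a ∈ J) : ‖multR m a‖ = ‖a‖ := by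
  have h : multR m a * star (multR m a) = a * star a := by
    rw [star_multR m ha, mult_central m ha (multL_mem _ _)]
    nth_rw 1 [show m = star (star m) by simp]
    rw [multL_star_multL (Unitary.star_mem hm) (star_mem ha)]
  have h2 := congrArg norm h
  rw [CStarRing.norm_self_mul_star, CStarRing.norm_self_mul_star] at h2
  nlinarith [norm_nonneg (multR m a), norm_nonneg a]

variable (m)

theorem mem_closure_mul (hJ : IsClosedIdeal J) {a : B} (ha : a ∈ J) :
    ∃ l : Filter J, l.NeBot ∧ Tendsto (fun e : J => (⟨a, ha⟩ : J) * e) l (𝓝 ⟨a, ha⟩) ∧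
      Tendsto (fun e : J => e * (⟨a, ha⟩ : J)) l (𝓝 ⟨a, ha⟩) := by
  have : IsClosed (J : Set B) := hJ.isClosed
  let : NonUnitalCStarAlgebra J := NonUnitalStarSubalgebra.nonUnitalCStarAlgebra J
  let : PartialOrder J := CStarAlgebra.spectralOrder J
  have : StarOrderedRing J := CStarAlgebra.spectralOrderedRing J
  have h := CStarAlgebra.increasingApproximateUnit J
  exact ⟨CStarAlgebra.approximateUnit J, inferInstance, h.tendsto_mul_left _,
    h.tendsto_mul_right _⟩

theorem multR_mem_ideal (hJ : IsClosedIdeal J) {I : NonUnitalStarSubalgebra ℂ B}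
    (hI : IsClosedIdeal I) {a : B} (ha : a ∈ J) (haI : a ∈ I) : multR m a ∈ I := by
  obtain ⟨l, hl, h1, -⟩ := mem_closure_mul hJ ha
  have h2 := (continuous_subtype_val.comp m.snd.continuous).continuousAt.tendsto.comp h1
  rw [multR_of_mem m ha]
  refine hI.isClosed.mem_of_tendsto h2 (Eventually.of_forall fun e => ?_)
  have := multR_mul_right m hJ a e.2
  rw [multR_of_mem m (hJ.mul_mem_left a e.2)] at this
  change ((m.snd (⟨a, ha⟩ * e) : J) : B) ∈ I
  change ((m.snd (⟨a, ha⟩ * e) : J) : B) = _ at this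
  rw [this]
  exact hI.mul_mem_right _ haI

theorem multL_mem_ideal (hJ : IsClosedIdeal J) {I : NonUnitalStarSubalgebra ℂ B}
    (hI : IsClosedIdeal I) {a : B} (ha : a ∈ J) (haI : a ∈ I) : multL m a ∈ I := by
  have h := multR_mem_ideal (star m) hJ hI (star_mem ha) (star_mem haI)
  rw [← star_multL m ha] at h
  simpa using star_mem h

end MultiplierLemmas

namespace TwistedPartialAction

variable {X : Type u} [Groupoid.{v} X] [TopologicalSpace X] [TopologicalSpace (Arr X)]
    {A : X → Type t} [∀ x, NonUnitalCStarAlgebra (A x)] (T : TwistedPartialAction X A)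

section algebra

variable {v x y z : X} (g : y ⟶ z) (h : x ⟶ y) (k : v ⟶ x)

theorem ideal_J : IsClosedIdeal (T.D g ⊓ T.D (h ≫ g)) :=
  (T.isClosedIdeal g).inf (T.isClosedIdeal _)

variable {g}

theorem act_of_mem {a : A y} (ha : a ∈ T.D (inv g)) : T.act g a = T.iso g ⟨a, ha⟩ := dif_pos ha

theorem actInv_of_mem {a : A z} (ha : a ∈ T.D g) : T.actInv g a = (T.iso g).symm ⟨a, ha⟩ :=
  dif_pos ha

variable (g)

theorem act_mem_D (a : A y) : T.act g a ∈ T.D g := by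
  unfold TwistedPartialActionData.act; split_ifs
  exacts [Subtype.coe_prop _, zero_mem _]

theorem actInv_mem_D (a : A z) : T.actInv g a ∈ T.D (inv g) := by
  unfold TwistedPartialActionData.actInv; split_ifs
  exacts [Subtype.coe_prop _, zero_mem _]

variable {g}

theorem act_actInv {a : A z} (ha : a ∈ T.D g) : T.act g (T.actInv g a) = a := by
  rw [T.act_of_mem (T.actInv_mem_D g a)]
  simp [T.actInv_of_mem ha]

theorem actInv_act {a : A y} (ha : a ∈ T.D (inv g)) : T.actInv g (T.act g a) = a := by
  rw [T.actInv_of_mem (T.act_mem_D g a)]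
  simp [T.act_of_mem ha]

theorem act_add {a b : A y} (ha : a ∈ T.D (inv g)) (hb : b ∈ T.D (inv g)) :
    T.act g (a + b) = T.act g a + T.act g b := by
  rw [T.act_of_mem ha, T.act_of_mem hb, T.act_of_mem (add_mem ha hb)]
  exact congrArg Subtype.val (map_add (T.iso g) ⟨a, ha⟩ ⟨b, hb⟩)

theorem act_sub {a b : A y} (ha : a ∈ T.D (inv g)) (hb : b ∈ T.D (inv g)) :
    T.act g (a - b) = T.act g a - T.act g b := by
  rw [T.act_of_mem ha, T.act_of_mem hb, T.act_of_mem (sub_mem ha hb)]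
  exact congrArg Subtype.val (map_sub (T.iso g) ⟨a, ha⟩ ⟨b, hb⟩)

theorem act_mul {a b : A y} (ha : a ∈ T.D (inv g)) (hb : b ∈ T.D (inv g)) :
    T.act g (a * b) = T.act g a * T.act g b := by
  rw [T.act_of_mem ha, T.act_of_mem hb, T.act_of_mem (mul_mem ha hb)]
  exact congrArg Subtype.val (map_mul (T.iso g) ⟨a, ha⟩ ⟨b, hb⟩)

theorem act_smul (c : ℂ) {a : A y} (ha : a ∈ T.D (inv g)) :
    T.act g (c • a) = c • T.act g a := by
  rw [T.act_of_mem ha, T.act_of_mem (SMulMemClass.smul_mem c ha)]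
  exact congrArg Subtype.val (map_smul (T.iso g) c ⟨a, ha⟩)

theorem act_star {a : A y} (ha : a ∈ T.D (inv g)) :
    T.act g (star a) = star (T.act g a) := by
  rw [T.act_of_mem ha, T.act_of_mem (star_mem ha)]
  exact congrArg Subtype.val (map_star (T.iso g) ⟨a, ha⟩)

theorem norm_act {a : A y} (ha : a ∈ T.D (inv g)) : ‖T.act g a‖ = ‖a‖ := by
  have := (T.isClosedIdeal g).isClosed
  have := (T.isClosedIdeal (inv g)).isClosed
  let : NonUnitalCStarAlgebra (T.D g) := NonUnitalStarSubalgebra.nonUnitalCStarAlgebra _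
  let : NonUnitalCStarAlgebra (T.D (inv g)) := NonUnitalStarSubalgebra.nonUnitalCStarAlgebra _
  rw [T.act_of_mem ha]
  exact NonUnitalStarAlgHom.norm_map (T.iso g) (T.iso g).injective ⟨a, ha⟩

theorem act_injOn {a b : A y} (ha : a ∈ T.D (inv g)) (hb : b ∈ T.D (inv g))
    (h : T.act g a = T.act g b) : a = b := by
  rw [← T.actInv_act ha, h, T.actInv_act hb]

theorem actInv_mul {a b : A z} (ha : a ∈ T.D g) (hb : b ∈ T.D g) :
    T.actInv g (a * b) = T.actInv g a * T.actInv g b := by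
  refine T.act_injOn (T.actInv_mem_D g _) (mul_mem (T.actInv_mem_D g _) (T.actInv_mem_D g _)) ?_
  rw [T.act_mul (T.actInv_mem_D g _) (T.actInv_mem_D g _), T.act_actInv ha, T.act_actInv hb,
    T.act_actInv (mul_mem ha hb)]

theorem actInv_add {a b : A z} (ha : a ∈ T.D g) (hb : b ∈ T.D g) :
    T.actInv g (a + b) = T.actInv g a + T.actInv g b := by
  refine T.act_injOn (T.actInv_mem_D g _) (add_mem (T.actInv_mem_D g _) (T.actInv_mem_D g _)) ?_
  rw [T.act_add (T.actInv_mem_D g _) (T.actInv_mem_D g _), T.act_actInv ha, T.act_actInv hb,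
    T.act_actInv (add_mem ha hb)]

theorem actInv_smul (c : ℂ) {a : A z} (ha : a ∈ T.D g) :
    T.actInv g (c • a) = c • T.actInv g a := by
  refine T.act_injOn (T.actInv_mem_D g _) (SMulMemClass.smul_mem c (T.actInv_mem_D g _)) ?_
  rw [T.act_smul c (T.actInv_mem_D g _), T.act_actInv ha, T.act_actInv (SMulMemClass.smul_mem c ha)]

theorem actInv_star {a : A z} (ha : a ∈ T.D g) :
    T.actInv g (star a) = star (T.actInv g a) := by
  refine T.act_injOn (T.actInv_mem_D g _) (star_mem (T.actInv_mem_D g _)) ?_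
  rw [T.act_star (T.actInv_mem_D g _), T.act_actInv ha, T.act_actInv (star_mem ha)]

theorem norm_actInv {a : A z} (ha : a ∈ T.D g) : ‖T.actInv g a‖ = ‖a‖ := by
  rw [← T.norm_act (T.actInv_mem_D g a), T.act_actInv ha]

variable (g)

theorem w_unitary : (T.w g h).1 ∈ unitary 𝓜(ℂ, ↥(T.D g ⊓ T.D (h ≫ g))) := (T.w g h).2

theorem mem_inv_inv {a : A z} (ha : a ∈ T.D g) : a ∈ T.D (inv (inv g)) := by
  rwa [IsIso.inv_inv]

variable {g}

/-- `𝔞_{g⁻¹}(𝔞_g(a)) = w(g⁻¹, g) a w(g⁻¹, g)^*`. -/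
theorem act_inv_act {a : A y} (ha : a ∈ T.D (inv g)) :
    T.act (inv g) (T.act g a) = T.wL (inv g) g (T.wRstar (inv g) g a) := by
  have h1 := T.act_act (inv g) g a ⟨T.actInv (inv g) a,
    ⟨T.actInv_mem_D _ _, by simpa using T.actInv_mem_D (inv g) a⟩, T.act_actInv ha⟩
  rw [h1, IsIso.hom_inv_id, T.act_unit]

theorem mem_J_inv {a : A y} (ha : a ∈ T.D (inv g)) : a ∈ T.D (inv g) ⊓ T.D (g ≫ inv g) :=
  ⟨ha, by rw [IsIso.hom_inv_id, T.D_unit]; trivial⟩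

theorem actInv_mem {d : A z} (hd : d ∈ T.D g) (hd' : d ∈ T.D (h ≫ g)) :
    T.actInv g d ∈ T.D h := by
  have h1 := T.act_mem (inv g) (h ≫ g) d ⟨T.mem_inv_inv g hd, hd'⟩
  rw [Category.assoc, IsIso.hom_inv_id, Category.comp_id] at h1
  have ha := T.actInv_mem_D g d
  have h2 := T.act_inv_act ha
  rw [T.act_actInv hd] at h2
  rw [h2] at h1
  have hJ := T.mem_J_inv ha
  have hm := T.w_unitary (inv g) g
  have hI := T.ideal_J (inv g) g
  have h3 := multL_mem_ideal (star (T.w (inv g) g).1) hI (T.isClosedIdeal h)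
    (multL_mem _ _) h1
  have h4 := multL_star_multL hm (multR_mem (star (T.w (inv g) g).1) (T.actInv g d))
  have h5 := multR_mem_ideal (T.w (inv g) g).1 hI (T.isClosedIdeal h) (multL_mem _ _) h3
  change multR _ (multL _ (multL _ (multR _ _))) ∈ _ at h5
  rw [h4, multR_multR_star hm hJ] at h5
  exact h5

variable {h}

theorem act_mem_left {n : A x} (hn : n ∈ T.D (inv h)) (hn' : n ∈ T.D (inv (h ≫ g))) :
    T.act h n ∈ T.D (inv g) := by
  have h1 := T.act_mem h (inv (h ≫ g)) n ⟨hn, hn'⟩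
  simpa using h1

theorem act_comp_mem {n : A x} (hn : n ∈ T.D (inv h)) (hn' : n ∈ T.D (inv (h ≫ g))) :
    T.act (h ≫ g) n ∈ T.D g ⊓ T.D (h ≫ g) := by
  have h1 := T.act_mem (h ≫ g) (inv h) n ⟨hn', hn⟩
  rw [IsIso.inv_hom_id_assoc] at h1
  exact ⟨h1, T.act_mem_D _ _⟩

/-- `𝔞_g(𝔞_h(n)) w(g, h) = w(g, h) 𝔞_{gh}(n)`. -/
theorem wR_act_act {n : A x} (hn : n ∈ T.D (inv h)) (hn' : n ∈ T.D (inv (h ≫ g))) :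
    T.wR g h (T.act g (T.act h n)) = T.wL g h (T.act (h ≫ g) n) := by
  have h0 : T.actInv (inv h) n ∈ T.D (inv g) := by
    refine T.actInv_mem (inv g) hn ?_
    rwa [← IsIso.inv_comp]
  have h1 := T.act_act g h n ⟨T.actInv (inv h) n,
    ⟨h0, by simpa using T.actInv_mem_D (inv h) n⟩, T.act_actInv hn⟩
  rw [h1]
  have hz := T.act_comp_mem hn hn'
  have hI := T.ideal_J g h
  change multR _ (multL _ (multR _ _)) = multL _ _
  rw [multR_multL _ hI _ (multR_mem _ _), multR_multR_star (T.w_unitary g h) hz]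

theorem exists_act_comp {j : A z} (hj : j ∈ T.D g ⊓ T.D (h ≫ g)) :
    ∃ n ∈ T.D (inv h), n ∈ T.D (inv (h ≫ g)) ∧ T.act (h ≫ g) n = j := by
  refine ⟨T.actInv (h ≫ g) j, ?_, T.actInv_mem_D _ _, T.act_actInv hj.2⟩
  refine T.actInv_mem (inv h) hj.2 ?_
  rw [IsIso.inv_hom_id_assoc]
  exact hj.1

theorem act_mem_J {a : A y} (ha : a ∈ T.D (inv g)) (ha' : a ∈ T.D h) :
    T.act g a ∈ T.D g ⊓ T.D (h ≫ g) :=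
  ⟨T.act_mem_D _ _, T.act_mem g h a ⟨ha, ha'⟩⟩

variable (g h)

/-- The product `(a δ_g) · (b δ_h) = 𝔞_g(𝔞_g⁻¹(a) b) w(g, h) δ_{gh}`. -/
def pmul (a : A z) (b : A y) : A z := T.wR g h (T.act g (T.actInv g a * b))

/-- The involution `(a δ_g)^* = 𝔞_g⁻¹(a^*) w(g⁻¹, g)^* δ_{g⁻¹}`. -/
def pinv (a : A z) : A y := T.wRstar (inv g) g (T.actInv g (star a))

variable {g h}

theorem dom_left (a : A z) (b : A y) : T.actInv g a * b ∈ T.D (inv g) :=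
  (T.isClosedIdeal (inv g)).mul_mem_right _ (T.actInv_mem_D g a)

theorem pmul_mem_J (a : A z) (b : A y) : T.pmul g h a b ∈ T.D g ⊓ T.D (h ≫ g) := multR_mem _ _

theorem pmul_mem (a : A z) (b : A y) : T.pmul g h a b ∈ T.D (h ≫ g) := (T.pmul_mem_J a b).2

theorem dom_right (a : A z) {b : A y} (hb : b ∈ T.D h) : T.actInv g a * b ∈ T.D h :=
  (T.isClosedIdeal h).mul_mem_left _ hb

theorem act_dom_mem (a : A z) {b : A y} (hb : b ∈ T.D h) :
    T.act g (T.actInv g a * b) ∈ T.D g ⊓ T.D (h ≫ g) :=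
  T.act_mem_J (T.dom_left a b) (T.dom_right a hb)

theorem pinv_mem (a : A z) : T.pinv g a ∈ T.D (inv g) := by
  have h1 := multR_mem (star (T.w (inv g) g).1) (T.actInv g (star a))
  exact h1.1

/-- `(a δ_g) 𝔞_{gh}(n) = 𝔞_g(𝔞_g⁻¹(a) b 𝔞_h(n)) w(g, h)` if `n` is in the domain of
`𝔞_g ∘ 𝔞_h`. -/
theorem pmul_mul_act (a : A z) {b : A y} (hb : b ∈ T.D h) {n : A x} (hn : n ∈ T.D (inv h))
    (hn' : n ∈ T.D (inv (h ≫ g))) :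
    T.pmul g h a b * T.act (h ≫ g) n = T.wR g h (T.act g (T.actInv g a * b * T.act h n)) := by
  have hz := T.act_comp_mem hn hn'
  have hI := T.ideal_J g h
  have h1 := T.act_mem_left hn hn'
  have h2 : T.act g (T.act h n) ∈ T.D g ⊓ T.D (h ≫ g) := T.act_mem_J h1 (T.act_mem_D _ _)
  rw [T.act_mul (T.dom_left a b) h1]
  change multR _ _ * _ = multR _ _
  rw [mult_central _ (T.act_dom_mem a hb) hz, multR_mul_right _ hI _ h2]
  exact congrArg _ (T.wR_act_act hn hn').symm

theorem pmul_assoc {a : A z} {b : A y} (hb : b ∈ T.D h) {c : A x} (hc : c ∈ T.D k) :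
    T.pmul (h ≫ g) k (T.pmul g h a b) c = T.pmul g (k ≫ h) a (T.pmul h k b c) := by
  have hI := T.ideal_J g h
  have hbc := T.act_dom_mem (g := h) (h := k) b hc
  have hm1 : T.actInv g a * T.act h (T.actInv h b * c) ∈ T.D (inv g) := T.dom_left _ _
  have hm2 : T.actInv g a * T.act h (T.actInv h b * c) ∈ T.D h ⊓ T.D (k ≫ h) :=
    (T.ideal_J h k).mul_mem_left _ hbc
  have hY : T.pmul g (k ≫ h) a (T.pmul h k b c) =
      T.wR (h ≫ g) k (T.wR g h (T.act g (T.actInv g a * T.act h (T.actInv h b * c)))) := by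
    rw [← T.cocycle g h k _ ⟨⟨hm1, hm2.1⟩, hm2.2⟩]
    refine congrArg (fun e => T.wR g (k ≫ h) (T.act g e)) ?_
    exact (multR_mul_right _ (T.ideal_J h k) _ hbc).symm
  rw [hY]
  refine congrArg (T.wR (h ≫ g) k) ?_
  set t := T.actInv (h ≫ g) (T.pmul g h a b) with ht
  have htd : t ∈ T.D (inv (h ≫ g)) := T.actInv_mem_D _ _
  have ht' : t ∈ T.D (inv h) := by
    refine T.actInv_mem (inv h) (T.pmul_mem_J a b).2 ?_
    rw [IsIso.inv_hom_id_assoc]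
    exact (T.pmul_mem_J a b).1
  have htc1 : t * c ∈ T.D (inv h) := (T.isClosedIdeal _).mul_mem_right _ ht'
  have htc2 : t * c ∈ T.D (inv (h ≫ g)) := (T.isClosedIdeal _).mul_mem_right _ htd
  refine eq_of_forall_mul_right (T.act_comp_mem htc1 htc2) (multR_mem _ _) fun f hf => ?_
  obtain ⟨n, hn, hn', rfl⟩ := T.exists_act_comp hf
  have hcn : c * n ∈ T.D (inv h) := (T.isClosedIdeal _).mul_mem_left _ hn
  have hcn' : c * n ∈ T.D (inv (h ≫ g)) := (T.isClosedIdeal _).mul_mem_left _ hn'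
  have hL : T.act (h ≫ g) (t * c) * T.act (h ≫ g) n =
      T.pmul g h a b * T.act (h ≫ g) (c * n) := by
    rw [← T.act_mul htc2 hn', mul_assoc, T.act_mul htd hcn', ht, T.act_actInv (T.pmul_mem a b)]
  rw [hL, T.pmul_mul_act a hb hcn hcn']
  have h1 := T.act_mem_left hn hn'
  have h2 : T.act g (T.act h n) ∈ T.D g ⊓ T.D (h ≫ g) := T.act_mem_J h1 (T.act_mem_D _ _)
  have hR : T.wR g h (T.act g (T.actInv g a * T.act h (T.actInv h b * c))) *
      T.act (h ≫ g) n = T.wR g h (T.act g (T.actInv g a * T.act h (T.actInv h b * c) *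
        T.act h n)) := by
    rw [T.act_mul hm1 h1]
    change multR _ _ * _ = multR _ _
    rw [mult_central _ (T.act_mem_J hm1 hm2.1) (T.act_comp_mem hn hn'),
      multR_mul_right _ hI _ h2]
    exact congrArg _ (T.wR_act_act hn hn').symm
  rw [hR]
  have e1 : b * T.act h (c * n) = T.act h (T.actInv h b * (c * n)) := by
    rw [T.act_mul (T.actInv_mem_D _ _) hcn, T.act_actInv hb]
  have e2 : T.act h (T.actInv h b * c) * T.act h n = T.act h (T.actInv h b * (c * n)) := by
    rw [← T.act_mul (T.dom_left _ _) hn, mul_assoc]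
  rw [mul_assoc, e1, mul_assoc, e2]

theorem pmul_injOn {b : A y} (hb : b ∈ T.D h) {a' b' : A z}
    (hE : T.pmul g h a' b = T.pmul g h b' b) :
    T.actInv g a' * b = T.actInv g b' * b := by
  have hw := T.w_unitary g h
  have h1 := congrArg (multR (star (T.w g h).1)) hE
  change multR _ (multR _ _) = multR _ (multR _ _) at h1
  rw [multR_star_multR hw (T.act_dom_mem a' hb), multR_star_multR hw (T.act_dom_mem b' hb)] at h1
  exact T.act_injOn (T.dom_left _ _) (T.dom_left _ _) h1

theorem pmul_unit {b : A y} {e : A y} (he : e ∈ T.D h) : T.pmul (𝟙 y) h b e = b * e := by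
  have hb : b ∈ T.D (𝟙 y) := by rw [T.D_unit]; trivial
  have h0 : T.actInv (𝟙 y) b = b := by
    have := T.act_actInv hb
    rwa [T.act_unit] at this
  unfold pmul
  rw [T.act_unit, h0]
  unfold TwistedPartialActionData.wR
  rw [T.w_unit_left]
  refine multR_one ⟨by rw [T.D_unit]; trivial, ?_⟩
  rw [Category.comp_id]
  exact (T.isClosedIdeal h).mul_mem_left _ he

theorem wR_unit {a : A z} (ha : a ∈ T.D g) : T.wR g (𝟙 y) a = a := by
  unfold TwistedPartialActionData.wR
  rw [T.w_unit_right]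
  exact multR_one ⟨ha, by rwa [Category.id_comp]⟩

theorem wR_unit_left {a : A z} (ha : a ∈ T.D g) : T.wR (𝟙 z) g a = a := by
  unfold TwistedPartialActionData.wR
  rw [T.w_unit_left]
  exact multR_one ⟨by rw [T.D_unit]; trivial, by rwa [Category.comp_id]⟩

/-- `(a δ_g)^* · (c δ_g) = 𝔞_g⁻¹(a^* c)`. -/
theorem pmul_pinv {a c : A z} (ha : a ∈ T.D g) (hc : c ∈ T.D g) :
    T.pmul (inv g) g (T.pinv g a) c = T.actInv g (star a * c) := by
  have hI := T.ideal_J (inv g) g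
  have hw := T.w_unitary (inv g) g
  have hs := T.mem_J_inv (T.actInv_mem_D g (star a))
  have hc' := T.mem_J_inv (T.actInv_mem_D g c)
  have e1 : T.act (inv g) (T.actInv (inv g) (T.pinv g a) * c) =
      T.pinv g a * T.wL (inv g) g (T.wRstar (inv g) g (T.actInv g c)) := by
    rw [T.act_mul (T.actInv_mem_D _ _) (T.mem_inv_inv g hc), T.act_actInv (T.pinv_mem a),
      ← T.act_inv_act (T.actInv_mem_D g c), T.act_actInv hc]
  have e2 : T.pinv g a * T.wL (inv g) g (T.wRstar (inv g) g (T.actInv g c)) =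
      T.actInv g (star a) * T.wRstar (inv g) g (T.actInv g c) := by
    change multR _ _ * multL _ (multR _ _) = _ * multR _ _
    rw [← mult_central _ (multR_mem _ _) (multR_mem _ _), multR_multR_star hw hs]
  unfold pmul
  rw [e1, e2, T.actInv_mul (star_mem ha) hc]
  change multR _ (_ * multR _ _) = _
  rw [multR_mul_right _ hI _ (multR_mem _ _), multR_multR_star hw hc']

/-- `((a δ_g) · (b δ_h))^* · ((d δ_g) · (e δ_h)) = n δ`, where `𝔞_h(n) = b^* 𝔞_g⁻¹(a^* d) e`. -/
theorem star_pmul_mul {a d : A z} {b e : A y} (ha : a ∈ T.D g) (hb : b ∈ T.D h) (hd : d ∈ T.D g)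
    (he : e ∈ T.D h) :
    T.pmul (inv (h ≫ g)) (h ≫ g) (T.pinv (h ≫ g) (T.pmul g h a b)) (T.pmul g h d e) =
      T.actInv h (star b * (T.actInv g (star a * d) * e)) := by
  have hI := T.ideal_J g h
  have hw := T.w_unitary g h
  have hq : T.actInv g (star a * d) * e ∈ T.D h := (T.isClosedIdeal h).mul_mem_left _ he
  have hm : star b * (T.actInv g (star a * d) * e) ∈ T.D h :=
    (T.isClosedIdeal h).mul_mem_left _ hq
  have hm' : star b * (T.actInv g (star a * d) * e) ∈ T.D (inv g) :=
    (T.isClosedIdeal _).mul_mem_left _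
      ((T.isClosedIdeal _).mul_mem_right _ (T.actInv_mem_D _ _))
  have hn := T.actInv_mem_D h (star b * (T.actInv g (star a * d) * e))
  have hn' : T.actInv h (star b * (T.actInv g (star a * d) * e)) ∈ T.D (inv (h ≫ g)) := by
    refine T.actInv_mem _ hm ?_
    simpa using hm'
  have L : star (T.pmul g h a b) * T.pmul g h d e =
      T.act (h ≫ g) (T.actInv h (star b * (T.actInv g (star a * d) * e))) := by
    have hu := T.act_dom_mem (g := g) (h := h) a hb
    have hv := T.act_dom_mem (g := g) (h := h) d he
    have e1 : star (T.act g (T.actInv g a * b)) * T.act g (T.actInv g d * e) =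
        T.act g (T.act h (T.actInv h (star b * (T.actInv g (star a * d) * e)))) := by
      rw [T.act_actInv hm, ← T.act_star (T.dom_left a b),
        ← T.act_mul (star_mem (T.dom_left a b)) (T.dom_left d e), star_mul,
        T.actInv_mul (star_mem ha) hd, T.actInv_star ha]
      simp only [mul_assoc]
    change star (multR _ _) * multR _ _ = _
    rw [star_multR _ hu, ← multL_mul_left _ hI _ (star_mem hu),
      ← multR_mul_right _ hI _ hv, e1]
    have e2 := T.wR_act_act hn hn'
    change multR _ _ = multL _ _ at e2
    rw [e2, multL_star_multL hw (T.act_comp_mem hn hn')]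
  rw [T.pmul_pinv (T.pmul_mem a b) (T.pmul_mem d e), L, T.actInv_act hn']

/-- `((b δ_h)^* · (a δ_g)^*) · ((d δ_g) · (e δ_h)) = n δ`, where `𝔞_h(n) = b^* 𝔞_g⁻¹(a^* d) e`. -/
theorem pmul_pinv_mul {a d : A z} {b e : A y} (ha : a ∈ T.D g) (hb : b ∈ T.D h) (hd : d ∈ T.D g)
    (he : e ∈ T.D h) :
    T.pmul (inv (h ≫ g)) (h ≫ g) (T.pmul (inv h) (inv g) (T.pinv h b) (T.pinv g a))
      (T.pmul g h d e) = T.actInv h (star b * (T.actInv g (star a * d) * e)) := by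
  have hq : T.actInv g (star a * d) * e ∈ T.D h := (T.isClosedIdeal h).mul_mem_left _ he
  rw [IsIso.inv_comp, T.pmul_assoc (h ≫ g) (T.pinv_mem a) (T.pmul_mem d e),
    ← T.pmul_assoc h hd he, T.pmul_pinv ha hd, IsIso.hom_inv_id, T.pmul_unit he,
    Category.assoc, IsIso.hom_inv_id, Category.comp_id, T.pmul_pinv hb hq]

theorem eq_of_pmul_pmul_eq {y₁ y₂ : A x} (d1 : y₁ ∈ T.D (inv (h ≫ g))) (d1' : y₁ ∈ T.D (inv h))
    (d2 : y₂ ∈ T.D (inv (h ≫ g))) (d2' : y₂ ∈ T.D (inv h))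
    (key : ∀ d ∈ T.D g, ∀ e ∈ T.D h,
      T.pmul (inv (h ≫ g)) (h ≫ g) y₁ (T.pmul g h d e) =
        T.pmul (inv (h ≫ g)) (h ≫ g) y₂ (T.pmul g h d e)) : y₁ = y₂ := by
  have hI := T.ideal_J g h
  have hw := T.w_unitary g h
  have m1 : ∀ y' : A x, y' ∈ T.D (inv (h ≫ g)) → y' ∈ T.D (inv h) →
      T.actInv (inv (h ≫ g)) y' ∈ T.D g ⊓ T.D (h ≫ g) := by
    intro y' h1 h2
    refine ⟨T.actInv_mem g h1 (by simpa using h2), ?_⟩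
    have := T.actInv_mem_D (inv (h ≫ g)) y'
    rwa [IsIso.inv_inv] at this
  have h1 := m1 y₁ d1 d1'
  have h2 := m1 y₂ d2 d2'
  have fin : T.actInv (inv (h ≫ g)) y₁ = T.actInv (inv (h ≫ g)) y₂ := by
    refine eq_of_forall_mul_right h1 h2 fun j hj => ?_
    refine eq_of_forall_mul_right (hI.mul_mem_left _ hj) (hI.mul_mem_left _ hj) fun i hi => ?_
    have hi' : T.wRstar g h i ∈ T.D g ⊓ T.D (h ≫ g) := multR_mem _ _
    have he : T.actInv g (T.wRstar g h i) ∈ T.D h := T.actInv_mem h hi'.1 hi'.2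
    have hp : T.pmul g h j (T.actInv g (T.wRstar g h i)) = j * i := by
      unfold pmul
      rw [← T.actInv_mul hj.1 hi'.1, T.act_actInv (mul_mem hj.1 hi'.1)]
      change multR _ (j * multR _ i) = _
      rw [multR_mul_right _ hI _ (multR_mem _ _), multR_multR_star hw hi]
    have hk := key j hj.1 _ he
    rw [hp] at hk
    have := T.pmul_injOn (hI.mul_mem_left _ hi).2 hk
    rw [mul_assoc, mul_assoc, this]
  rw [← T.act_actInv d1, fin, T.act_actInv d2]

theorem pinv_pmul {a : A z} {b : A y} (ha : a ∈ T.D g) (hb : b ∈ T.D h) :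
    T.pinv (h ≫ g) (T.pmul g h a b) = T.pmul (inv h) (inv g) (T.pinv h b) (T.pinv g a) := by
  have hab := T.pmul_mem_J (g := g) (h := h) a b
  have d1 : T.pinv (h ≫ g) (T.pmul g h a b) ∈ T.D (inv (h ≫ g)) := T.pinv_mem _
  have d2 : T.pmul (inv h) (inv g) (T.pinv h b) (T.pinv g a) ∈ T.D (inv (h ≫ g)) := by
    rw [IsIso.inv_comp]; exact T.pmul_mem _ _
  have d2' : T.pmul (inv h) (inv g) (T.pinv h b) (T.pinv g a) ∈ T.D (inv h) := (T.pmul_mem_J _ _).1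
  have d1' : T.pinv (h ≫ g) (T.pmul g h a b) ∈ T.D (inv h) := by
    refine multR_mem_ideal _ (T.ideal_J (inv (h ≫ g)) (h ≫ g)) (T.isClosedIdeal _)
      (T.mem_J_inv (T.actInv_mem_D _ _)) ?_
    refine T.actInv_mem (inv h) (star_mem hab.2) ?_
    rw [IsIso.inv_hom_id_assoc]
    exact star_mem hab.1
  refine T.eq_of_pmul_pmul_eq d1 d1' d2 d2' fun d hd e he => ?_
  rw [T.star_pmul_mul ha hb hd he, T.pmul_pinv_mul ha hb hd he]

theorem pinv_pinv {a : A z} (ha : a ∈ T.D g) : T.pinv (inv g) (T.pinv g a) = a := by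
  set r := T.pinv (inv g) (T.pinv g a) with hr
  have hr0 : r ∈ T.D g := by
    have := T.pinv_mem (g := inv g) (T.pinv g a)
    rwa [IsIso.inv_inv] at this
  have hI := T.ideal_J (inv g) g
  have hw := T.w_unitary (inv g) g
  have key : ∀ c ∈ T.D (inv g), T.pmul g (inv g) r c = T.pmul g (inv g) a c := by
    intro c hc
    have h1 := T.pmul_pinv (T.pinv_mem a) hc
    have h1' : T.pmul g (inv g) r c = T.actInv (inv g) (star (T.pinv g a) * c) := by
      rw [← h1, IsIso.inv_inv]
    have ha' := T.actInv_mem_D g a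
    have hac : T.actInv g a * c ∈ T.D (inv g) := T.dom_left a c
    have hstar : star (T.pinv g a) * c = T.wL (inv g) g (T.actInv g a * c) := by
      change star (multR _ _) * c = multL _ _
      rw [T.actInv_star ha, star_multR _ (T.mem_J_inv (star_mem ha')), star_star, star_star,
        multL_mul_left _ hI _ (T.mem_J_inv ha')]
    set p := T.act g (T.actInv g a * c) with hp
    have hpD : p ∈ T.D g := T.act_mem_D _ _
    have hc2 := T.cocycle (inv g) g (inv g) p
      ⟨⟨T.mem_inv_inv g hpD, hpD⟩, by rw [IsIso.inv_hom_id, T.D_unit]; trivial⟩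
    rw [IsIso.inv_hom_id, IsIso.hom_inv_id, T.wR_unit (T.act_mem_D _ _)] at hc2
    have hR : T.wR (inv g) g (T.act (inv g) p) = T.wL (inv g) g (T.actInv g a * c) := by
      rw [hp, T.act_inv_act hac]
      change multR _ (multL _ (multR _ _)) = multL _ _
      rw [multR_multL _ hI _ (multR_mem _ _), multR_multR_star hw (T.mem_J_inv hac)]
    have hRD : T.wL (inv g) g (T.actInv g a * c) ∈ T.D (inv g) := by
      have h3 := multL_mem (T.w (inv g) g).1 (T.actInv g a * c)
      exact h3.1
    rw [hR, T.wR_unit_left hRD] at hc2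
    have hRD2 : T.wR g (inv g) p ∈ T.D g := by
      have h3 := multR_mem (T.w g (inv g)).1 p
      exact h3.1
    rw [h1', hstar, ← hc2, T.actInv_act (T.mem_inv_inv g hRD2)]
    rfl
  have fin : T.actInv g r = T.actInv g a := by
    refine eq_of_forall_mul_right (T.actInv_mem_D g r) (T.actInv_mem_D g a) fun c hc => ?_
    exact T.pmul_injOn hc (key c hc)
  rw [← T.act_actInv hr0, fin, T.act_actInv ha]

theorem norm_pmul_le {a : A z} {b : A y} (ha : a ∈ T.D g) (hb : b ∈ T.D h) :
    ‖T.pmul g h a b‖ ≤ ‖a‖ * ‖b‖ := by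
  change ‖multR _ _‖ ≤ _
  rw [norm_multR (T.w_unitary g h) (T.act_dom_mem a hb), T.norm_act (T.dom_left a b),
    ← T.norm_actInv ha]
  exact norm_mul_le _ _

end algebra

end TwistedPartialAction

namespace CStarField

variable {B : Type*} [TopologicalSpace B] {A : B → Type*} [∀ b, NonUnitalCStarAlgebra (A b)]
  {F : CStarField A} {Y : Type*} [TopologicalSpace Y] {p : Y → B}

theorem IsContSection.norm_lt {η : ∀ y, A (p y)} (hη : F.IsContSection p η) (hp : Continuous p)
    (y : Y) {r : ℝ} (hr : ‖η y‖ < r) : ∀ᶠ y' in 𝓝 y, ‖η y'‖ < r := by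
  obtain ⟨e, he, h1⟩ := hη y ((r - ‖η y‖) / 3) (by linarith)
  have h2 : ‖e (p y)‖ < r - (r - ‖η y‖) / 3 := by
    have := h1.self_of_nhds
    have h3 : ‖e (p y)‖ ≤ ‖η y‖ + ‖η y - e (p y)‖ := by
      have := norm_sub_le (η y) (η y - e (p y)); rwa [sub_sub_cancel] at this
    linarith
  have h3 := (hp.tendsto y).eventually (F.isBanachField.upperSemicontinuous e he (p y) _ h2)
  filter_upwards [h1, h3] with y' h4 h5
  have : ‖η y'‖ ≤ ‖η y' - e (p y')‖ + ‖e (p y')‖ := by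
    have := norm_add_le (η y' - e (p y')) (e (p y')); rwa [sub_add_cancel] at this
  linarith

theorem IsContSection.of_approx {η : ∀ y, A (p y)}
    (h : ∀ (y : Y) (ε : ℝ), 0 < ε → ∃ ζ : ∀ y, A (p y), F.IsContSection p ζ ∧
      ∀ᶠ y' in 𝓝 y, ‖η y' - ζ y'‖ < ε) : F.IsContSection p η := by
  intro y ε hε
  obtain ⟨ζ, hζ, h1⟩ := h y (ε / 2) (by linarith)
  obtain ⟨e, he, h2⟩ := hζ y (ε / 2) (by linarith)
  refine ⟨e, he, ?_⟩
  filter_upwards [h1, h2] with y' h3 h4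
  have := norm_add_le (η y' - ζ y') (ζ y' - e (p y'))
  rw [sub_add_sub_cancel] at this
  linarith

theorem IsContSection.comp {η : ∀ y, A (p y)} (hη : F.IsContSection p η) {Z : Type*}
    [TopologicalSpace Z] {f : Z → Y} (hf : Continuous f) :
    F.IsContSection (fun z => p (f z)) fun z => η (f z) := by
  intro z ε hε
  obtain ⟨e, he, h⟩ := hη (f z) ε hε
  exact ⟨e, he, (hf.tendsto z).eventually h⟩

theorem IsContSection.zero : F.IsContSection p fun _ => 0 := fun _ ε hε =>
  ⟨0, zero_mem _, Eventually.of_forall fun _ => by simpa using hε⟩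

theorem IsContSection.add {η ζ : ∀ y, A (p y)} (hη : F.IsContSection p η)
    (hζ : F.IsContSection p ζ) : F.IsContSection p fun y => η y + ζ y := by
  intro y ε hε
  obtain ⟨e, he, h1⟩ := hη y (ε / 2) (by linarith)
  obtain ⟨d, hd, h2⟩ := hζ y (ε / 2) (by linarith)
  refine ⟨e + d, add_mem he hd, ?_⟩
  filter_upwards [h1, h2] with y' h3 h4
  have := norm_add_le (η y' - e (p y')) (ζ y' - d (p y'))
  rw [Pi.add_apply, add_sub_add_comm]
  linarith

theorem IsContSection.smul (c : ℂ) {η : ∀ y, A (p y)} (hη : F.IsContSection p η) :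
    F.IsContSection p fun y => c • η y := by
  intro y ε hε
  obtain ⟨e, he, h1⟩ := hη y (ε / (‖c‖ + 1)) (by positivity)
  refine ⟨c • e, SMulMemClass.smul_mem c he, ?_⟩
  filter_upwards [h1] with y' h3
  rw [Pi.smul_apply, ← smul_sub, norm_smul]
  rw [lt_div_iff₀ (by positivity)] at h3
  nlinarith [norm_nonneg (η y' - e (p y')), norm_nonneg c]

theorem IsContSection.sub {η ζ : ∀ y, A (p y)} (hη : F.IsContSection p η)
    (hζ : F.IsContSection p ζ) : F.IsContSection p fun y => η y - ζ y := by
  simpa [sub_eq_add_neg] using hη.add (hζ.smul (-1))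

theorem IsContSection.star {η : ∀ y, A (p y)} (hη : F.IsContSection p η) :
    F.IsContSection p fun y => star (η y) := by
  intro y ε hε
  obtain ⟨e, he, h1⟩ := hη y ε hε
  refine ⟨Star.star e, star_mem he, ?_⟩
  filter_upwards [h1] with y' h3
  rw [Pi.star_apply, ← star_sub, norm_star]
  exact h3

theorem IsContSection.mul {η ζ : ∀ y, A (p y)} (hη : F.IsContSection p η)
    (hζ : F.IsContSection p ζ) (hp : Continuous p) : F.IsContSection p fun y => η y * ζ y := by
  intro y ε hε
  set M := ‖η y‖ + ‖ζ y‖ + 2 with hM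
  have hMpos : 0 < M := by
    have h1 := norm_nonneg (η y)
    have h2 := norm_nonneg (ζ y)
    rw [hM]; linarith
  set δ := min 1 (ε / (2 * M)) with hδ
  have hδ0 : 0 < δ := by positivity
  have hδ1 : δ ≤ 1 := min_le_left _ _
  have hδ2 : δ * (2 * M) ≤ ε := by
    rw [← le_div_iff₀ (by positivity)]; exact min_le_right _ _
  obtain ⟨e, he, h1⟩ := hη y δ hδ0
  obtain ⟨d, hd, h2⟩ := hζ y δ hδ0
  have b1 := hη.norm_lt hp y (r := ‖η y‖ + 1) (by linarith)
  have b2 := hζ.norm_lt hp y (r := ‖ζ y‖ + 1) (by linarith)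
  refine ⟨e * d, mul_mem he hd, ?_⟩
  filter_upwards [h1, h2, b1, b2] with y' h3 h4 h5 h6
  have e1 : η y' * ζ y' - (e * d) (p y') =
      (η y' - e (p y')) * ζ y' + e (p y') * (ζ y' - d (p y')) := by
    rw [Pi.mul_apply, sub_mul, mul_sub]; abel
  have h7 : ‖e (p y')‖ ≤ ‖η y'‖ + ‖η y' - e (p y')‖ := by
    have := norm_sub_le (η y') (η y' - e (p y')); rwa [sub_sub_cancel] at this
  rw [e1]
  refine (norm_add_le _ _).trans_lt ?_
  have h8 := norm_mul_le (η y' - e (p y')) (ζ y')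
  have h9 := norm_mul_le (e (p y')) (ζ y' - d (p y'))
  have h10 : ‖η y' - e (p y')‖ * ‖ζ y'‖ ≤ δ * (‖ζ y‖ + 1) :=
    mul_le_mul h3.le h6.le (norm_nonneg _) hδ0.le
  have h11 : ‖e (p y')‖ * ‖ζ y' - d (p y')‖ ≤ (‖η y‖ + 2) * δ :=
    mul_le_mul (by linarith) h4.le (norm_nonneg _) (by positivity)
  have h12 : 0 ≤ δ * ‖ζ y‖ := by positivity
  have h13 : 0 ≤ δ * ‖η y‖ := by positivity
  nlinarith

end CStarField

theorem CompPair.continuous_left {X : Type u} [Groupoid.{v} X] [TopologicalSpace (Arr X)] :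
    Continuous (CompPair.left : CompPair X → Arr X) :=
  continuous_fst.comp (continuous_induced_dom (f := fun p : CompPair X => (p.left, p.right)))

theorem CompPair.continuous_right {X : Type u} [Groupoid.{v} X] [TopologicalSpace (Arr X)] :
    Continuous (CompPair.right : CompPair X → Arr X) :=
  continuous_snd.comp (continuous_induced_dom (f := fun p : CompPair X => (p.left, p.right)))

namespace TwistedPartialAction

variable {X : Type u} [Groupoid.{v} X] [TopologicalSpace X] [TopologicalSpace (Arr X)]
    {A : X → Type t} [∀ x, NonUnitalCStarAlgebra (A x)] (T : TwistedPartialAction X A)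

section algebra

variable {x y z : X} {g : y ⟶ z} {h : x ⟶ y}

theorem heq_of_coe_eq {g g' : x ⟶ y} (e : g = g') {a : T.D g} {b : T.D g'}
    (hab : (a : A y) = b) : HEq a b := by
  subst e; exact heq_of_eq (Subtype.ext hab)

theorem pmul_add_left {a a' : A z} {b : A y} (ha : a ∈ T.D g) (ha' : a' ∈ T.D g)
    (hb : b ∈ T.D h) : T.pmul g h (a + a') b = T.pmul g h a b + T.pmul g h a' b := by
  unfold pmul
  rw [T.actInv_add ha ha', add_mul, T.act_add (T.dom_left _ _) (T.dom_left _ _)]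
  exact multR_add _ (T.act_dom_mem a hb) (T.act_dom_mem a' hb)

theorem pmul_add_right {a : A z} {b b' : A y} (hb : b ∈ T.D h) (hb' : b' ∈ T.D h) :
    T.pmul g h a (b + b') = T.pmul g h a b + T.pmul g h a b' := by
  unfold pmul
  rw [mul_add, T.act_add (T.dom_left _ _) (T.dom_left _ _)]
  exact multR_add _ (T.act_dom_mem a hb) (T.act_dom_mem a hb')

theorem pmul_smul_left (c : ℂ) {a : A z} {b : A y} (ha : a ∈ T.D g)
    (hb : b ∈ T.D h) : T.pmul g h (c • a) b = c • T.pmul g h a b := by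
  unfold pmul
  rw [T.actInv_smul c ha, smul_mul_assoc, T.act_smul c (T.dom_left _ _)]
  exact multR_smul _ c (T.act_dom_mem a hb)

theorem pmul_smul_right (c : ℂ) {a : A z} {b : A y} (hb : b ∈ T.D h) :
    T.pmul g h a (c • b) = c • T.pmul g h a b := by
  unfold pmul
  rw [mul_smul_comm, T.act_smul c (T.dom_left _ _)]
  exact multR_smul _ c (T.act_dom_mem a hb)

theorem pinv_add {a a' : A z} (ha : a ∈ T.D g) (ha' : a' ∈ T.D g) :
    T.pinv g (a + a') = T.pinv g a + T.pinv g a' := by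
  unfold pinv
  rw [star_add, T.actInv_add (star_mem ha) (star_mem ha')]
  exact multR_add _ (T.mem_J_inv (T.actInv_mem_D _ _)) (T.mem_J_inv (T.actInv_mem_D _ _))

theorem pinv_smul (c : ℂ) {a : A z} (ha : a ∈ T.D g) :
    T.pinv g (c • a) = star c • T.pinv g a := by
  unfold pinv
  rw [star_smul, T.actInv_smul _ (star_mem ha)]
  exact multR_smul _ _ (T.mem_J_inv (T.actInv_mem_D _ _))

end algebra

/-- The multiplication of the associated Fell bundle. -/
def fellMul {x y z : X} (g : y ⟶ z) (h : x ⟶ y) : T.D g →ₗ[ℂ] T.D h →ₗ[ℂ] T.D (h ≫ g) :=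
  LinearMap.mk₂ ℂ (fun a b => ⟨T.pmul g h a b, T.pmul_mem _ _⟩)
    (fun a a' b => Subtype.ext (T.pmul_add_left a.2 a'.2 b.2))
    (fun c a b => Subtype.ext (T.pmul_smul_left c a.2 b.2))
    (fun _ b b' => Subtype.ext (T.pmul_add_right b.2 b'.2))
    (fun c _ b => Subtype.ext (T.pmul_smul_right c b.2))

/-- The involution of the associated Fell bundle. -/
def fellInvol {x y : X} (g : x ⟶ y) : T.D g →ₗ⋆[ℂ] T.D (inv g) where
  toFun a := ⟨T.pinv g a, T.pinv_mem _⟩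
  map_add' a a' := Subtype.ext (T.pinv_add a.2 a'.2)
  map_smul' c a := Subtype.ext (T.pinv_smul c a.2)

/-- The continuous sections of the associated Fell bundle: the continuous sections of the pull-back
of the field of C*-algebras along the range map whose value at `g` belongs to `D_g`. -/
def fellSections : Submodule ℂ (∀ g : Arr X, T.D g.hom) where
  carrier := {f | T.field.IsContSection Arr.rng fun g => (f g : A g.rng)}
  add_mem' h1 h2 := h1.add h2
  zero_mem' := CStarField.IsContSection.zero
  smul_mem' c _ h1 := h1.smul c

theorem wRstar_contSection {F : ∀ q : CompPair X, A q.z}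
    (hF : T.field.IsContSection CompPair.z F)
    (hFJ : ∀ q, F q ∈ T.D q.fst ⊓ T.D (q.snd ≫ q.fst)) :
    T.field.IsContSection CompPair.z fun q : CompPair X => T.wRstar q.fst q.snd (F q) := by
  have hW := ((T.w_continuous _ (fun q => star_mem (hFJ q)) hF.star).1).star
  have e1 : (fun q : CompPair X => star (T.wL q.fst q.snd (star (F q)))) =
      fun q => T.wRstar q.fst q.snd (F q) := by
    funext q
    unfold TwistedPartialActionData.wL TwistedPartialActionData.wRstar
    rw [star_multL _ (star_mem (hFJ q)), star_star]
  rwa [e1] at hW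

theorem actInv_contSection {f : ∀ g : Arr X, A g.rng} (hf : T.field.IsContSection Arr.rng f)
    (hD : ∀ g, f g ∈ T.D g.hom) :
    T.field.IsContSection Arr.src fun g => T.actInv g.hom (f g) := by
  refine (T.act_continuous _ fun g => T.actInv_mem_D _ _).2 ?_
  simpa only [T.act_actInv (hD _)] using hf

variable [hG : IsTopologicalGroupoid X]

theorem fellSections_isBanachField : IsBanachField T.fellSections where
  exists_eq g a := by
    obtain ⟨f, hf, hD, hg⟩ := T.D_continuous g a a.2
    exact ⟨fun g' => ⟨f g', hD g'⟩, hf, Subtype.ext hg⟩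
  upperSemicontinuous f hf g r hr := by
    exact CStarField.IsContSection.norm_lt hf hG.continuous_rng g hr
  of_locally_approx f h := by
    refine CStarField.IsContSection.of_approx fun g ε hε => ?_
    obtain ⟨e, he, h1⟩ := h g ε hε
    exact ⟨_, he, h1⟩

/-- Pointwise application of `𝔞` preserves continuity of sections over composable pairs. -/
theorem act_contSection {m : ∀ q : CompPair X, A q.y}
    (hm : T.field.IsContSection CompPair.y m) (hD : ∀ q, m q ∈ T.D (inv q.fst)) :
    T.field.IsContSection CompPair.z fun q => T.act q.fst (m q) := by
  refine CStarField.IsContSection.of_approx fun q ε hε => ?_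
  obtain ⟨f, hf, hfD, hfq⟩ := T.D_continuous q.left.inverse (m q) (hD q)
  have h1 : T.field.IsContSection Arr.src fun g : Arr X => f g.inverse :=
    hf.comp hG.continuous_inverse
  have h2 := ((T.act_continuous (fun g : Arr X => f g.inverse) fun g => hfD g.inverse).1 h1).comp
    (CompPair.continuous_left (X := X))
  refine ⟨_, h2, ?_⟩
  have hy : Continuous (CompPair.y : CompPair X → X) :=
    hG.continuous_src.comp CompPair.continuous_left
  have h3 := (hm.sub (h1.comp (CompPair.continuous_left (X := X)))).norm_lt hy q (r := ε)
    (by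
      have : m q - f q.left.inverse = 0 := by rw [hfq, sub_self]
      change ‖m q - f q.left.inverse‖ < ε
      rwa [this, norm_zero])
  filter_upwards [h3] with q' h4
  have e1 := T.act_sub (hD q') (hfD q'.left.inverse)
  change ‖T.act q'.fst (m q') - T.act q'.fst (f q'.left.inverse)‖ < ε
  rw [← e1, T.norm_act (sub_mem (hD q') (hfD q'.left.inverse))]
  exact h4

theorem pmul_contSection {f₁ f₂ : ∀ g : Arr X, A g.rng}
    (hf₁ : T.field.IsContSection Arr.rng f₁) (hf₂ : T.field.IsContSection Arr.rng f₂)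
    (hD₁ : ∀ g, f₁ g ∈ T.D g.hom) (hD₂ : ∀ g, f₂ g ∈ T.D g.hom) :
    T.field.IsContSection CompPair.z
      fun q => T.pmul q.fst q.snd (f₁ q.left) (f₂ q.right) := by
  have hy : Continuous (CompPair.y : CompPair X → X) :=
    hG.continuous_src.comp CompPair.continuous_left
  have h1 : T.field.IsContSection CompPair.y fun q : CompPair X => T.actInv q.fst (f₁ q.left) :=
    (T.actInv_contSection hf₁ hD₁).comp (CompPair.continuous_left (X := X))
  have h2 : T.field.IsContSection CompPair.y fun q : CompPair X => f₂ q.right :=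
    hf₂.comp (CompPair.continuous_right (X := X))
  have h3 := T.act_contSection (h1.mul h2 hy) fun q => T.dom_left _ _
  exact (T.w_continuous _ (fun q => T.act_dom_mem _ (hD₂ q.right)) h3).2

/-- The continuous map `g ↦ (g⁻¹, g)`. -/
abbrev invPair (g : Arr X) : CompPair X := ⟨inv g.hom, g.hom⟩

theorem continuous_invPair : Continuous (invPair : Arr X → CompPair X) :=
  continuous_induced_rng.2 (hG.continuous_inverse.prodMk continuous_id)

theorem wRstar_inv_contSection {j : ∀ g : Arr X, A g.src}
    (hj : T.field.IsContSection Arr.src j)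
    (hJ : ∀ g, j g ∈ T.D (inv g.hom) ⊓ T.D (g.hom ≫ inv g.hom)) :
    T.field.IsContSection Arr.src fun g => T.wRstar (inv g.hom) g.hom (j g) := by
  have hz : Continuous (CompPair.z : CompPair X → X) :=
    hG.continuous_rng.comp CompPair.continuous_left
  refine CStarField.IsContSection.of_approx fun g ε hε => ?_
  obtain ⟨l, hl, hl1, -⟩ := mem_closure_mul (T.ideal_J (inv g.hom) g.hom) (hJ g)
  obtain ⟨e, he⟩ := (hl1.eventually (Metric.ball_mem_nhds _ hε)).exists
  have he' : ‖j g * (e : A g.src) - j g‖ < ε := by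
    rw [dist_eq_norm] at he; exact he
  obtain ⟨a, ha, haD, haq⟩ := T.D_continuous (invPair g).left (j g) (hJ g).1
  obtain ⟨b, hb, hbD, hbq⟩ := T.D_continuous (invPair g).prod (e : A g.src) e.2.2
  have hF : T.field.IsContSection CompPair.z fun q : CompPair X => a q.left * b q.prod :=
    CStarField.IsContSection.mul (ha.comp (CompPair.continuous_left (X := X)))
      (hb.comp hG.continuous_prod) hz
  have hFJ : ∀ q : CompPair X, a q.left * b q.prod ∈ T.D q.fst ⊓ T.D (q.snd ≫ q.fst) := fun q =>
    ⟨(T.isClosedIdeal _).mul_mem_right _ (haD q.left),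
      (T.isClosedIdeal _).mul_mem_left _ (hbD q.prod)⟩
  have hW2 := (T.wRstar_contSection hF hFJ).comp (continuous_invPair (X := X))
  refine ⟨_, hW2, ?_⟩
  have hF2 : T.field.IsContSection Arr.src fun g' : Arr X =>
      a (invPair g').left * b (invPair g').prod := hF.comp (continuous_invPair (X := X))
  have h3 := (hj.sub hF2).norm_lt hG.continuous_src g (r := ε) (by
    rw [haq, hbq, norm_sub_rev]; exact he')
  filter_upwards [h3] with g' h4
  unfold TwistedPartialActionData.wRstar
  rw [← multR_sub _ (hJ g') (hFJ (invPair g')),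
    norm_multR (Unitary.star_mem (T.w_unitary _ _)) (sub_mem (hJ g') (hFJ (invPair g')))]
  exact h4

theorem pinv_contSection {f : ∀ g : Arr X, A g.rng} (hf : T.field.IsContSection Arr.rng f)
    (hD : ∀ g, f g ∈ T.D g.hom) :
    T.field.IsContSection Arr.src fun g => T.pinv g.hom (f g) :=
  T.wRstar_inv_contSection (T.actInv_contSection hf.star fun g => star_mem (hD g))
    fun g => T.mem_J_inv (T.actInv_mem_D g.hom (star (f g)))

/-- The Fell bundle associated to a twisted partial action.  Its fibre at `g` is `D_g`, and
`(a δ_g) · (b δ_h) = 𝔞_g(𝔞_g⁻¹(a) b) w(g, h) δ_{gh}`, `(a δ_g)^* = 𝔞_g⁻¹(a^*) w(g⁻¹, g)^* δ_{g⁻¹}`. -/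
def fellBundle : FellBundle.{u, v, t} X where
  fib g := T.D g
  complete g := (T.isClosedIdeal g).isClosed.completeSpace_coe
  sections := T.fellSections
  isBanachField := T.fellSections_isBanachField
  mul := T.fellMul _ _
  invol := T.fellInvol _
  mul_assoc a b c := T.heq_of_coe_eq (Category.assoc _ _ _).symm (T.pmul_assoc _ b.2 c.2)
  invol_mul a b := T.heq_of_coe_eq (IsIso.inv_comp ..) (T.pinv_pmul a.2 b.2)
  invol_invol a := T.heq_of_coe_eq (IsIso.inv_inv) (T.pinv_pinv a.2)
  norm_mul_le a b := T.norm_pmul_le a.2 b.2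
  norm_invol_mul_self {x y g} a := by
    change ‖T.pmul (inv g) g (T.pinv g a) a‖ = ‖(a : A y)‖ ^ 2
    rw [T.pmul_pinv a.2 a.2, T.norm_actInv (mul_mem (star_mem a.2) a.2),
      CStarRing.norm_star_mul_self, sq]
  positive {x y g} a := by
    have hb : T.actInv g a ∈ T.D (𝟙 x) := by rw [T.D_unit]; trivial
    refine ⟨⟨T.actInv g a, hb⟩, T.heq_of_coe_eq (by simp) ?_⟩
    change T.pmul (inv (𝟙 x)) (𝟙 x) (T.pinv (𝟙 x) _) _ = T.pmul (inv g) g (T.pinv g a) a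
    rw [T.pmul_pinv a.2 a.2, T.pmul_pinv hb hb, T.actInv_mul (star_mem a.2) a.2, T.actInv_star a.2]
    have h1 := T.act_actInv (g := 𝟙 x) (mul_mem (star_mem hb) hb)
    rwa [T.act_unit] at h1
  mul_continuous f₁ hf₁ f₂ hf₂ p ε hε := by
    have h1 := T.pmul_contSection hf₁ hf₂ (fun g => (f₁ g).2) fun g => (f₂ g).2
    obtain ⟨f, hf, hfD, hfp⟩ := T.D_continuous p.prod (T.pmul p.fst p.snd (f₁ p.left) (f₂ p.right))
      (T.pmul_mem _ _)
    refine ⟨fun g => ⟨f g, hfD g⟩, hf, ?_⟩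
    exact (h1.sub (hf.comp hG.continuous_prod)).norm_lt
      (hG.continuous_rng.comp CompPair.continuous_left) p (by
        change ‖T.pmul p.fst p.snd (f₁ p.left) (f₂ p.right) - f p.prod‖ < ε
        rwa [hfp, sub_self, norm_zero])
  invol_continuous f₁ hf₁ g ε hε := by
    have h1 := T.pinv_contSection hf₁ fun g => (f₁ g).2
    obtain ⟨f, hf, hfD, hfp⟩ := T.D_continuous g.inverse (T.pinv g.hom (f₁ g)) (T.pinv_mem _)
    refine ⟨fun g => ⟨f g, hfD g⟩, hf, ?_⟩
    exact (h1.sub (hf.comp hG.continuous_inverse)).norm_lt hG.continuous_src g (by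
        change ‖T.pinv g.hom (f₁ g) - f g.inverse‖ < ε
        rwa [hfp, sub_self, norm_zero])

end TwistedPartialAction

/-! ### Measurable fields of Hilbert spaces -/

/-- A field of C*-algebras is separable if it has a sequence of continuous sections whose values are
dense in each fibre.  Over a second countable locally compact Hausdorff space this says that the
C*-algebra of continuous sections vanishing at infinity is separable. -/
def CStarField.IsSeparable {B : Type*} [TopologicalSpace B] {A : B → Type*}
    [∀ b, NonUnitalCStarAlgebra (A b)] (F : CStarField A) : Prop :=
  ∃ a : ℕ → ∀ b, A b, (∀ n, a n ∈ F.sections) ∧ ∀ b, DenseRange fun n => a n b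

section MeasurableField

variable {X : Type u} {H : X → Type*} [∀ x, NormedAddCommGroup (H x)]
  [∀ x, InnerProductSpace ℂ (H x)]

/-- `𝒮` is the space of measurable sections of a `ν`-measurable field of Hilbert spaces with fibres
`H x`. -/
structure IsMeasurableField [MeasurableSpace X] (ν : Measure X) (𝒮 : Submodule ℂ (∀ x, H x)) :
    Prop where
  norm : ∀ ξ ∈ 𝒮, AEMeasurable (fun x => ‖ξ x‖) ν
  maximal : ∀ η : ∀ x, H x, (∀ ξ ∈ 𝒮, AEMeasurable (fun x => inner ℂ (ξ x) (η x)) ν) → η ∈ 𝒮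
  total : ∃ e : ℕ → ∀ x, H x, (∀ n, e n ∈ 𝒮) ∧
    ∀ x, (Submodule.span ℂ (Set.range fun n => e n x)).topologicalClosure = ⊤

/-- `η` is a `μ`-measurable section of the pull-back along `p` of the measurable field of Hilbert
spaces with space of measurable sections `𝒮`. -/
def IsMeasurableSection (𝒮 : Submodule ℂ (∀ x, H x)) {Y : Type*} [MeasurableSpace Y]
    (μ : Measure Y) (p : Y → X) (η : ∀ y, H (p y)) : Prop :=
  ∀ ξ ∈ 𝒮, AEMeasurable (fun y => inner ℂ (ξ (p y)) (η y)) μ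

end MeasurableField

section Representations

variable {X : Type u} [Groupoid.{v} X] [TopologicalSpace X] [TopologicalSpace (Arr X)]
  {H : X → Type*} [∀ x, NormedAddCommGroup (H x)] [∀ x, InnerProductSpace ℂ (H x)]
  [∀ x, CompleteSpace (H x)]
  {H' : X → Type*} [∀ x, NormedAddCommGroup (H' x)] [∀ x, InnerProductSpace ℂ (H' x)]
  [∀ x, CompleteSpace (H' x)]

/-! ### Measurable representations of Fell bundles -/

/-- The data of a Fell-bundle representation: linear maps `S_g : 𝒜_g → 𝔹(H_{s(g)}, H_{r(g)})`. -/
@[ext]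
structure FellRepData (B : FellBundle.{u, v, t} X) (H : X → Type*) [∀ x, NormedAddCommGroup (H x)]
    [∀ x, InnerProductSpace ℂ (H x)] where
  S : ∀ {x y : X} (g : x ⟶ y), B.fib g →ₗ[ℂ] (H x →L[ℂ] H y)

section

variable [MeasurableSpace X] [MeasurableSpace (Arr X)] (α : HaarSystem X) (ν : Measure X)
  (𝒮 : Submodule ℂ (∀ x, H x))

/-- Measurable Fell-bundle pre-representations. -/
structure IsFellPreRep (B : FellBundle.{u, v, t} X) (R : FellRepData B H) : Prop where
  multiplicative : ∀ {x y z : X} (g : y ⟶ z) (h : x ⟶ y) (a : B.fib g) (b : B.fib h),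
    (R.S g a).comp (R.S h b) = R.S (h ≫ g) (B.mul a b)
  adjoint : ∀ {x y : X} (g : x ⟶ y) (a : B.fib g),
    ContinuousLinearMap.adjoint (R.S g a) = R.S (inv g) (B.invol a)
  nondegenerate : ∀ x : X, (Submodule.span ℂ
    {ζ : H x | ∃ (a : B.fib (𝟙 x)) (ξ : H x), ζ = R.S (𝟙 x) a ξ}).topologicalClosure = ⊤
  measurable : ∀ f ∈ B.sections, HasCompactSupp f → ∀ ξ : ∀ g : Arr X, H g.src,
    IsMeasurableSection 𝒮 (α.compTilde ν) Arr.src ξ →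
      IsMeasurableSection 𝒮 (α.comp ν) Arr.rng fun g => R.S g.hom (f g) (ξ g)

/-- The set of all arrows `g` with `S_{r(g)}(𝒜_g 𝒜_g^*) H_{r(g)} ≠ 0`. -/
def FellRepData.support {B : FellBundle.{u, v, t} X} (R : FellRepData B H) : Set (Arr X) :=
  {g | ∃ (a b : B.fib g.hom) (ξ : H g.rng),
    R.S (inv g.hom ≫ g.hom) (B.mul a (B.invol b)) ξ ≠ 0}

/-- Measurable Fell-bundle representations on a measurable field of Hilbert spaces. -/
structure IsFellRep (B : FellBundle.{u, v, t} X) (R : FellRepData B H) : Prop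
    extends IsFellPreRep α ν 𝒮 B R where
  nontrivial : ∀ᵐ x ∂ν, Nontrivial (H x)
  quasiInvariant : IsSymmetricMeasure ((α.comp ν).restrict R.support)

end

/-- `(V_x)_{x ∈ E}` intertwines two Fell-bundle representations over `E`. -/
def FellRepData.Intertwines {B : FellBundle.{u, v, t} X} (R : FellRepData B H)
    (R' : FellRepData B H') (E : Set X) (V : ∀ x, H x →L[ℂ] H' x) : Prop :=
  ∀ x ∈ E, ∀ y ∈ E, ∀ (g : x ⟶ y) (a : B.fib g) (ξ : H x), V y (R.S g a ξ) = R'.S g a (V x ξ)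

/-! ### Measurable covariant representations -/

section EssentialSubspace

variable {B : Type*} [NonUnitalCStarAlgebra B] {K : Type*} [NormedAddCommGroup K]
  [InnerProductSpace ℂ K] [CompleteSpace K]

/-- The closed linear span `φ(I) K` of all vectors `φ(a) ξ` with `a ∈ I`. -/
def essSub (φ : B →⋆ₙₐ[ℂ] (K →L[ℂ] K)) (I : NonUnitalStarSubalgebra ℂ B) : Submodule ℂ K :=
  (Submodule.span ℂ {ζ | ∃ a ∈ I, ∃ ξ : K, ζ = φ a ξ}).topologicalClosure

instance (φ : B →⋆ₙₐ[ℂ] (K →L[ℂ] K)) (I : NonUnitalStarSubalgebra ℂ B) :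
    CompleteSpace (essSub φ I) :=
  (Submodule.isClosed_topologicalClosure _).completeSpace_coe

theorem apply_mem_essSub (φ : B →⋆ₙₐ[ℂ] (K →L[ℂ] K)) {I : NonUnitalStarSubalgebra ℂ B} {a : B}
    (ha : a ∈ I) (ξ : K) : φ a ξ ∈ essSub φ I :=
  Submodule.le_topologicalClosure _ (Submodule.subset_span ⟨a, ha, ξ, rfl⟩)

/-- `V` is the operator `φ(m)` for a multiplier `m` of the ideal `J`, where `φ` is extended to
multipliers of `J` on the subspace `φ(J) K` and by `0` on its orthogonal complement. -/
structure IsMultiplierExtension (φ : B →⋆ₙₐ[ℂ] (K →L[ℂ] K)) (J : NonUnitalStarSubalgebra ℂ B)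
    (m : 𝓜(ℂ, J)) (V : K →L[ℂ] K) : Prop where
  apply_apply : ∀ a ∈ J, ∀ ξ : K, V (φ a ξ) = φ (multL m a) ξ
  apply_orthogonal : ∀ ξ ∈ (essSub φ J)ᗮ, V ξ = 0

end EssentialSubspace

variable {A : X → Type t} [∀ x, NonUnitalCStarAlgebra (A x)]

/-- The data of a covariant representation: representations `φ_x` of the fibres and unitary
operators `U_g : φ_{s(g)}(D_{g⁻¹}) H_{s(g)} → φ_{r(g)}(D_g) H_{r(g)}`. -/
structure CovRepData (T : TwistedPartialAction X A) (H : X → Type*) [∀ x, NormedAddCommGroup (H x)]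
    [∀ x, InnerProductSpace ℂ (H x)] [∀ x, CompleteSpace (H x)] where
  φ : ∀ x : X, A x →⋆ₙₐ[ℂ] (H x →L[ℂ] H x)
  U : ∀ {x y : X} (g : x ⟶ y), essSub (φ x) (T.D (inv g)) ≃ₗᵢ[ℂ] essSub (φ y) (T.D g)

section

variable [MeasurableSpace X] [MeasurableSpace (Arr X)] (α : HaarSystem X) (ν : Measure X)
  (𝒮 : Submodule ℂ (∀ x, H x))

/-- The set of all arrows `g` with `φ_{r(g)}(D_g) H_{r(g)} ≠ 0`. -/
def CovRepData.support {T : TwistedPartialAction X A} (c : CovRepData T H) : Set (Arr X) :=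
  {g | ∃ a ∈ T.D g.hom, ∃ ξ : H g.rng, c.φ g.rng a ξ ≠ 0}

/-- Measurable covariant representations of a twisted partial action on a measurable field of
Hilbert spaces. -/
structure IsCovRep (T : TwistedPartialAction X A) (c : CovRepData T H) : Prop where
  nontrivial : ∀ᵐ x ∂ν, Nontrivial (H x)
  nondegenerate : ∀ x : X, essSub (c.φ x) ⊤ = ⊤
  quasiInvariant : IsSymmetricMeasure ((α.comp ν).restrict c.support)
  /-- `U_g φ_{s(g)}(a) U_g^* = φ_{r(g)}(𝔞_g(a))` on `φ_{r(g)}(D_g) H_{r(g)}` -/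
  covariance : ∀ {x y : X} (g : x ⟶ y) (a : A x) (ha : a ∈ T.D (inv g))
    (ξ : essSub (c.φ y) (T.D g)),
    (c.U g ⟨c.φ x a ((c.U g).symm ξ), apply_mem_essSub (c.φ x) ha _⟩ : H y) =
      c.φ y (T.act g a) ξ
  /-- `U_g U_h` is a restriction of `φ_{r(g)}(w(g, h)) U_{gh}` -/
  cocycle : ∀ {x y z : X} (g : y ⟶ z) (h : x ⟶ y), ∃ V : H z →L[ℂ] H z,
    IsMultiplierExtension (c.φ z) (T.D g ⊓ T.D (h ≫ g)) (T.w g h).1 V ∧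
    ∀ (ξ : H x) (h₁ : ξ ∈ essSub (c.φ x) (T.D (inv h)))
      (h₂ : (c.U h ⟨ξ, h₁⟩ : H y) ∈ essSub (c.φ y) (T.D (inv g))),
      ∃ h₃ : ξ ∈ essSub (c.φ x) (T.D (inv (h ≫ g))),
        (c.U g ⟨c.U h ⟨ξ, h₁⟩, h₂⟩ : H z) = V (c.U (h ≫ g) ⟨ξ, h₃⟩)
  /-- pointwise application of `φ_x(a_x)` maps measurable sections to measurable sections -/
  measurable_φ : ∀ a ∈ T.field.sections, VanishesAtInfinity a → ∀ ξ ∈ 𝒮,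
    (fun x => c.φ x (a x) (ξ x)) ∈ 𝒮
  /-- pointwise application of `U_g` maps measurable sections to measurable sections -/
  measurable_U : ∀ ξ : ∀ g : Arr X, essSub (c.φ g.src) (T.D (inv g.hom)),
    IsMeasurableSection 𝒮 (α.compTilde ν) Arr.src (fun g => (ξ g : H g.src)) →
      IsMeasurableSection 𝒮 (α.comp ν) Arr.rng fun g => (c.U g.hom (ξ g) : H g.rng)

end

namespace CovRepData

variable {T : TwistedPartialAction X A} (c : CovRepData T H)

/-- The extension of `U_g` to a partial isometry `H_{s(g)} → H_{r(g)}`. -/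
def Ubar {x y : X} (g : x ⟶ y) : H x →L[ℂ] H y :=
  (essSub (c.φ y) (T.D g)).subtypeL.comp
    (((c.U g).toContinuousLinearEquiv : _ →L[ℂ] essSub (c.φ y) (T.D g)).comp
      (essSub (c.φ x) (T.D (inv g))).orthogonalProjectionOnto)

/-- The linear map `D_g → 𝔹(H_{s(g)}, H_{r(g)})`, `a ↦ φ_{r(g)}(a) Ū_g`. -/
def toS {x y : X} (g : x ⟶ y) : T.D g →ₗ[ℂ] (H x →L[ℂ] H y) where
  toFun a := (c.φ y a).comp (c.Ubar g)
  map_add' a b := by ext ξ; simp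
  map_smul' r a := by ext ξ; simp

/-- The Fell-bundle representation `S_g(a) = φ_{r(g)}(a) Ū_g`. -/
def toFellRep [IsTopologicalGroupoid X] : FellRepData T.fellBundle H where
  S g := c.toS g

/-- `(V_x)_{x ∈ E}` intertwines two covariant representations over `E`. -/
structure Intertwines (c' : CovRepData T H') (E : Set X) (V : ∀ x, H x →L[ℂ] H' x) : Prop where
  map_φ : ∀ x ∈ E, ∀ (a : A x) (ξ : H x), V x (c.φ x a ξ) = c'.φ x a (V x ξ)
  map_U : ∀ x ∈ E, ∀ y ∈ E, ∀ (g : x ⟶ y) (ξ : essSub (c.φ x) (T.D (inv g))),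
    ∃ h : V x ξ ∈ essSub (c'.φ x) (T.D (inv g)), V y (c.U g ξ) = c'.U g ⟨V x ξ, h⟩

end CovRepData

end Representations

end FellBundles

end

noncomputable section

namespace FellBundles

universe u v t

/-! ### Isometries between closed spans -/

section Gram

variable {K L : Type*} [NormedAddCommGroup K] [InnerProductSpace ℂ K]
  [NormedAddCommGroup L] [InnerProductSpace ℂ L] {ι : Type*}

/-! The two notions carry the same algebraic information, because S_g(a) = φ(a)Ū_g can be read in
both directions. Given (φ, U), covariance moves coefficients through Ū_g, namely φ(a)Ū_g = Ū_g
φ(𝔞_g⁻¹(a)), and the cocycle condition gives Ū_g Ū_h φ(n) = φ(w(g, h)𝔞_{gh}(n)) Ū_{gh} for n in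
D_{h⁻¹} ∩ D_{(gh)⁻¹}. These two rules reproduce the product and the involution of the Fell bundle
(`φ_Ubar_φ_Ubar`, `adjoint_φ_Ubar`). Conversely, put φ_x = S_{u(x)}. Then S_g(a)^*S_g(b) =
φ(𝔞_g⁻¹(a^*b)), so the families φ(a)ξ and S_g(𝔞_g(a))ξ, with a in D_{g⁻¹}, have the same Gram
matrix; a unitary U_g matches their closed spans (`exists_U`). The relation S_g(a)S_g(b)^* = φ(ab^*)
identifies the second span with φ(D_g)H (`essSub_rep_eq`). Since U_g is determined by U_gφ(a)ξ =
S_g(𝔞_g(a))ξ, injectivity and the statement about intertwiners follow.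

The analytic content is measurability, and the direction from S to (φ, U) has two difficulties.
First, S is only measurable over the arrows, whereas φ lives over the objects, and the units may
form a null set. Near a unit a continuous section a of B is approximated by products f₁(g) ·
f₂(g⁻¹), which act by S_g(f₁(g))S_{g⁻¹}(f₂(g⁻¹)) and hence measurably over the arrows. As each α^x
lives on the range fibre and has full support there, a.e. measurability then descends to the objects
(`HaarSystem.aemeasurable_of_approx_near_units`, `rep_measurable`). Second, U_g ξ(g) is approximated
by S_g(d_k(g))ξ(g), where (d_k) is a countable fibrewise dense family of sections; this is where
separability enters. The sets on which a given k is good enough are null measurable for ν ∘ α̃, and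
symmetry on the support transports this to ν ∘ α; off the support Ū_g vanishes
(`toCovRep_measurable_U`). Finally, measures enter both definitions only through null sets, which
gives invariance under equivalence. -/

/-- Linear combinations of a family of vectors, as a map to the closed linear span. -/
def closedSpanMap (v : ι → K) : (ι →₀ ℂ) →ₗ[ℂ] (Submodule.span ℂ (Set.range v)).topologicalClosure :=
  (Finsupp.linearCombination ℂ v).codRestrict _ fun c =>
    Submodule.le_topologicalClosure _ (by
      rw [← Finsupp.range_linearCombination]; exact LinearMap.mem_range_self _ c)

theorem denseRange_closedSpanMap (v : ι → K) : DenseRange (closedSpanMap v) := by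
  rintro ⟨ξ, hξ⟩
  rw [closure_subtype]
  have h1 : ((fun x => x : (Submodule.span ℂ (Set.range v)).topologicalClosure → K) ''
      Set.range (closedSpanMap v)) = (Submodule.span ℂ (Set.range v) : Set K) := by
    rw [← Set.range_comp]
    exact congrArg (fun S : Submodule ℂ K => (S : Set K)) (Finsupp.range_linearCombination ℂ (v := v))
  rw [h1]
  exact hξ

theorem inner_linearCombination (v : ι → K) (c d : ι →₀ ℂ) :
    inner ℂ (Finsupp.linearCombination ℂ v c) (Finsupp.linearCombination ℂ v d) =
      c.sum fun i a => d.sum fun j b => starRingEnd ℂ a * (b * inner ℂ (v i) (v j)) := by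
  simp only [Finsupp.linearCombination_apply, Finsupp.sum, sum_inner, inner_sum, inner_smul_left,
    inner_smul_right, Finset.mul_sum]
  rw [Finset.sum_comm]
  exact Finset.sum_congr rfl fun _ _ => Finset.sum_congr rfl fun _ _ => by ring

/-- Two families of vectors with the same Gram matrix are related by a unitary operator between
their closed linear spans. -/
theorem exists_isometryEquiv_closedSpan [CompleteSpace K] [CompleteSpace L] (v : ι → K) (w : ι → L)
    (h : ∀ i j, inner ℂ (v i) (v j) = inner ℂ (w i) (w j)) :
    ∃ Φ : (Submodule.span ℂ (Set.range v)).topologicalClosure ≃ₗᵢ[ℂ]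
        (Submodule.span ℂ (Set.range w)).topologicalClosure,
      ∀ i (hi : v i ∈ (Submodule.span ℂ (Set.range v)).topologicalClosure),
        (Φ ⟨v i, hi⟩ : L) = w i := by
  have : CompleteSpace (Submodule.span ℂ (Set.range v)).topologicalClosure :=
    (Submodule.isClosed_topologicalClosure _).completeSpace_coe
  have : CompleteSpace (Submodule.span ℂ (Set.range w)).topologicalClosure :=
    (Submodule.isClosed_topologicalClosure _).completeSpace_coe
  -- The norm of a finite combination depends only on the Gram matrix. Hence v i ↦ w i is well
  -- defined and isometric on spans, and density on both sides extends it to a unitary between the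
  -- closures.
  have hn : ∀ c : ι →₀ ℂ, ‖closedSpanMap w c‖ = ‖closedSpanMap v c‖ := by
    intro c
    have h1 : inner ℂ (Finsupp.linearCombination ℂ w c) (Finsupp.linearCombination ℂ w c) =
        inner ℂ (Finsupp.linearCombination ℂ v c) (Finsupp.linearCombination ℂ v c) := by
      simp only [inner_linearCombination, h]
    rw [inner_self_eq_norm_sq_to_K, inner_self_eq_norm_sq_to_K] at h1
    have h2 : ‖Finsupp.linearCombination ℂ w c‖ ^ 2 = ‖Finsupp.linearCombination ℂ v c‖ ^ 2 := by
      exact_mod_cast h1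
    exact (sq_eq_sq₀ (norm_nonneg _) (norm_nonneg _)).1 h2
  refine ⟨(LinearEquiv.refl ℂ (ι →₀ ℂ)).extendOfIsometry (closedSpanMap v) (closedSpanMap w)
    (denseRange_closedSpanMap v) (denseRange_closedSpanMap w) hn, fun i hi => ?_⟩
  have h1 : (⟨v i, hi⟩ : (Submodule.span ℂ (Set.range v)).topologicalClosure) =
      closedSpanMap v (Finsupp.single i 1) := Subtype.ext (by simp [closedSpanMap])
  have h2 := LinearEquiv.extendOfIsometry_eq (f := LinearEquiv.refl ℂ (ι →₀ ℂ))
    (e₁ := closedSpanMap v) (e₂ := closedSpanMap w)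
    (denseRange_closedSpanMap v) (denseRange_closedSpanMap w) hn (Finsupp.single i 1)
  rw [h1]
  refine (congrArg Subtype.val h2).trans ?_
  simp [closedSpanMap]

end Gram

/-! ### Essential subspaces -/

theorem eq_zero_of_mem_orthogonal {K : Type*} [NormedAddCommGroup K]
    [InnerProductSpace ℂ K] {S : Submodule ℂ K} {ξ : K} (h : ξ ∈ S) (h' : ξ ∈ Sᗮ) :
    ξ = 0 :=
  inner_self_eq_zero.1 ((Submodule.mem_orthogonal _ _).1 h' ξ h)

section EssentialSubspace

variable {B : Type*} [NonUnitalCStarAlgebra B] {K : Type*} [NormedAddCommGroup K]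
  [InnerProductSpace ℂ K] [CompleteSpace K] {φ : B →⋆ₙₐ[ℂ] (K →L[ℂ] K)}
  {I J : NonUnitalStarSubalgebra ℂ B}

/-- An induction principle: below, S is an equalizer of continuous operators or the preimage of a
closed subspace, so that closed linear conditions need only be tested on the vectors φ(a)ξ. -/
theorem essSub_le {S : Submodule ℂ K} (hS : IsClosed (S : Set K))
    (h : ∀ a ∈ I, ∀ ξ, φ a ξ ∈ S) : essSub φ I ≤ S := by
  refine Submodule.topologicalClosure_minimal _ (Submodule.span_le.2 ?_) hS
  rintro _ ⟨a, ha, ξ, rfl⟩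
  exact h a ha ξ

theorem isClosed_essSub : IsClosed (essSub φ I : Set K) := Submodule.isClosed_topologicalClosure _

theorem essSub_mono (h : I ≤ J) : essSub φ I ≤ essSub φ J :=
  essSub_le isClosed_essSub fun _ ha ξ => apply_mem_essSub φ (h ha) ξ

theorem eqOn_essSub {L : Type*} [NormedAddCommGroup L] [NormedSpace ℂ L] {f f' : K →L[ℂ] L}
    (h : ∀ a ∈ I, ∀ ξ, f (φ a ξ) = f' (φ a ξ)) {ζ : K} (hζ : ζ ∈ essSub φ I) : f ζ = f' ζ :=
  essSub_le (S := LinearMap.eqLocus (f : K →ₗ[ℂ] L) f') (isClosed_eq f.continuous f'.continuous)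
    h hζ

theorem apply_apply (φ : B →⋆ₙₐ[ℂ] (K →L[ℂ] K)) (a b : B) (ξ : K) :
    φ a (φ b ξ) = φ (a * b) ξ := by
  rw [map_mul]; rfl

theorem inner_apply_left (a : B) (ξ η : K) : inner ℂ (φ a ξ) η = inner ℂ ξ (φ (star a) η) := by
  rw [map_star, ContinuousLinearMap.star_eq_adjoint, ContinuousLinearMap.adjoint_inner_right]

theorem inner_apply_right (a : B) (ξ η : K) : inner ℂ ξ (φ a η) = inner ℂ (φ (star a) ξ) η := by
  rw [inner_apply_left, star_star]

/-- Since I is self-adjoint, ‖φ(a)ξ‖² = ⟨ξ, φ(a^*)φ(a)ξ⟩ pairs ξ with a vector of φ(I)K; conversely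
⟨ξ, φ(a)η⟩ = ⟨φ(a^*)ξ, η⟩. -/
theorem mem_orthogonal_essSub_iff {ξ : K} : ξ ∈ (essSub φ I)ᗮ ↔ ∀ a ∈ I, φ a ξ = 0 := by
  constructor
  · intro h a ha
    rw [← inner_self_eq_zero (𝕜 := ℂ), inner_apply_right]
    exact (Submodule.mem_orthogonal' _ _).1 h _ (apply_mem_essSub φ (star_mem ha) _) |>
      fun e => by rw [← inner_conj_symm, e, map_zero]
  · intro h
    have h1 : essSub φ I ≤ (Submodule.span ℂ {ξ})ᗮ := by
      refine essSub_le (Submodule.isClosed_orthogonal _) fun a ha η => ?_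
      rw [Submodule.mem_orthogonal_singleton_iff_inner_right, inner_apply_right,
        h _ (star_mem ha), inner_zero_left]
    refine (Submodule.mem_orthogonal _ _).2 fun ζ hζ => ?_
    have := Submodule.mem_orthogonal_singleton_iff_inner_left.1 (h1 hζ)
    exact this

theorem apply_orthogonal {a : B} (ha : a ∈ I) {ξ : K} (hξ : ξ ∈ (essSub φ I)ᗮ) : φ a ξ = 0 :=
  mem_orthogonal_essSub_iff.1 hξ a ha

theorem continuousLinearMap_ext_essSub {L : Type*} [NormedAddCommGroup L] [NormedSpace ℂ L]
    {f f' : K →L[ℂ] L} (h : ∀ a ∈ I, ∀ ξ, f (φ a ξ) = f' (φ a ξ))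
    (h' : ∀ ξ ∈ (essSub φ I)ᗮ, f ξ = f' ξ) : f = f' := by
  ext ξ
  obtain ⟨η, hη, ζ, hζ, rfl⟩ := (essSub φ I).exists_add_mem_mem_orthogonal ξ
  rw [map_add, map_add, eqOn_essSub h hη, h' ζ hζ]

theorem apply_mem_essSub_of_mem (hI : IsClosedIdeal I) (b : B) {ξ : K} (hξ : ξ ∈ essSub φ I) :
    φ b ξ ∈ essSub φ I := by
  refine essSub_le (S := (essSub φ I).comap (φ b : K →ₗ[ℂ] K))
    (isClosed_essSub.preimage (φ b).continuous) (fun a ha η => ?_) hξ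
  change φ b (φ a η) ∈ essSub φ I
  rw [apply_apply]
  exact apply_mem_essSub φ (hI.mul_mem_left b ha) η

/-- Let n be the component of ζ orthogonal to φ(I ∩ J)K; it still lies in both φ(I)K and φ(J)K. For
b in J, the vector φ(b)n lies in φ(I)K and is killed by φ(I), because IJ ⊆ I ∩ J. So φ(b)n = 0 for
all b in J, and then n = 0. This is needed to find the natural domain of U_g U_h. -/
theorem essSub_inf (hI : IsClosedIdeal I) (hJ : IsClosedIdeal J) :
    essSub φ (I ⊓ J) = essSub φ I ⊓ essSub φ J := by
  refine le_antisymm (le_inf (essSub_mono inf_le_left) (essSub_mono inf_le_right)) ?_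
  rintro ζ ⟨h1, h2⟩
  obtain ⟨m, hm, n, hn, rfl⟩ := (essSub φ (I ⊓ J)).exists_add_mem_mem_orthogonal ζ
  have hn1 : n ∈ essSub φ I := by
    simpa using sub_mem h1 (essSub_mono (φ := φ) (inf_le_left : I ⊓ J ≤ I) hm)
  have hn2 : n ∈ essSub φ J := by
    simpa using sub_mem h2 (essSub_mono (φ := φ) (inf_le_right : I ⊓ J ≤ J) hm)
  have h3 : ∀ b ∈ J, φ b n = 0 := by
    intro b hb
    refine eq_zero_of_mem_orthogonal (apply_mem_essSub_of_mem hI b hn1) ?_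
    refine mem_orthogonal_essSub_iff.2 fun a ha => ?_
    rw [apply_apply]
    exact apply_orthogonal (I := I ⊓ J) ⟨hI.mul_mem_right b ha, hJ.mul_mem_left a hb⟩ hn
  rw [eq_zero_of_mem_orthogonal hn2 (mem_orthogonal_essSub_iff.2 h3), add_zero]
  exact hm

theorem continuous_rep : Continuous φ := by
  refine AddMonoidHomClass.continuous_of_bound φ 1 fun a => ?_
  rw [one_mul]
  exact NonUnitalStarAlgHom.norm_apply_le φ a

/-- A continuous image of an ideal lies in a closed set if this holds for products. -/
theorem mem_of_mul_mem {E : Type*} [TopologicalSpace E] (hI : IsClosedIdeal I) {S : Set E}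
    (hS : IsClosed S) {f : I → E} (hf : Continuous f) (h : ∀ a b : I, f (a * b) ∈ S) (a : I) :
    f a ∈ S := by
  -- Along an approximate unit e of I, the products a * e converge to a.
  obtain ⟨l, hl, h1, -⟩ := mem_closure_mul hI a.2
  exact hS.mem_of_tendsto ((hf.tendsto a).comp h1) (Eventually.of_forall fun e => h a e)

theorem essSub_le_of_mul (hI : IsClosedIdeal I) {S : Submodule ℂ K} (hS : IsClosed (S : Set K))
    (h : ∀ a ∈ I, ∀ b ∈ I, ∀ ξ, φ (a * b) ξ ∈ S) : essSub φ I ≤ S :=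
  essSub_le hS fun a ha ξ =>
    mem_of_mul_mem hI hS (f := fun c : I => φ (c : B) ξ)
      ((continuous_rep.comp continuous_subtype_val).clm_apply continuous_const)
      (fun c d => h c c.2 d d.2 ξ) ⟨a, ha⟩

theorem essSub_eq_span_range (I : NonUnitalStarSubalgebra ℂ B) :
    essSub φ I = (Submodule.span ℂ (Set.range fun p : I × K => φ (p.1 : B) p.2)).topologicalClosure
    := by
  unfold essSub
  congr 2
  ext ζ
  constructor
  · rintro ⟨a, ha, ξ, rfl⟩
    exact ⟨(⟨a, ha⟩, ξ), rfl⟩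
  · rintro ⟨p, rfl⟩
    exact ⟨p.1, p.1.2, p.2, rfl⟩

/-- This says that ξ lies in the closure of its own orbit N = φ(I)ξ. Split ξ = n + n' along the
closure S of N. For a in I, φ(a)n' lies in S, as both φ(a)ξ and φ(a)n do, and it is orthogonal to N,
as ⟨φ(b)ξ, φ(a)n'⟩ = ⟨φ(a^*b)ξ, n'⟩. So φ(I) kills n', which also lies in φ(I)K, hence n' = 0. -/
theorem exists_norm_apply_sub_lt {ξ : K} (hξ : ξ ∈ essSub φ I) {δ : ℝ}
    (hδ : 0 < δ) : ∃ b ∈ I, ‖φ b ξ - ξ‖ < δ := by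
  let ev : B →ₗ[ℂ] K :=
    { toFun := fun b => φ b ξ
      map_add' := fun a b => by rw [map_add]; rfl
      map_smul' := fun r b => by rw [map_smul]; rfl }
  let N : Submodule ℂ K := I.toSubmodule.map ev
  let S := N.topologicalClosure
  have : CompleteSpace S := (Submodule.isClosed_topologicalClosure _).completeSpace_coe
  have hN : ∀ b ∈ I, φ b ξ ∈ N := fun b hb => ⟨b, hb, rfl⟩
  have hNS : N ≤ S := N.le_topologicalClosure
  have hSe : S ≤ essSub φ I := Submodule.topologicalClosure_minimal _ (by
    rintro _ ⟨b, hb, rfl⟩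
    exact apply_mem_essSub φ hb ξ) isClosed_essSub
  obtain ⟨n, hn, n', hn', e⟩ := S.exists_add_mem_mem_orthogonal ξ
  have hinv : ∀ a ∈ I, φ a n ∈ S := by
    intro a ha
    have h1 : S ≤ S.comap (φ a : K →ₗ[ℂ] K) := by
      refine Submodule.topologicalClosure_minimal _ ?_
        ((Submodule.isClosed_topologicalClosure N).preimage (φ a).continuous)
      rintro _ ⟨b, hb, rfl⟩
      change φ a (φ b ξ) ∈ S
      rw [apply_apply]
      exact hNS (hN _ (mul_mem ha hb))
    exact h1 hn
  have h0 : ∀ a ∈ I, φ a n' = 0 := by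
    intro a ha
    refine eq_zero_of_mem_orthogonal (S := S) ?_ ?_
    · rw [show n' = ξ - n by rw [e]; abel, map_sub]
      exact sub_mem (hNS (hN a ha)) (hinv a ha)
    · rw [Submodule.orthogonal_closure, Submodule.mem_orthogonal]
      rintro _ ⟨b, hb, rfl⟩
      change inner ℂ (φ b ξ) (φ a n') = 0
      rw [inner_apply_right, apply_apply]
      exact (Submodule.mem_orthogonal _ _).1 hn' _ (hNS (hN _ (mul_mem (star_mem ha) hb)))
  have h1 : n' = 0 := by
    refine eq_zero_of_mem_orthogonal (S := essSub φ I) ?_ (mem_orthogonal_essSub_iff.2 h0)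
    rw [show n' = ξ - n by rw [e]; abel]
    exact sub_mem hξ (hSe hn)
  have h2 : ξ ∈ closure (N : Set K) := by
    rw [e, h1, add_zero]; exact hn
  obtain ⟨_, ⟨b, hb, rfl⟩, h3⟩ := Metric.mem_closure_iff.1 h2 δ hδ
  rw [dist_comm, dist_eq_norm] at h3
  exact ⟨b, hb, h3⟩

/-- A unitary multiplier of an ideal acts in every representation. -/
theorem exists_isMultiplierExtension {m : 𝓜(ℂ, J)}
    (hm : m ∈ unitary 𝓜(ℂ, J)) (φ : B →⋆ₙₐ[ℂ] (K →L[ℂ] K)) :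
    ∃ V : K →L[ℂ] K, IsMultiplierExtension φ J m V := by
  obtain ⟨Φ, hΦ⟩ := exists_isometryEquiv_closedSpan (fun p : J × K => φ (p.1 : B) p.2)
    (fun p : J × K => φ (multL m (p.1 : B)) p.2) (by
      -- The Gram matrices agree because (m a)^*(m b) = a^* m^* m b = a^* b.
      intro p q
      rw [inner_apply_left, inner_apply_left, apply_apply, apply_apply, star_multL m p.1.2,
        mult_central _ (star_mem p.1.2) (multL_mem _ _), multL_star_multL hm q.1.2])
  have he := essSub_eq_span_range (φ := φ) J
  let S' := (Submodule.span ℂ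
    (Set.range fun p : J × K => φ (multL m (p.1 : B)) p.2)).topologicalClosure
  let S := (Submodule.span ℂ (Set.range fun p : J × K => φ (p.1 : B) p.2)).topologicalClosure
  have : CompleteSpace S := (Submodule.isClosed_topologicalClosure _).completeSpace_coe
  refine ⟨S'.subtypeL.comp ((Φ.toContinuousLinearEquiv : S →L[ℂ] S').comp
    S.orthogonalProjectionOnto), ⟨fun a ha ξ => ?_, fun ξ hξ => ?_⟩⟩
  · have h1 : φ a ξ ∈ S := by
      change _ ∈ (Submodule.span ℂ _).topologicalClosure
      rw [← he]; exact apply_mem_essSub φ ha ξ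
    have h2 : S.orthogonalProjectionOnto (φ a ξ) = ⟨φ a ξ, h1⟩ :=
      S.orthogonalProjectionOnto_mem_subspace_eq_self ⟨_, h1⟩
    have h3 := hΦ (⟨a, ha⟩, ξ) h1
    simpa [h2] using h3
  · have h2 : S.orthogonalProjectionOnto ξ = 0 := by
      rw [Submodule.orthogonalProjectionOnto_eq_zero_iff]
      change ξ ∈ (Submodule.span ℂ _).topologicalClosureᗮ
      rwa [← he]
    simp [h2]

end EssentialSubspace

/-! ### Further identities in the associated Fell bundle -/

namespace TwistedPartialAction

variable {X : Type u} [Groupoid.{v} X] [TopologicalSpace X] [TopologicalSpace (Arr X)]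
    {A : X → Type t} [∀ x, NonUnitalCStarAlgebra (A x)] (T : TwistedPartialAction X A)
    {x y z : X} {g : y ⟶ z} {h : x ⟶ y}

theorem mem_D_unit (a : A x) : a ∈ T.D (𝟙 x) := by rw [T.D_unit]; trivial

theorem actInv_unit (a : A x) : T.actInv (𝟙 x) a = a := by
  have := T.act_actInv (T.mem_D_unit a)
  rwa [T.act_unit] at this

theorem pinv_unit (a : A x) : T.pinv (𝟙 x) a = star a := by
  unfold pinv TwistedPartialActionData.wRstar
  rw [T.actInv_unit, T.w_unit_right]
  have h1 : star a ∈ T.D (inv (𝟙 x)) ⊓ T.D (𝟙 x ≫ inv (𝟙 x)) := by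
    rw [Category.id_comp, IsIso.inv_id]
    exact ⟨T.mem_D_unit _, T.mem_D_unit _⟩
  have := multR_one h1
  rwa [← star_one] at this

theorem pmul_unit_right (b : A z) (a : A y) :
    T.pmul g (𝟙 y) b a = T.act g (T.actInv g b * a) :=
  T.wR_unit (T.act_mem_D _ _)

/-- `(a δ_g) · (b δ_g)^* = a b^*`. -/
theorem pmul_pinv_right {a b : A z} (ha : a ∈ T.D g) (hb : b ∈ T.D g) :
    T.pmul g (inv g) a (T.pinv g b) = a * star b := by
  have hI := T.ideal_J (inv g) g
  have hw := T.w_unitary (inv g) g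
  set c := T.actInv g a * T.actInv g (star b) with hc
  have hcD : c ∈ T.D (inv g) := mul_mem (T.actInv_mem_D _ _) (T.actInv_mem_D _ _)
  have h1 : T.actInv g a * T.pinv g b = T.wRstar (inv g) g c :=
    (multR_mul_right _ hI _ (T.mem_J_inv (T.actInv_mem_D _ _))).symm
  set d := T.wRstar (inv g) g c with hd
  have hdJ : d ∈ T.D (inv g) ⊓ T.D (g ≫ inv g) := multR_mem _ _
  -- Here d = c w(g⁻¹, g)^*. The cocycle identity for (g, g⁻¹, g) has trivial outer twists w(g, 1)
  -- and w(1, g), and it becomes 𝔞_g(d) w(g, g⁻¹) = 𝔞_g(c).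
  have h2 := T.cocycle g (inv g) g d ⟨⟨hdJ.1, hdJ.1⟩, hdJ.2⟩
  have h3 : T.wR (inv g) g d = c := multR_multR_star hw (T.mem_J_inv hcD)
  have hD : T.wR g (inv g) (T.act g d) ∈ T.D g := (multR_mem (T.w g (inv g)).1 _).1
  rw [h3, IsIso.hom_inv_id, IsIso.inv_hom_id, T.wR_unit (T.act_mem_D _ _), T.wR_unit_left hD] at h2
  change T.wR g (inv g) (T.act g (T.actInv g a * T.pinv g b)) = _
  rw [h1, ← h2, hc, ← T.actInv_mul ha (star_mem hb), T.act_actInv (mul_mem ha (star_mem hb))]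

end TwistedPartialAction

/-! ### From covariant representations to Fell-bundle representations -/

namespace CovRepData

section

variable {X : Type u} [Groupoid.{v} X] [TopologicalSpace X] [TopologicalSpace (Arr X)]
  {H : X → Type*} [∀ x, NormedAddCommGroup (H x)] [∀ x, InnerProductSpace ℂ (H x)]
  [∀ x, CompleteSpace (H x)]
  {A : X → Type t} [∀ x, NonUnitalCStarAlgebra (A x)] {T : TwistedPartialAction X A}
  (c : CovRepData T H)
  {x y z : X} {g : y ⟶ z} {h : x ⟶ y}

theorem Ubar_apply {ξ : H y} (hξ : ξ ∈ essSub (c.φ y) (T.D (inv g))) :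
    c.Ubar g ξ = c.U g ⟨ξ, hξ⟩ := by
  have h2 : (essSub (c.φ y) (T.D (inv g))).orthogonalProjectionOnto ξ = ⟨ξ, hξ⟩ :=
    Submodule.orthogonalProjectionOnto_mem_subspace_eq_self ⟨ξ, hξ⟩
  simp [Ubar, h2]

theorem Ubar_orthogonal {ξ : H y} (hξ : ξ ∈ (essSub (c.φ y) (T.D (inv g)))ᗮ) :
    c.Ubar g ξ = 0 := by
  simp [Ubar, Submodule.orthogonalProjectionOnto_eq_zero_iff.2 hξ]

theorem Ubar_mem (ξ : H y) : c.Ubar g ξ ∈ essSub (c.φ z) (T.D g) := Subtype.coe_prop _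

theorem Ubar_symm (ζ : essSub (c.φ z) (T.D g)) : c.Ubar g ((c.U g).symm ζ : H y) = ζ := by
  rw [c.Ubar_apply (Subtype.coe_prop _)]
  simp

theorem Ubar_congr {g g' : y ⟶ z} (e : g = g') : c.Ubar g = c.Ubar g' := by rw [e]

theorem inner_Ubar {ξ η : H y} (hξ : ξ ∈ essSub (c.φ y) (T.D (inv g)))
    (hη : η ∈ essSub (c.φ y) (T.D (inv g))) : inner ℂ (c.Ubar g ξ) (c.Ubar g η) = inner ℂ ξ η := by
  rw [c.Ubar_apply hξ, c.Ubar_apply hη]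
  exact (c.U g).inner_map_map ⟨ξ, hξ⟩ ⟨η, hη⟩

theorem norm_Ubar {ξ : H y} (hξ : ξ ∈ essSub (c.φ y) (T.D (inv g))) : ‖c.Ubar g ξ‖ = ‖ξ‖ := by
  rw [c.Ubar_apply hξ]
  exact (c.U g).norm_map ⟨ξ, hξ⟩

/-- Ū_g is a partial isometry with initial space φ(D_{g⁻¹})H, so Ū_g^*Ū_g is the projection onto it.
-/
theorem adjoint_Ubar_Ubar {ξ : H y} (hξ : ξ ∈ essSub (c.φ y) (T.D (inv g))) :
    ContinuousLinearMap.adjoint (c.Ubar g) (c.Ubar g ξ) = ξ := by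
  refine ext_inner_left ℂ fun η => ?_
  rw [ContinuousLinearMap.adjoint_inner_right]
  obtain ⟨a, ha, b, hb, rfl⟩ := (essSub (c.φ y) (T.D (inv g))).exists_add_mem_mem_orthogonal η
  rw [map_add, c.Ubar_orthogonal hb, add_zero, c.inner_Ubar ha hξ, inner_add_left,
    (Submodule.mem_orthogonal' _ _).1 hb ξ hξ, add_zero]

/-- A covariant representation is determined by its operators `Ū_g` and representations `φ_x`. -/
theorem ext_of_Ubar {c c' : CovRepData T H} (hφ : ∀ x, c.φ x = c'.φ x)
    (hU : ∀ {x y : X} (g : x ⟶ y) (a : A x), a ∈ T.D (inv g) → ∀ ξ,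
      c.Ubar g (c.φ x a ξ) = c'.Ubar g (c'.φ x a ξ)) : c = c' := by
  -- The type of U depends on φ, so U and U' cannot be compared directly. The comparison is made in
  -- H y with a separate membership proof for each side, in a form that survives the later
  -- identification of φ with φ'.
  have key : ∀ {x y : X} (g : x ⟶ y) (ξ : H x) (h : ξ ∈ essSub (c.φ x) (T.D (inv g)))
      (h' : ξ ∈ essSub (c'.φ x) (T.D (inv g))), (c.U g ⟨ξ, h⟩ : H y) = c'.U g ⟨ξ, h'⟩ := by
    intro x y g ξ h h'
    rw [← c.Ubar_apply, ← c'.Ubar_apply]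
    refine eqOn_essSub (fun a ha ζ => ?_) h
    have h1 := hU g a ha ζ
    rwa [← hφ] at h1
  have e : c.φ = c'.φ := funext hφ
  clear hφ hU
  obtain ⟨φ, U⟩ := c
  obtain ⟨φ', U'⟩ := c'
  change φ = φ' at e
  subst e
  have e : @U = @U' := by
    funext x y g
    exact LinearIsometryEquiv.ext fun ξ => Subtype.ext (key g ξ ξ.2 ξ.2)
  rw [e]

end

/-! ### Consequences of covariance: product, involution, support and intertwiners -/

section

variable {X : Type u} [Groupoid.{v} X] [TopologicalSpace X] [TopologicalSpace (Arr X)]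
  {H : X → Type*} [∀ x, NormedAddCommGroup (H x)] [∀ x, InnerProductSpace ℂ (H x)]
  [∀ x, CompleteSpace (H x)] [MeasurableSpace X] [MeasurableSpace (Arr X)]
  {α : HaarSystem X} {ν : Measure X} {𝒮 : Submodule ℂ (∀ x, H x)}
  {A : X → Type t} [∀ x, NonUnitalCStarAlgebra (A x)] {T : TwistedPartialAction X A}
  {c : CovRepData T H} (hc : IsCovRep α ν 𝒮 T c)
  {x y z : X} {g : y ⟶ z} {h : x ⟶ y}

include hc

/-- Covariance without domain restrictions: on the orthogonal complement of φ(D_{g⁻¹})H both φ(a)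
and Ū_g vanish, hence so do both sides. -/
theorem Ubar_φ {a : A y} (ha : a ∈ T.D (inv g)) (ξ : H y) :
    c.Ubar g (c.φ y a ξ) = c.φ z (T.act g a) (c.Ubar g ξ) := by
  obtain ⟨η, hη, ζ, hζ, rfl⟩ :=
    (essSub (c.φ y) (T.D (inv g))).exists_add_mem_mem_orthogonal ξ
  rw [map_add, apply_orthogonal ha hζ, add_zero, map_add, c.Ubar_orthogonal hζ, add_zero]
  have h1 := hc.covariance g a ha (c.U g ⟨η, hη⟩)
  rw [c.Ubar_apply (apply_mem_essSub _ ha _), c.Ubar_apply hη, ← h1]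
  simp

theorem φ_Ubar {a : A z} (ha : a ∈ T.D g) (ξ : H y) :
    c.φ z a (c.Ubar g ξ) = c.Ubar g (c.φ y (T.actInv g a) ξ) := by
  rw [Ubar_φ hc (T.actInv_mem_D _ _), T.act_actInv ha]

/-- The two conditions on n put φ(n)ξ into the natural domain of U_g U_h, and 𝔞_{gh}(n) into the
ideal of which w(g, h) is a multiplier. The auxiliary operator V can then be evaluated, and it
disappears from the cocycle condition. -/
theorem Ubar_Ubar_φ {n : A x} (hn : n ∈ T.D (inv h)) (hn' : n ∈ T.D (inv (h ≫ g))) (ξ : H x) :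
    c.Ubar g (c.Ubar h (c.φ x n ξ)) =
      c.φ z (T.wL g h (T.act (h ≫ g) n)) (c.Ubar (h ≫ g) ξ) := by
  obtain ⟨V, hV, hU⟩ := hc.cocycle g h
  have h1 := apply_mem_essSub (c.φ x) hn ξ
  have h2 : c.Ubar h (c.φ x n ξ) ∈ essSub (c.φ y) (T.D (inv g)) := by
    rw [Ubar_φ hc hn]
    exact apply_mem_essSub _ (T.act_mem_left hn hn') _
  rw [c.Ubar_apply h1] at h2
  obtain ⟨h3, h4⟩ := hU _ h1 h2
  rw [c.Ubar_apply h1, c.Ubar_apply h2, h4, ← c.Ubar_apply h3, Ubar_φ hc hn',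
    hV.apply_apply _ (T.act_comp_mem hn hn')]
  rfl

/-- Triviality at units is a consequence of the axioms: as w(u, u) = 1, the operator Ū_u is
idempotent, and nondegeneracy together with D_u = B_x makes it isometric on all of H_x. -/
theorem Ubar_unit (x : X) : c.Ubar (𝟙 x) = ContinuousLinearMap.id ℂ (H x) := by
  have h0 : ∀ n : A x, n ∈ T.D (inv (𝟙 x)) := fun n => by rw [IsIso.inv_id]; exact T.mem_D_unit n
  have htop : ∀ ξ, ξ ∈ essSub (c.φ x) (T.D (inv (𝟙 x))) := fun ξ => by
    rw [IsIso.inv_id, T.D_unit, hc.nondegenerate]; trivial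
  have h1 : ∀ n ∈ (⊤ : NonUnitalStarSubalgebra ℂ (A x)), ∀ ξ,
      c.Ubar (𝟙 x) (c.φ x n ξ) = ContinuousLinearMap.id ℂ (H x) (c.φ x n ξ) := by
    intro n _ ξ
    have h2 := Ubar_Ubar_φ hc (g := 𝟙 x) (h := 𝟙 x) (n := n) (h0 n)
      (by rw [IsIso.inv_comp, IsIso.inv_id, Category.id_comp]; exact T.mem_D_unit n) ξ
    have h3 : T.wL (𝟙 x) (𝟙 x) (T.act (𝟙 x ≫ 𝟙 x) n) = n := by
      rw [Category.id_comp, T.act_unit]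
      unfold TwistedPartialActionData.wL
      rw [T.w_unit_left]
      refine multL_one ⟨T.mem_D_unit n, ?_⟩
      rw [Category.id_comp]
      exact T.mem_D_unit n
    rw [h3, c.Ubar_congr (Category.id_comp (𝟙 x))] at h2
    have h4 := Ubar_φ hc (h0 n) ξ
    rw [T.act_unit] at h4
    -- For v = φ(n)ξ the relations read Ū Ū v = Ū v, so the isometry Ū kills Ū v - v.
    rw [← h4, ← sub_eq_zero, ← map_sub, ← norm_eq_zero, c.norm_Ubar (htop _), norm_eq_zero,
      sub_eq_zero] at h2
    exact h2
  refine ContinuousLinearMap.ext fun ξ => eqOn_essSub h1 ?_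
  rw [hc.nondegenerate]; trivial

/-- Moving a through Ū_g and then m = 𝔞_g⁻¹(a)b through Ū_h turns the left side into Ū_g Ū_h φ(n)ξ
with n = 𝔞_h⁻¹(m). Since m lies in D_{g⁻¹} ∩ D_h, the cocycle rule applies to n, and w(g,
h)𝔞_{gh}(n) = 𝔞_g(m)w(g, h) is the Fell-bundle product. -/
theorem φ_Ubar_φ_Ubar {a : A z} (ha : a ∈ T.D g) {b : A y} (hb : b ∈ T.D h) (ξ : H x) :
    c.φ z a (c.Ubar g (c.φ y b (c.Ubar h ξ))) = c.φ z (T.pmul g h a b) (c.Ubar (h ≫ g) ξ) := by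
  have hm := T.dom_left (g := g) a b
  have hm' := T.dom_right (g := g) a hb
  rw [φ_Ubar hc ha, apply_apply, φ_Ubar hc hm']
  have hn := T.actInv_mem_D h (T.actInv g a * b)
  have hn' : T.actInv h (T.actInv g a * b) ∈ T.D (inv (h ≫ g)) := by
    refine T.actInv_mem _ hm' ?_
    simpa using hm
  rw [Ubar_Ubar_φ hc hn hn', ← T.wR_act_act hn hn', T.act_actInv hm']
  rfl

/-- Both operators vanish on the complement of φ(D_g)H. On φ(b)ξ, the vector ξ may be replaced by
some Ū_g ζ; then both sides equal φ(𝔞_g⁻¹(a^*b))ζ, one by covariance and Ū_g^*Ū_g, the other by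
multiplicativity. -/
theorem adjoint_φ_Ubar {a : A z} (ha : a ∈ T.D g) :
    ContinuousLinearMap.adjoint ((c.φ z a).comp (c.Ubar g)) =
      (c.φ y (T.pinv g a)).comp (c.Ubar (inv g)) := by
  refine continuousLinearMap_ext_essSub (φ := c.φ z) (I := T.D g) (fun b hb ξ => ?_) fun ξ hξ => ?_
  · obtain ⟨ζ, hζ⟩ : ∃ ζ, c.φ z b ξ = c.φ z b (c.Ubar g ζ) := by
      obtain ⟨η, hη, θ, hθ, rfl⟩ := (essSub (c.φ z) (T.D g)).exists_add_mem_mem_orthogonal ξ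
      exact ⟨(c.U g).symm ⟨η, hη⟩, by
        rw [map_add, apply_orthogonal hb hθ, add_zero, c.Ubar_symm]⟩
    have h1 := φ_Ubar_φ_Ubar hc (T.pinv_mem (g := g) a) hb ζ
    rw [T.pmul_pinv ha hb, c.Ubar_congr (IsIso.hom_inv_id g), Ubar_unit hc] at h1
    rw [hζ, ContinuousLinearMap.comp_apply, h1, ContinuousLinearMap.adjoint_comp,
      ContinuousLinearMap.comp_apply, ← ContinuousLinearMap.star_eq_adjoint, ← map_star,
      apply_apply, φ_Ubar hc (mul_mem (star_mem ha) hb),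
      c.adjoint_Ubar_Ubar (apply_mem_essSub _ (T.actInv_mem_D _ _) _)]
    rfl
  · rw [ContinuousLinearMap.adjoint_comp, ContinuousLinearMap.comp_apply,
      ← ContinuousLinearMap.star_eq_adjoint, ← map_star, apply_orthogonal (star_mem ha) hξ, map_zero,
      ContinuousLinearMap.comp_apply, c.Ubar_orthogonal (by rwa [IsIso.inv_inv]), map_zero]

variable [IsTopologicalGroupoid X]

theorem toFellRep_unit (x : X) (a : A x) (ha : a ∈ T.D (𝟙 x)) :
    c.toFellRep.S (𝟙 x) (⟨a, ha⟩ : T.D (𝟙 x)) = c.φ x a := by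
  change (c.φ x a).comp (c.Ubar (𝟙 x)) = _
  rw [Ubar_unit hc]
  rfl

theorem toFellRep_iso (a : A y) (ha : a ∈ T.D (inv g)) (ξ : H y) :
    (c.U g ⟨c.φ y a ξ, apply_mem_essSub (c.φ y) ha ξ⟩ : H z) =
      c.toFellRep.S g (T.iso g ⟨a, ha⟩) ξ := by
  rw [← c.Ubar_apply, Ubar_φ hc ha, T.act_of_mem ha]
  rfl

/-- The product of a and the adjoint of b in the bundle acts as φ(ab^*). Nonvanishing of φ(a) is
detected by such elements because ‖φ(a)ξ‖² = ⟨ξ, φ(a^*a)ξ⟩. -/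
theorem toFellRep_support : c.toFellRep.support = c.support := by
  have key : ∀ (g : Arr X) (a b : A g.rng) (ha : a ∈ T.D g.hom) (hb : b ∈ T.D g.hom) ξ,
      c.toFellRep.S (inv g.hom ≫ g.hom)
        (T.fellBundle.mul (⟨a, ha⟩ : T.D g.hom) (T.fellBundle.invol (⟨b, hb⟩ : T.D g.hom))) ξ =
        c.φ g.rng (a * star b) ξ := by
    intro g a b ha hb ξ
    change c.φ g.rng (T.pmul g.hom (inv g.hom) a (T.pinv g.hom b)) (c.Ubar _ ξ) = _
    rw [T.pmul_pinv_right ha hb, c.Ubar_congr (IsIso.inv_hom_id g.hom), Ubar_unit hc]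
    rfl
  ext g
  constructor
  · rintro ⟨⟨a, ha⟩, ⟨b, hb⟩, ξ, h⟩
    rw [key g a b ha hb] at h
    exact ⟨_, mul_mem ha (star_mem hb), ξ, h⟩
  · rintro ⟨a, ha, ξ, h⟩
    refine ⟨⟨star a, star_mem ha⟩, ⟨star a, star_mem ha⟩, ξ, ?_⟩
    rw [key g _ _ (star_mem ha) (star_mem ha), star_star, ← apply_apply]
    intro h2
    apply h
    rw [← inner_self_eq_zero (𝕜 := ℂ), inner_apply_left, h2, inner_zero_right]

theorem toFellRep_injective {c' : CovRepData T H} (hc' : IsCovRep α ν 𝒮 T c')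
    (h : c.toFellRep = c'.toFellRep) : c = c' := by
  have hφ : ∀ x, c.φ x = c'.φ x := fun x => by
    ext a : 1
    rw [← toFellRep_unit hc x a (T.mem_D_unit a), h, toFellRep_unit hc' x a (T.mem_D_unit a)]
  refine ext_of_Ubar hφ fun {x y} g a ha ξ => ?_
  rw [c.Ubar_apply (apply_mem_essSub _ ha _), c'.Ubar_apply (apply_mem_essSub _ ha _),
    toFellRep_iso hc a ha, toFellRep_iso hc' a ha, h]

/-- One direction uses S_g(a) = Ū_g φ(𝔞_g⁻¹(a)). In the other, unit arrows give the relation for φ,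
which makes V preserve the domains; the relation for U_g is then tested on φ(a)ζ, where U_g φ(a)ζ =
S_g(𝔞_g(a))ζ. Everything happens arrow by arrow. -/
theorem intertwines_iff {H' : X → Type*} [∀ x, NormedAddCommGroup (H' x)]
    [∀ x, InnerProductSpace ℂ (H' x)] [∀ x, CompleteSpace (H' x)] {ν' : Measure X}
    {𝒮' : Submodule ℂ (∀ x, H' x)} {c' : CovRepData T H'} (hc' : IsCovRep α ν' 𝒮' T c')
    (E : Set X) (V : ∀ x, H x →L[ℂ] H' x) :
    c.Intertwines c' E V ↔ c.toFellRep.Intertwines c'.toFellRep E V := by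
  constructor
  · intro hV x hx y hy g ⟨a, ha⟩ ξ
    change V y (c.φ y a (c.Ubar g ξ)) = c'.φ y a (c'.Ubar g (V x ξ))
    have ha' := T.actInv_mem_D g a
    rw [φ_Ubar hc ha, φ_Ubar hc' ha, ← hV.map_φ x hx, c.Ubar_apply (apply_mem_essSub _ ha' _)]
    obtain ⟨h1, h2⟩ := hV.map_U x hx y hy g ⟨_, apply_mem_essSub (c.φ x) ha' ξ⟩
    rw [h2, ← c'.Ubar_apply]
  · intro hV
    have hφ : ∀ x ∈ E, ∀ (a : A x) (ξ : H x), V x (c.φ x a ξ) = c'.φ x a (V x ξ) := by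
      intro x hx a ξ
      have := hV x hx x hx (𝟙 x) (⟨a, T.mem_D_unit a⟩ : T.D (𝟙 x)) ξ
      rwa [toFellRep_unit hc, toFellRep_unit hc'] at this
    refine ⟨hφ, fun x hx y hy g ξ => ?_⟩
    have h1 : essSub (c.φ x) (T.D (inv g)) ≤
        (essSub (c'.φ x) (T.D (inv g))).comap (V x : H x →ₗ[ℂ] H' x) := by
      refine essSub_le (isClosed_essSub.preimage (V x).continuous) fun a ha ζ => ?_
      change V x (c.φ x a ζ) ∈ essSub (c'.φ x) (T.D (inv g))
      rw [hφ x hx]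
      exact apply_mem_essSub _ ha _
    refine ⟨h1 ξ.2, ?_⟩
    rw [← c'.Ubar_apply, ← c.Ubar_apply ξ.2]
    refine eqOn_essSub (f := (V y).comp (c.Ubar g)) (f' := (c'.Ubar g).comp (V x))
      (fun a ha ζ => ?_) ξ.2
    have h2 := hV x hx y hy g (T.iso g ⟨a, ha⟩) ζ
    rw [← toFellRep_iso hc, ← toFellRep_iso hc', ← c.Ubar_apply, ← c'.Ubar_apply] at h2
    rw [ContinuousLinearMap.comp_apply, h2, ContinuousLinearMap.comp_apply, hφ x hx]

/-- The algebraic properties of the Fell-bundle representation of a covariant representation. -/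
theorem toFellRep_multiplicative (a : T.fellBundle.fib g) (b : T.fellBundle.fib h) :
    (c.toFellRep.S g a).comp (c.toFellRep.S h b) =
      c.toFellRep.S (h ≫ g) (T.fellBundle.mul a b) := by
  ext ξ
  exact φ_Ubar_φ_Ubar hc a.2 b.2 ξ

theorem toFellRep_adjoint (a : T.fellBundle.fib g) :
    ContinuousLinearMap.adjoint (c.toFellRep.S g a) =
      c.toFellRep.S (inv g) (T.fellBundle.invol a) :=
  adjoint_φ_Ubar hc a.2

theorem toFellRep_nondegenerate (x : X) : (Submodule.span ℂ
    {ζ : H x | ∃ (a : T.fellBundle.fib (𝟙 x)) (ξ : H x),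
      ζ = c.toFellRep.S (𝟙 x) a ξ}).topologicalClosure = ⊤ := by
  rw [← hc.nondegenerate x]
  unfold essSub
  congr 2
  ext ζ
  constructor
  · rintro ⟨⟨a, ha⟩, ξ, rfl⟩
    exact ⟨a, trivial, ξ, by rw [toFellRep_unit hc]⟩
  · rintro ⟨a, -, ξ, rfl⟩
    exact ⟨(⟨a, T.mem_D_unit a⟩ : T.D (𝟙 x)), ξ, by rw [toFellRep_unit hc]⟩

end

end CovRepData

/-! ### Approximation of almost everywhere measurable functions -/

/-- A function that is approximated, on the sets of countable covers, by almost everywhere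
measurable functions is almost everywhere measurable. -/
theorem aemeasurable_of_forall_approx {Y : Type*} [MeasurableSpace Y] {μ : Measure Y} {F : Y → ℂ}
    (C : Y → ℝ)
    (h : ∀ n : ℕ, ∃ (m : ℕ → Y → ℂ) (M : ℕ → Set Y), (∀ k, AEMeasurable (m k) μ) ∧
      (∀ k, NullMeasurableSet (M k) μ) ∧ (∀ y, ∃ k, y ∈ M k) ∧
      ∀ k, ∀ y ∈ M k, dist (m k y) (F y) ≤ C y * (1 / ((n : ℝ) + 1))) :
    AEMeasurable F μ := by
  classical
  choose m M hm hM hcov hd using h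
  -- At each point the first admissible index k is used. The resulting function is m n k on the
  -- disjoint pieces M n k \ ⋃_{j<k} M n j. The bound C y / (n + 1) gives pointwise convergence,
  -- which is enough.
  refine aemeasurable_of_tendsto_metrizable_ae (μ := μ) atTop
    (f := fun n y => m n (Nat.find (hcov n y)) y) (fun n => ?_) (Eventually.of_forall fun y => ?_)
  · refine NullMeasurable.aemeasurable fun B hB => ?_
    have e : (fun y => m n (Nat.find (hcov n y)) y) ⁻¹' B =
        ⋃ k, (M n k \ ⋃ j : Fin k, M n j) ∩ m n k ⁻¹' B := by
      ext y
      simp only [Set.mem_preimage, Set.mem_iUnion, Set.mem_inter_iff, Set.mem_sdiff, not_exists]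
      constructor
      · intro hy
        exact ⟨_, ⟨Nat.find_spec (hcov n y), fun j => Nat.find_min (hcov n y) j.2⟩, hy⟩
      · rintro ⟨k, ⟨h1, h2⟩, h3⟩
        have : Nat.find (hcov n y) = k :=
          (Nat.find_eq_iff _).2 ⟨h1, fun j hj => h2 ⟨j, hj⟩⟩
        rwa [this]
    rw [e]
    exact NullMeasurableSet.iUnion fun k =>
      ((hM n k).diff (NullMeasurableSet.iUnion fun j : Fin k => hM n j)).inter
        ((hm n k).nullMeasurable hB)
  · rw [tendsto_iff_dist_tendsto_zero]
    refine squeeze_zero (fun _ => dist_nonneg) (fun n => hd n _ y (Nat.find_spec (hcov n y))) ?_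
    simpa using tendsto_one_div_add_atTop_nhds_zero_nat.const_mul (C y)

/-- A function is almost everywhere measurable if the preimages of closed sets are null
measurable. -/
theorem aemeasurable_of_isClosed {Y : Type*} [MeasurableSpace Y] {μ : Measure Y} {F : Y → ℂ}
    (h : ∀ K : Set ℂ, IsClosed K → K.Nonempty → NullMeasurableSet (F ⁻¹' K) μ) :
    AEMeasurable F μ := by
  refine NullMeasurable.aemeasurable ?_
  -- Null measurable sets form a σ-algebra, so closed sets suffice as generators of the Borel sets.
  have : @Measurable (NullMeasurableSpace Y μ) ℂ _ _ F := by
    refine measurable_of_isClosed' fun K hK hne _ => h K hK hne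
  exact fun B hB => this hB

/-! ### Haar systems -/

section Haar

variable {X : Type u} [Groupoid.{v} X] [TopologicalSpace X] [TopologicalSpace (Arr X)]
  [hG : IsTopologicalGroupoid X]

theorem measurable_inverse [MeasurableSpace (Arr X)] [BorelSpace (Arr X)] :
    Measurable (Arr.inverse : Arr X → Arr X) :=
  hG.continuous_inverse.measurable

/-- The source map is a continuous left inverse of the unit map. This embedding gives the object
space the Hausdorff property, local compactness and second countability, which are assumed only for
the arrows. -/
theorem isClosedEmbedding_unit [T2Space (Arr X)] :
    IsClosedEmbedding (Arr.unit : X → Arr X) :=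
  Function.LeftInverse.isClosedEmbedding (f := Arr.src) (fun _ => rfl) hG.continuous_src
    hG.continuous_unit

variable (X) in
theorem t2Space_obj [T2Space (Arr X)] : T2Space X :=
  (isClosedEmbedding_unit (X := X)).isEmbedding.t2Space

variable (X) in
theorem locallyCompactSpace_obj [T2Space (Arr X)] [LocallyCompactSpace (Arr X)] :
    LocallyCompactSpace X :=
  (isClosedEmbedding_unit (X := X)).locallyCompactSpace

variable [T2Space (Arr X)] [LocallyCompactSpace (Arr X)] [SecondCountableTopology (Arr X)]
  [MeasurableSpace X] [BorelSpace X] [MeasurableSpace (Arr X)] [BorelSpace (Arr X)]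

namespace HaarSystem

variable (α : HaarSystem X)

instance (x : X) : IsFiniteMeasureOnCompacts (α.measure x) := ⟨fun K hK =>
  α.finite_on_compacts x K hK⟩

omit hG in
-- Exhaust W by increasing closed, hence compact, sets F n, and take Urysohn functions f n that are
-- 1 on F n and 0 off W. Then α^x(F n) ≤ ∫ f n dα^x ≤ α^x(W), so α^x(W) is the supremum of these
-- integrals, each of which is continuous in x.
theorem measurable_measure_of_isOpen {W : Set (Arr X)} (hW : IsOpen W)
    (hc : IsCompact (closure W)) : Measurable fun x => α.measure x W := by
  let := TopologicalSpace.metrizableSpaceMetric (Arr X)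
  obtain ⟨F, hF, hFW, hFu, hFm⟩ := hW.exists_iUnion_isClosed
  have hFc : ∀ n, IsCompact (F n) := fun n =>
    hc.of_isClosed_subset (hF n) ((hFW n).trans subset_closure)
  choose f hf1 hf0 hfc hf using fun n => exists_continuous_one_zero_of_isCompact (hFc n)
    hW.isClosed_compl (Set.disjoint_compl_right_iff_subset.2 (hFW n))
  have e : ∀ x, α.measure x W = ⨆ n, ENNReal.ofReal (∫ g, f n g ∂α.measure x) := by
    intro x
    have hi : ∀ n, ENNReal.ofReal (∫ g, f n g ∂α.measure x) =
        ∫⁻ g, ENNReal.ofReal (f n g) ∂α.measure x := fun n =>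
      ofReal_integral_eq_lintegral_ofReal
        ((f n).continuous.integrable_of_hasCompactSupport (hfc n))
        (Eventually.of_forall fun g => (hf n g).1)
    refine le_antisymm ?_ (iSup_le fun n => ?_)
    · rw [← hFu, hFm.measure_iUnion]
      refine iSup_mono fun n => ?_
      rw [hi, ← lintegral_indicator_one (hF n).measurableSet]
      refine lintegral_mono fun g => ?_
      by_cases hg : g ∈ F n
      · simp [hg, hf1 n hg]
      · simp [hg]
    · rw [hi, ← lintegral_indicator_one hW.measurableSet]
      refine lintegral_mono fun g => ?_
      by_cases hg : g ∈ W
      · simpa [hg] using (hf n g).2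
      · have : f n g = 0 := hf0 n hg
        simp [hg, this]
  simp only [e]
  exact Measurable.iSup fun n =>
    (α.continuous_integral _ (f n).continuous (hfc n)).measurable.ennreal_ofReal

omit hG in
-- The measures α^x need not be finite, so the π-system argument with open sets is run on the
-- interiors of a compact exhaustion, and the results are combined by monotone limits.
theorem measurable_measure : Measurable α.measure := by
  let K : CompactExhaustion (Arr X) := default
  have hfin : ∀ n x, IsFiniteMeasure ((α.measure x).restrict (interior (K n))) := fun n x =>
    ⟨by
      rw [Measure.restrict_apply_univ]
      exact (measure_mono interior_subset).trans_lt ((K.isCompact n).measure_lt_top)⟩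
  have h1 : ∀ n, Measurable fun x => (α.measure x).restrict (interior (K n)) := by
    intro n
    have h2 : ∀ V : Set (Arr X), IsOpen V →
        Measurable fun x => (α.measure x).restrict (interior (K n)) V := by
      intro V hV
      simp only [Measure.restrict_apply hV.measurableSet]
      refine α.measurable_measure_of_isOpen (hV.inter isOpen_interior) ?_
      exact (K.isCompact n).of_isClosed_subset isClosed_closure
        (closure_minimal (Set.inter_subset_right.trans interior_subset) (K.isCompact n).isClosed)
    exact Measurable.measure_of_isPiSystem (BorelSpace.measurable_eq) isPiSystem_isOpen h2
      (h2 _ isOpen_univ)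
  refine Measure.measurable_of_measurable_coe _ fun s hs => ?_
  have h3 : ∀ x, α.measure x s = ⨆ n, (α.measure x).restrict (interior (K n)) s := by
    intro x
    simp only [Measure.restrict_apply hs]
    have hmono : Monotone fun n => s ∩ interior (K n) := fun m n hmn =>
      Set.inter_subset_inter_right _ (interior_mono (K.subset hmn))
    rw [← hmono.measure_iUnion, ← Set.inter_iUnion]
    congr 1
    have : (⋃ n, interior (K n)) = Set.univ :=
      Set.eq_univ_of_forall fun g => by
        obtain ⟨n, hn⟩ := K.exists_mem g
        exact Set.mem_iUnion.2 ⟨n + 1, K.subset_interior_succ n hn⟩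
    rw [this, Set.inter_univ]
  simp only [h3]
  exact Measurable.iSup fun n => (Measure.measurable_coe hs).comp (h1 n)

omit hG in
theorem measurable_coe {s : Set (Arr X)} (hs : MeasurableSet s) :
    Measurable fun x => α.measure x s :=
  (Measure.measurable_coe hs).comp α.measurable_measure

/-- α^x is concentrated on r⁻¹(x), so for x outside s it does not charge r⁻¹(s). -/
theorem quasiMeasurePreserving_rng (ν : Measure X) :
    Measure.QuasiMeasurePreserving Arr.rng (α.comp ν) ν := by
  refine ⟨hG.continuous_rng.measurable, Measure.AbsolutelyContinuous.mk fun s hs h => ?_⟩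
  rw [Measure.map_apply hG.continuous_rng.measurable hs, comp,
    Measure.bind_apply (hG.continuous_rng.measurable hs) α.measurable_measure.aemeasurable,
    lintegral_eq_zero_iff (α.measurable_coe (hG.continuous_rng.measurable hs))]
  have h1 : ∀ᵐ x ∂ν, x ∉ s := measure_eq_zero_iff_ae_notMem.1 h
  filter_upwards [h1] with x hx
  refine measure_mono_null (fun g hg => ?_) (α.supported x)
  rintro rfl
  exact hx hg

omit [T2Space (Arr X)] [LocallyCompactSpace (Arr X)] [SecondCountableTopology (Arr X)]
  [BorelSpace X] in
theorem quasiMeasurePreserving_inverse (ν : Measure X) :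
    Measure.QuasiMeasurePreserving Arr.inverse (α.compTilde ν) (α.comp ν) := by
  refine ⟨measurable_inverse, ?_⟩
  have e : (Arr.inverse ∘ Arr.inverse : Arr X → Arr X) = id := by
    funext g
    simp [Arr.inverse]
  rw [compTilde, Measure.map_map measurable_inverse measurable_inverse, e, Measure.map_id]

theorem quasiMeasurePreserving_src (ν : Measure X) :
    Measure.QuasiMeasurePreserving Arr.src (α.compTilde ν) ν :=
  (α.quasiMeasurePreserving_rng ν).comp (α.quasiMeasurePreserving_inverse ν)

omit hG in
theorem comp_absolutelyContinuous {ν μ : Measure X} (h : ν ≪ μ) : α.comp ν ≪ α.comp μ := by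
  refine Measure.AbsolutelyContinuous.mk fun s hs h1 => ?_
  have hm := α.measurable_coe hs
  rw [comp, Measure.bind_apply hs α.measurable_measure.aemeasurable,
    lintegral_eq_zero_iff hm] at h1 ⊢
  exact h.ae_le h1

theorem compTilde_absolutelyContinuous {ν μ : Measure X} (h : ν ≪ μ) :
    α.compTilde ν ≪ α.compTilde μ :=
  (α.comp_absolutelyContinuous h).map measurable_inverse

omit hG in
-- A measurable set that agrees with P almost everywhere for ν ∘ α agrees with it α^x-almost
-- everywhere for ν-almost all x.
theorem nullMeasurableSet_measure_ne_zero {ν : Measure X} {P : Set (Arr X)}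
    (hP : NullMeasurableSet P (α.comp ν)) : NullMeasurableSet {x | α.measure x P ≠ 0} ν := by
  obtain ⟨P', hP', hPP⟩ := hP
  have h1 : MeasurableSet {x | α.measure x P' ≠ 0} :=
    α.measurable_coe hP' (measurableSet_singleton 0).compl
  refine h1.nullMeasurableSet.congr ?_
  have h2 := Measure.ae_ae_of_ae_bind α.measurable_measure.aemeasurable hPP
  filter_upwards [h2] with x hx
  have h3 : α.measure x P = α.measure x P' := measure_congr hx
  change (α.measure x P' ≠ 0) = (α.measure x P ≠ 0)
  rw [h3]

/-- A function on the object space is almost everywhere measurable if its pull-back along the range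
map is approximated near the units by almost everywhere measurable functions on the arrow space. -/
theorem aemeasurable_of_approx_near_units {ν : Measure X} {F : X → ℂ} {C : X → ℝ}
    (hC : AEMeasurable C ν) {ι : ℕ → Type*} [∀ n, Countable (ι n)] {W : ∀ n, ι n → Set (Arr X)}
    (hW : ∀ n i, IsOpen (W n i)) {m : ∀ n, ι n → Arr X → ℂ}
    (hm : ∀ n i, AEMeasurable (m n i) (α.comp ν)) (hcov : ∀ n x, ∃ i, Arr.unit x ∈ W n i)
    (hd : ∀ n i, ∀ g ∈ W n i, dist (m n i g) (F g.rng) ≤ C g.rng * (1 / ((n : ℝ) + 1))) :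
    AEMeasurable F ν := by
  refine aemeasurable_of_isClosed fun K hK hne => ?_
  -- P n i collects the arrows in W n i whose approximate value m n i is as close to K as the error
  -- bound permits.
  let P : ∀ n, ι n → Set (Arr X) := fun n i =>
    W n i ∩ {g | Metric.infDist (m n i g) K ≤ C g.rng * (1 / ((n : ℝ) + 1))}
  have hP : ∀ n i, NullMeasurableSet (P n i) (α.comp ν) := fun n i =>
    (hW n i).measurableSet.nullMeasurableSet.inter (nullMeasurableSet_le
      (Metric.continuous_infDist_pt K |>.measurable.comp_aemeasurable (hm n i))
      ((hC.comp_quasiMeasurePreserving (α.quasiMeasurePreserving_rng ν)).mul_const _))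
  -- The condition that P n i meets r⁻¹(x) is replaced by α^x(P n i) ≠ 0, which is null measurable
  -- in x. If F x ∈ K, then P n i contains W n i ∩ r⁻¹(x), and this has positive measure by full
  -- support when W n i contains the unit at x. Conversely, a non-null P n i contains an arrow with
  -- range x, so F x has distance at most 2C(x)/(n + 1) from K for every n, and K is closed.
  have e : F ⁻¹' K = ⋂ n, ⋃ i, {x | α.measure x (P n i) ≠ 0} := by
    ext x
    simp only [Set.mem_preimage, Set.mem_iInter, Set.mem_iUnion, Set.mem_ofPred_eq]
    constructor
    · intro hx n
      obtain ⟨i, hi⟩ := hcov n x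
      refine ⟨i, fun h0 => α.full_support (Arr.unit x) (W n i) (hW n i) hi ?_⟩
      refine measure_mono_null (t := P n i ∪ {g | g.rng ≠ x}) (fun g hg => ?_)
        (measure_union_null h0 (α.supported x))
      by_cases hgx : g.rng = x
      · refine Or.inl ⟨hg, ?_⟩
        refine (Metric.infDist_le_dist_of_mem ?_).trans (hd n i g hg)
        rw [hgx]; exact hx
      · exact Or.inr hgx
    · intro hx
      have h1 : ∀ n : ℕ, Metric.infDist (F x) K ≤ 2 * C x * (1 / ((n : ℝ) + 1)) := by
        intro n
        obtain ⟨i, hi⟩ := hx n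
        obtain ⟨g, hg, hgx⟩ : ∃ g ∈ P n i, g.rng = x := by
          by_contra! hcon
          exact hi (measure_mono_null (fun g hg => hcon g hg) (α.supported x))
        have h2 := hd n i g hg.1
        have h3 : Metric.infDist (m n i g) K ≤ _ := hg.2
        have h4 := Metric.infDist_le_infDist_add_dist (s := K) (x := F x) (y := m n i g)
        rw [hgx] at h2 h3
        rw [dist_comm] at h4
        linarith
      have h2 : Metric.infDist (F x) K ≤ 0 := by
        have h3 := (tendsto_one_div_add_atTop_nhds_zero_nat (𝕜 := ℝ)).const_mul (2 * C x)
        rw [mul_zero] at h3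
        exact ge_of_tendsto' h3 h1
      exact (hK.mem_iff_infDist_zero hne).2 (le_antisymm h2 Metric.infDist_nonneg)
  rw [e]
  exact NullMeasurableSet.iInter fun n => NullMeasurableSet.iUnion fun i =>
    α.nullMeasurableSet_measure_ne_zero (hP n i)

end HaarSystem

end Haar

/-! ### Measurable sections -/

section MeasurableSections

section

variable {X : Type u} {H : X → Type*} [∀ x, NormedAddCommGroup (H x)]
  [∀ x, InnerProductSpace ℂ (H x)] {𝒮 : Submodule ℂ (∀ x, H x)}
  {Y : Type*} [MeasurableSpace Y] {μ : Measure Y} {p : Y → X}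

theorem IsMeasurableSection.sub {ξ η : ∀ y, H (p y)} (hξ : IsMeasurableSection 𝒮 μ p ξ)
    (hη : IsMeasurableSection 𝒮 μ p η) : IsMeasurableSection 𝒮 μ p fun y => ξ y - η y := by
  intro ζ hζ
  simp only [inner_sub_right]
  exact (hξ ζ hζ).sub (hη ζ hζ)

theorem IsMeasurableSection.mono_ac {μ' : Measure Y} (h : μ' ≪ μ) {ξ : ∀ y, H (p y)}
    (hξ : IsMeasurableSection 𝒮 μ p ξ) : IsMeasurableSection 𝒮 μ' p ξ :=
  fun ζ hζ => (hξ ζ hζ).mono_ac h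

end

variable {X : Type u} {H : X → Type*} [∀ x, NormedAddCommGroup (H x)]
  [∀ x, InnerProductSpace ℂ (H x)] [MeasurableSpace X] {ν : Measure X}
  {𝒮 : Submodule ℂ (∀ x, H x)} (h𝒮 : IsMeasurableField ν 𝒮)
  {Y : Type*} [MeasurableSpace Y] {μ : Measure Y} {p : Y → X}

include h𝒮

/-- The axioms for 𝒮 give measurable norms; polarization turns them into measurable inner products.
-/
theorem IsMeasurableField.aemeasurable_inner {ξ η : ∀ x, H x} (hξ : ξ ∈ 𝒮) (hη : η ∈ 𝒮) :
    AEMeasurable (fun x => inner ℂ (ξ x) (η x)) ν := by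
  simp only [inner_eq_sum_norm_sq_div_four]
  have h1 := h𝒮.norm _ (add_mem hξ hη)
  have h2 := h𝒮.norm _ (sub_mem hξ hη)
  have h3 := h𝒮.norm _ (sub_mem hξ (𝒮.smul_mem Complex.I hη))
  have h4 := h𝒮.norm _ (add_mem hξ (𝒮.smul_mem Complex.I hη))
  simp only [Pi.add_apply, Pi.sub_apply, Pi.smul_apply] at h1 h2 h3 h4
  have c1 := Complex.measurable_ofReal.comp_aemeasurable h1
  have c2 := Complex.measurable_ofReal.comp_aemeasurable h2
  have c3 := Complex.measurable_ofReal.comp_aemeasurable h3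
  have c4 := Complex.measurable_ofReal.comp_aemeasurable h4
  exact (((c1.pow_const 2).sub (c2.pow_const 2)).add
    (((c3.pow_const 2).sub (c4.pow_const 2)).mul_const Complex.I)).div_const 4

theorem IsMeasurableField.isMeasurableSection_comp {ξ : ∀ x, H x} (hξ : ξ ∈ 𝒮)
    (hp : Measure.QuasiMeasurePreserving p μ ν) :
    IsMeasurableSection 𝒮 μ p fun y => ξ (p y) := fun _ hη =>
  (h𝒮.aemeasurable_inner hη hξ).comp_quasiMeasurePreserving hp

/-- A list of pairs (i, n) encodes the combination Σ q_i e_n with coefficients from a dense sequence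
in ℂ. This upgrades totality to a countable family of sections that is dense in every fibre. -/
theorem IsMeasurableField.exists_denseRange :
    ∃ c : List (ℕ × ℕ) → ∀ x, H x, (∀ l, c l ∈ 𝒮) ∧ ∀ x, DenseRange fun l => c l x := by
  obtain ⟨e, he, ht⟩ := h𝒮.total
  let q := TopologicalSpace.denseSeq ℂ
  let c : List (ℕ × ℕ) → ∀ x, H x := fun l => (l.map fun p => q p.1 • e p.2).sum
  refine ⟨c, fun l => ?_, fun x => ?_⟩
  · refine 𝒮.toAddSubmonoid.list_sum_mem fun v hv => ?_
    obtain ⟨p, -, rfl⟩ := List.mem_map.1 hv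
    exact 𝒮.smul_mem _ (he _)
  · have hadd : ∀ v ∈ closure (Set.range fun l => c l x), ∀ w ∈ closure (Set.range fun l => c l x),
        v + w ∈ closure (Set.range fun l => c l x) := by
      intro v hv w hw
      refine map_mem_closure₂ continuous_add hv hw ?_
      rintro _ ⟨l, rfl⟩ _ ⟨l', rfl⟩
      exact ⟨l ++ l', by simp [c]⟩
    have hsmul : ∀ (a : ℂ) (n : ℕ), a • e n x ∈ closure (Set.range fun l => c l x) := by
      intro a n
      refine map_mem_closure (f := fun a : ℂ => a • e n x) (by fun_prop)
        (TopologicalSpace.denseRange_denseSeq ℂ a) ?_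
      rintro _ ⟨i, rfl⟩
      exact ⟨[(i, n)], by simp [c, q]⟩
    have h1 : (Submodule.span ℂ (Set.range fun n => e n x) : Set (H x)) ⊆
        closure (Set.range fun l => c l x) := by
      intro v hv
      obtain ⟨a, rfl⟩ := Finsupp.mem_span_range_iff_exists_finsupp.1 hv
      refine Finset.sum_induction _ (· ∈ closure (Set.range fun l => c l x))
        (fun v w hv hw => hadd v hv w hw) ?_ fun n _ => hsmul _ n
      simpa using hsmul 0 0
    intro v
    have h2 : v ∈ (Submodule.span ℂ (Set.range fun n => e n x)).topologicalClosure := by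
      rw [ht]; trivial
    exact closure_minimal h1 isClosed_closure h2

/-- Measurability of a section of the pull-back is defined weakly. The bound ‖ζ‖ ≤ δ is equivalent
to |⟨c, ζ⟩| ≤ ‖c‖δ for all c in a countable dense family. -/
theorem IsMeasurableField.nullMeasurableSet_norm_le (hp : Measure.QuasiMeasurePreserving p μ ν)
    {ζ : ∀ y, H (p y)} (hζ : IsMeasurableSection 𝒮 μ p ζ) {δ : ℝ} (hδ : 0 ≤ δ) :
    NullMeasurableSet {y | ‖ζ y‖ ≤ δ} μ := by
  obtain ⟨c, hc, hd⟩ := h𝒮.exists_denseRange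
  have e : {y | ‖ζ y‖ ≤ δ} = ⋂ l, {y | ‖inner ℂ (c l (p y)) (ζ y)‖ ≤ ‖c l (p y)‖ * δ} := by
    ext y
    simp only [Set.mem_ofPred_eq, Set.mem_iInter]
    constructor
    · intro h l
      exact (norm_inner_le_norm _ _).trans (mul_le_mul_of_nonneg_left h (norm_nonneg _))
    · intro h
      have h1 : ∀ v : H (p y), ‖inner ℂ v (ζ y)‖ ≤ ‖v‖ * δ := fun v =>
        (hd (p y)).induction_on (p := fun v => ‖inner ℂ v (ζ y)‖ ≤ ‖v‖ * δ) v
          (isClosed_le (by fun_prop) (by fun_prop)) h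
      have h2 := h1 (ζ y)
      rw [inner_self_eq_norm_sq_to_K, norm_pow, norm_algebraMap', norm_norm, sq] at h2
      by_contra! h3
      nlinarith [norm_nonneg (ζ y)]
  rw [e]
  refine NullMeasurableSet.iInter fun l => nullMeasurableSet_le (hζ _ (hc l)).norm ?_
  exact ((h𝒮.norm _ (hc l)).comp_quasiMeasurePreserving hp).mul_const δ

end MeasurableSections

/-! ### Continuous sections -/

section ContinuousSections

/-- Near b, the constant multiple χ(b)f is a good approximation: |χ - χ(b)| is small there, and ‖f‖
is bounded by upper semicontinuity. -/
theorem IsBanachField.smul_mem {B : Type*} [TopologicalSpace B] {E : B → Type*}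
    [∀ b, NormedAddCommGroup (E b)] [∀ b, NormedSpace ℂ (E b)] {Γ : Submodule ℂ (∀ b, E b)}
    (hΓ : IsBanachField Γ) {χ : B → ℂ} (hχ : Continuous χ) {f : ∀ b, E b} (hf : f ∈ Γ) :
    (fun b => χ b • f b) ∈ Γ := by
  refine hΓ.of_locally_approx _ fun b ε hε => ⟨χ b • f, Γ.smul_mem _ hf, ?_⟩
  have h1 := hΓ.upperSemicontinuous f hf b (‖f b‖ + 1) (by linarith)
  have hδ : 0 < ε / (‖f b‖ + 1) := by positivity
  have h2 := hχ.continuousAt.eventually (Metric.ball_mem_nhds (χ b) hδ)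
  filter_upwards [h1, h2] with b' h3 h4
  rw [dist_eq_norm, lt_div_iff₀ (by positivity)] at h4
  rw [Pi.smul_apply, ← sub_smul, norm_smul]
  exact (mul_le_mul_of_nonneg_left h3.le (norm_nonneg _)).trans_lt h4

variable {B : Type*} [TopologicalSpace B] [T2Space B] [LocallyCompactSpace B]

theorem IsBanachField.exists_hasCompactSupp {E : B → Type*}
    [∀ b, NormedAddCommGroup (E b)] [∀ b, NormedSpace ℂ (E b)] {Γ : Submodule ℂ (∀ b, E b)}
    (hΓ : IsBanachField Γ) (b : B) (e : E b) : ∃ f ∈ Γ, HasCompactSupp f ∧ f b = e := by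
  obtain ⟨f, hf, rfl⟩ := hΓ.exists_eq b e
  obtain ⟨χ, h1, -, hc, -⟩ := exists_continuous_one_zero_of_isCompact (isCompact_singleton (x := b))
    isClosed_empty (Set.disjoint_empty _)
  refine ⟨_, hΓ.smul_mem (χ := fun b => (χ b : ℂ)) (by fun_prop) hf,
    ⟨tsupport χ, hc, fun b' hb' => ?_⟩, ?_⟩
  · simp [image_eq_zero_of_notMem_tsupport hb']
  · simp [h1 (Set.mem_singleton b)]

theorem CStarField.IsContSection.exists_vanishesAtInfinity {A : B → Type*}
    [∀ b, NonUnitalCStarAlgebra (A b)] {F : CStarField A} {Y : Type*} [TopologicalSpace Y]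
    {p : Y → B} (hp : Continuous p) {η : ∀ y, A (p y)} (hη : F.IsContSection p η) (y : Y) {ε : ℝ}
    (hε : 0 < ε) : ∃ e ∈ F.sections, VanishesAtInfinity e ∧
      ∀ᶠ y' in 𝓝 y, ‖η y' - e (p y')‖ < ε := by
  obtain ⟨e, he, h⟩ := hη y ε hε
  obtain ⟨K, hK, hKy⟩ := exists_compact_mem_nhds (p y)
  obtain ⟨χ, h1, -, hc, -⟩ := exists_continuous_one_zero_of_isCompact hK
    isClosed_empty (Set.disjoint_empty _)
  refine ⟨_, F.isBanachField.smul_mem (χ := fun b => (χ b : ℂ)) (by fun_prop) he,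
    fun δ hδ => ⟨tsupport χ, hc, fun b' hb' => ?_⟩, ?_⟩
  · simpa [image_eq_zero_of_notMem_tsupport hb'] using hδ
  · filter_upwards [h, hp.continuousAt.eventually hKy] with y' h2 h3
    have : χ (p y') = 1 := h1 h3
    simpa [this] using h2

/-- Pointwise application of a measurable field of representations to a continuous section of a
pull-back of a field of C*-algebras preserves measurable sections. -/
theorem isMeasurableSection_rep {A : B → Type*} [∀ b, NonUnitalCStarAlgebra (A b)]
    {F : CStarField A} {H : B → Type*} [∀ x, NormedAddCommGroup (H x)]
    [∀ x, InnerProductSpace ℂ (H x)] [∀ x, CompleteSpace (H x)] {𝒮 : Submodule ℂ (∀ x, H x)}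
    {φ : ∀ x, A x →⋆ₙₐ[ℂ] (H x →L[ℂ] H x)}
    (hφ : ∀ a ∈ F.sections, VanishesAtInfinity a → ∀ ξ ∈ 𝒮, (fun x => φ x (a x) (ξ x)) ∈ 𝒮)
    {Y : Type*} [TopologicalSpace Y] [SecondCountableTopology Y] [MeasurableSpace Y] [BorelSpace Y]
    {μ : Measure Y} {p : Y → B} (hp : Continuous p) {b : ∀ y, A (p y)} (hb : F.IsContSection p b)
    {ξ : ∀ y, H (p y)} (hξ : IsMeasurableSection 𝒮 μ p ξ) :
    IsMeasurableSection 𝒮 μ p fun y => φ (p y) (b y) (ξ y) := by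
  intro η hη
  refine aemeasurable_of_forall_approx (fun y => ‖η (p y)‖ * ‖ξ y‖) fun n => ?_
  rcases isEmpty_or_nonempty Y with hY | hY
  · exact ⟨fun _ _ => 0, fun _ => ∅, fun _ => aemeasurable_const, fun _ => .empty,
      fun y => hY.elim y, fun _ y => hY.elim y⟩
  have hn : 0 < 1 / ((n : ℝ) + 1) := by positivity
  choose e he hev hd using fun y => hb.exists_vanishesAtInfinity hp y hn
  obtain ⟨s, hs, hcov⟩ := TopologicalSpace.countable_cover_nhds
    fun y => interior_mem_nhds.2 (hd y)
  obtain ⟨y₀, hy₀⟩ := hs.exists_eq_range (by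
    by_contra hne
    rw [Set.not_nonempty_iff_eq_empty] at hne
    simp [hne] at hcov
    exact Set.empty_ne_univ hcov)
  refine ⟨fun k y => inner ℂ (η (p y)) (φ (p y) (e (y₀ k) (p y)) (ξ y)),
    fun k => interior {y' | ‖b y' - e (y₀ k) (p y')‖ < 1 / ((n : ℝ) + 1)}, fun k => ?_,
    fun k => isOpen_interior.measurableSet.nullMeasurableSet, fun y => ?_, fun k y hy => ?_⟩
  -- The operator is moved to the other argument, since e is a section over the base: φ(e^*)η is a
  -- measurable section there and can be paired with ξ, which exists only over Y.
  · simp only [inner_apply_right]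
    refine hξ _ (hφ (star (e (y₀ k))) (star_mem (he _)) (fun ε hε => ?_) η hη)
    obtain ⟨K, hK, h⟩ := hev (y₀ k) ε hε
    exact ⟨K, hK, fun b hb => by simpa using h b hb⟩
  · have h1 : y ∈ ⋃ x ∈ s, interior {y' | ‖b y' - e x (p y')‖ < 1 / ((n : ℝ) + 1)} := by
      rw [hcov]; trivial
    simp only [hy₀, Set.biUnion_range, Set.mem_iUnion] at h1
    exact h1
  · have h1 : ‖b y - e (y₀ k) (p y)‖ < 1 / ((n : ℝ) + 1) :=
      (interior_subset : _ ⊆ {y' | ‖b y' - e (y₀ k) (p y')‖ < 1 / ((n : ℝ) + 1)}) hy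
    rw [dist_eq_norm, ← inner_sub_right, ← sub_apply, ← map_sub]
    refine (norm_inner_le_norm _ _).trans ?_
    rw [mul_assoc]
    refine mul_le_mul_of_nonneg_left ?_ (norm_nonneg _)
    refine (ContinuousLinearMap.le_opNorm _ _).trans ?_
    rw [mul_comm]
    refine mul_le_mul_of_nonneg_left ?_ (norm_nonneg _)
    refine (NonUnitalStarAlgHom.norm_apply_le (φ (p y)) _).trans ?_
    rw [norm_sub_rev]
    exact h1.le

end ContinuousSections

/-! ### Countable fibrewise dense families in the associated Fell bundle -/

namespace TwistedPartialAction

variable {X : Type u} [Groupoid.{v} X] [TopologicalSpace X] [TopologicalSpace (Arr X)]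
    {A : X → Type t} [∀ x, NonUnitalCStarAlgebra (A x)] (T : TwistedPartialAction X A)
    [hG : IsTopologicalGroupoid X] [T2Space (Arr X)] [LocallyCompactSpace (Arr X)]
    [SecondCountableTopology (Arr X)]

/-- If the field of C*-algebras is separable, then so is the Fell bundle. -/
theorem exists_dense_sections (hA : T.field.IsSeparable) :
    ∃ d : ℕ → ∀ g : Arr X, T.D g.hom, (∀ n, d n ∈ T.fellSections ∧ HasCompactSupp (d n)) ∧
      ∀ (g : Arr X), ∀ b ∈ T.D g.hom, ∀ δ : ℝ, 0 < δ → ∃ n, ‖b - (d n g : A g.rng)‖ < δ := by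
  obtain ⟨a, ha, hdense⟩ := hA
  let Γ : Set (∀ g : Arr X, T.D g.hom) := {f | f ∈ T.fellSections ∧ HasCompactSupp f}
  have ho : ∀ (n m : ℕ) (f : Γ),
      IsOpen {g : Arr X | ‖a n g.rng - (f.1 g : A g.rng)‖ < 1 / ((m : ℝ) + 1)} := by
    intro n m f
    rw [isOpen_iff_mem_nhds]
    intro g hg
    have h1 : T.field.IsContSection Arr.rng fun g : Arr X => a n g.rng := fun g ε hε =>
      ⟨a n, ha n, Eventually.of_forall fun g' => by simpa using hε⟩
    exact (h1.sub f.2.1).norm_lt hG.continuous_rng g hg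
  -- By the Lindelöf property, for each n and m countably many sections of the bundle already cover
  -- all arrows at which some section in Γ is within 1/(m + 1) of a n. The zero section is added
  -- below only to make the family nonempty for the enumeration.
  choose s hs hsU using fun n m => TopologicalSpace.isOpen_iUnion_countable _ (ho n m)
  have h0 : (0 : ∀ g : Arr X, T.D g.hom) ∈ Γ :=
    ⟨zero_mem _, ∅, isCompact_empty, fun _ _ => rfl⟩
  have hc : (insert ⟨0, h0⟩ (⋃ n, ⋃ m, s n m) : Set Γ).Countable :=
    (Set.countable_iUnion fun n => Set.countable_iUnion fun m => hs n m).insert _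
  obtain ⟨d, hd⟩ := hc.exists_eq_range (Set.insert_nonempty _ _)
  refine ⟨fun n => (d n).1, fun n => (d n).2, fun g b hb δ hδ => ?_⟩
  obtain ⟨m, hm⟩ := exists_nat_one_div_lt (half_pos hδ)
  have hm0 : 0 < 1 / ((m : ℝ) + 1) := by positivity
  obtain ⟨n, hn⟩ := (hdense g.rng).exists_dist_lt b hm0
  rw [dist_eq_norm] at hn
  obtain ⟨f, hf, hfc, hfg⟩ := T.fellSections_isBanachField.exists_hasCompactSupp g ⟨b, hb⟩
  have h1 : g ∈ ⋃ i ∈ s n m, {g : Arr X | ‖a n g.rng - (i.1 g : A g.rng)‖ < 1 / ((m : ℝ) + 1)} := by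
    rw [hsU]
    refine Set.mem_iUnion.2 ⟨⟨f, hf, hfc⟩, ?_⟩
    change ‖a n g.rng - (f g : A g.rng)‖ < _
    rwa [hfg, norm_sub_rev]
  -- A section f through b shows that g lies in the union. The covering yields a listed section
  -- close to a n at g, and a n was chosen close to b there.
  obtain ⟨f', hf', h2⟩ := Set.mem_iUnion₂.1 h1
  obtain ⟨k, rfl⟩ : f' ∈ Set.range d := by
    rw [← hd]
    exact Set.mem_insert_of_mem _ (Set.mem_iUnion₂.2 ⟨n, m, hf'⟩)
  refine ⟨k, ?_⟩
  have h3 := norm_add_le (b - a n g.rng) (a n g.rng - ((d k).1 g : A g.rng))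
  rw [sub_add_sub_cancel] at h3
  have h4 : ‖a n g.rng - ((d k).1 g : A g.rng)‖ < 1 / ((m : ℝ) + 1) := h2
  linarith

end TwistedPartialAction

/-! ### From Fell-bundle representations to covariant representations -/

namespace FellRepData

section

variable {X : Type u} [Groupoid.{v} X] [TopologicalSpace X] [TopologicalSpace (Arr X)]
  [IsTopologicalGroupoid X]
  {H : X → Type*} [∀ x, NormedAddCommGroup (H x)] [∀ x, InnerProductSpace ℂ (H x)]
  {A : X → Type t} [∀ x, NonUnitalCStarAlgebra (A x)] {T : TwistedPartialAction X A}
  (R : FellRepData T.fellBundle H) {x y z : X} {g : y ⟶ z} {h : x ⟶ y}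

open Classical in
/-- The operator `S_g(a)` for `a ∈ D_g` (and `0` otherwise). -/
def op (g : y ⟶ z) (a : A z) : H y →L[ℂ] H z :=
  if ha : a ∈ T.D g then R.S g (⟨a, ha⟩ : T.D g) else 0

theorem op_of_mem {a : A z} (ha : a ∈ T.D g) : R.op g a = R.S g (⟨a, ha⟩ : T.D g) := dif_pos ha

theorem op_congr {g g' : y ⟶ z} (e : g = g') (a : A z) : R.op g a = R.op g' a := by rw [e]

theorem op_add {a b : A z} (ha : a ∈ T.D g) (hb : b ∈ T.D g) :
    R.op g (a + b) = R.op g a + R.op g b := by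
  rw [R.op_of_mem ha, R.op_of_mem hb, R.op_of_mem (add_mem ha hb)]
  exact (R.S g).map_add (⟨a, ha⟩ : T.D g) (⟨b, hb⟩ : T.D g)

theorem op_smul (r : ℂ) {a : A z} (ha : a ∈ T.D g) : R.op g (r • a) = r • R.op g a := by
  rw [R.op_of_mem ha, R.op_of_mem (SMulMemClass.smul_mem r ha)]
  exact (R.S g).map_smul r (⟨a, ha⟩ : T.D g)

end

/-! ### Algebraic reconstruction of φ and U from S -/

section

variable {X : Type u} [Groupoid.{v} X] [TopologicalSpace X] [TopologicalSpace (Arr X)]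
  [IsTopologicalGroupoid X]
  {H : X → Type*} [∀ x, NormedAddCommGroup (H x)] [∀ x, InnerProductSpace ℂ (H x)]
  [∀ x, CompleteSpace (H x)] [MeasurableSpace X] [MeasurableSpace (Arr X)]
  {α : HaarSystem X} {ν : Measure X} {𝒮 : Submodule ℂ (∀ x, H x)}
  {A : X → Type t} [∀ x, NonUnitalCStarAlgebra (A x)] {T : TwistedPartialAction X A}
  {R : FellRepData T.fellBundle H} (hR : IsFellPreRep α ν 𝒮 T.fellBundle R)
  {x y z : X} {g : y ⟶ z} {h : x ⟶ y}

include hR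

theorem op_op {a : A z} (ha : a ∈ T.D g) {b : A y} (hb : b ∈ T.D h) (ξ : H x) :
    R.op g a (R.op h b ξ) = R.op (h ≫ g) (T.pmul g h a b) ξ := by
  rw [R.op_of_mem ha, R.op_of_mem hb, R.op_of_mem (T.pmul_mem a b)]
  exact DFunLike.congr_fun (hR.multiplicative g h (⟨a, ha⟩ : T.D g) (⟨b, hb⟩ : T.D h)) ξ

theorem adjoint_op {a : A z} (ha : a ∈ T.D g) :
    ContinuousLinearMap.adjoint (R.op g a) = R.op (inv g) (T.pinv g a) := by
  rw [R.op_of_mem ha, R.op_of_mem (T.pinv_mem a)]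
  exact hR.adjoint g (⟨a, ha⟩ : T.D g)

/-- The representation `φ_x = S_{u(x)}` of the fibre at `x`. -/
def rep (x : X) : A x →⋆ₙₐ[ℂ] (H x →L[ℂ] H x) where
  toFun a := R.op (𝟙 x) a
  map_smul' r a := R.op_smul r (T.mem_D_unit a)
  map_zero' := by
    simpa using R.op_smul (g := 𝟙 x) 0 (T.mem_D_unit 0)
  map_add' a b := R.op_add (T.mem_D_unit a) (T.mem_D_unit b)
  map_mul' a b := by
    ext ξ
    change _ = R.op (𝟙 x) a (R.op (𝟙 x) b ξ)
    rw [op_op hR (T.mem_D_unit a) (T.mem_D_unit b), T.pmul_unit (T.mem_D_unit b),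
      R.op_congr (Category.id_comp (𝟙 x))]
  map_star' a := by
    rw [ContinuousLinearMap.star_eq_adjoint, adjoint_op hR (T.mem_D_unit a), T.pinv_unit,
      R.op_congr IsIso.inv_id]

theorem rep_apply (a : A x) : rep hR x a = R.op (𝟙 x) a := rfl

theorem rep_op (a : A z) {b : A z} (hb : b ∈ T.D g) (ξ : H y) :
    rep hR z a (R.op g b ξ) = R.op g (a * b) ξ := by
  rw [rep_apply, op_op hR (T.mem_D_unit a) hb, T.pmul_unit hb, R.op_congr (Category.comp_id g)]

theorem op_rep {b : A z} (hb : b ∈ T.D g) {a : A y} (ha : a ∈ T.D (inv g)) (ξ : H y) :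
    R.op g b (rep hR y a ξ) = R.op g (b * T.act g a) ξ := by
  rw [rep_apply, op_op hR hb (T.mem_D_unit a), T.pmul_unit_right,
    T.act_mul (T.actInv_mem_D g b) ha, T.act_actInv hb, R.op_congr (Category.id_comp g)]

/-- This is S_g(a)^*S_g(b) = φ(𝔞_g⁻¹(a^*b)) in terms of inner products. It controls norms and
kernels of S_g, and it is the Gram matrix from which U_g is built. -/
theorem inner_op_op {a b : A z} (ha : a ∈ T.D g) (hb : b ∈ T.D g) (ξ η : H y) :
    inner ℂ (R.op g a ξ) (R.op g b η) = inner ℂ ξ (rep hR y (T.actInv g (star a * b)) η) := by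
  rw [← ContinuousLinearMap.adjoint_inner_right, adjoint_op hR ha, op_op hR (T.pinv_mem a) hb,
    T.pmul_pinv ha hb, R.op_congr (IsIso.hom_inv_id g)]
  rfl

theorem op_adjoint_op {a b : A z} (ha : a ∈ T.D g) (hb : b ∈ T.D g) (ξ : H z) :
    R.op g a (ContinuousLinearMap.adjoint (R.op g b) ξ) = rep hR z (a * star b) ξ := by
  rw [adjoint_op hR hb, op_op hR ha (T.pinv_mem b), T.pmul_pinv_right ha hb,
    R.op_congr (IsIso.inv_hom_id g)]
  rfl

/-- Contractivity is automatic: by the Gram formula ‖S_g(a)ξ‖² ≤ ‖𝔞_g⁻¹(a^*a)‖ ‖ξ‖², and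
*-homomorphisms between C*-algebras are contractive. -/
theorem norm_op_apply_le {a : A z} (ha : a ∈ T.D g) (ξ : H y) : ‖R.op g a ξ‖ ≤ ‖a‖ * ‖ξ‖ := by
  have h1 : ‖R.op g a ξ‖ ^ 2 ≤ (‖a‖ * ‖ξ‖) ^ 2 := by
    have h2 := inner_op_op hR ha ha ξ ξ
    have h3 : ‖R.op g a ξ‖ ^ 2 = ‖inner ℂ (R.op g a ξ) (R.op g a ξ)‖ := by
      rw [inner_self_eq_norm_sq_to_K, norm_pow, norm_algebraMap', norm_norm]
    rw [h3, h2]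
    refine (norm_inner_le_norm _ _).trans ?_
    have h4 := (rep hR y (T.actInv g (star a * a))).le_opNorm ξ
    have h5 := NonUnitalStarAlgHom.norm_apply_le (rep hR y) (T.actInv g (star a * a))
    rw [T.norm_actInv (mul_mem (star_mem ha) ha), CStarRing.norm_star_mul_self] at h5
    calc ‖ξ‖ * ‖rep hR y (T.actInv g (star a * a)) ξ‖
        ≤ ‖ξ‖ * (‖a‖ * ‖a‖ * ‖ξ‖) := by gcongr; exact h4.trans (by gcongr)
      _ = (‖a‖ * ‖ξ‖) ^ 2 := by ring
  exact (sq_le_sq₀ (norm_nonneg _) (by positivity)).1 h1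

theorem continuous_op (ξ : H y) : Continuous fun a : T.D g => R.op g (a : A z) ξ := by
  have h1 : ∀ a b : T.D g, ‖R.op g (a : A z) ξ - R.op g (b : A z) ξ‖ ≤ ‖ξ‖ * ‖a - b‖ := by
    intro a b
    have e : R.op g (a : A z) ξ - R.op g (b : A z) ξ = R.op g ((a - b : T.D g) : A z) ξ := by
      have := R.op_add (a - b).2 b.2
      rw [← NonUnitalStarSubalgebra.coe_add, sub_add_cancel] at this
      rw [this]
      simp
    rw [e, mul_comm]
    exact norm_op_apply_le hR (a - b).2 ξ
  refine (LipschitzWith.of_dist_le_mul (K := ‖ξ‖₊) fun a b => ?_).continuous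
  rw [dist_eq_norm, dist_eq_norm]
  exact h1 a b

/-- For products, S_g(ab) = φ(a)S_g(b); an approximate unit of D_g handles general elements. -/
theorem op_mem_essSub {a : A z} (ha : a ∈ T.D g) (ξ : H y) :
    R.op g a ξ ∈ essSub (rep hR z) (T.D g) := by
  refine mem_of_mul_mem (T.isClosedIdeal g) isClosed_essSub (continuous_op hR ξ)
    (fun a b => ?_) ⟨a, ha⟩
  change R.op g ((a : A z) * b) ξ ∈ _
  rw [← rep_op hR _ b.2]
  exact apply_mem_essSub _ a.2 _

theorem op_orthogonal {a : A z} (ha : a ∈ T.D g) {ξ : H y}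
    (hξ : ξ ∈ (essSub (rep hR y) (T.D (inv g)))ᗮ) : R.op g a ξ = 0 := by
  rw [← inner_self_eq_zero (𝕜 := ℂ), inner_op_op hR ha ha,
    apply_orthogonal (T.actInv_mem_D _ _) hξ, inner_zero_right]

/-- The range of φ(ab) = S_g(a)S_g(b^*)^* lies in that of S_g(a), and products suffice by the
approximate unit. This makes U_g surjective onto φ(D_g)H. -/
theorem essSub_rep_eq (g : y ⟶ z) : essSub (rep hR z) (T.D g) =
    (Submodule.span ℂ (Set.range fun p : T.D (inv g) × H y =>
      R.op g (T.act g p.1) p.2)).topologicalClosure := by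
  refine le_antisymm (essSub_le_of_mul (T.isClosedIdeal g)
    (Submodule.isClosed_topologicalClosure _) fun a ha b hb ξ => ?_) ?_
  · refine Submodule.le_topologicalClosure _ (Submodule.subset_span
      ⟨(⟨T.actInv g a, T.actInv_mem_D _ _⟩,
        ContinuousLinearMap.adjoint (R.op g (star b)) ξ), ?_⟩)
    change R.op g (T.act g (T.actInv g a)) _ = _
    rw [T.act_actInv ha, op_adjoint_op hR ha (star_mem hb), star_star]
  · refine Submodule.topologicalClosure_minimal _ (Submodule.span_le.2 ?_) isClosed_essSub
    rintro _ ⟨p, rfl⟩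
    exact op_mem_essSub hR (T.act_mem_D _ _) _

/-- Both families have Gram matrix ⟨ξ, φ(a^*b)η⟩, because 𝔞_g⁻¹(𝔞_g(a)^*𝔞_g(b)) = a^*b. -/
theorem exists_U (g : y ⟶ z) :
    ∃ Φ : essSub (rep hR y) (T.D (inv g)) ≃ₗᵢ[ℂ] essSub (rep hR z) (T.D g),
      ∀ a (ha : a ∈ T.D (inv g)) (ξ : H y),
        (Φ ⟨rep hR y a ξ, apply_mem_essSub _ ha ξ⟩ : H z) = R.op g (T.act g a) ξ := by
  obtain ⟨Φ, hΦ⟩ := exists_isometryEquiv_closedSpan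
    (fun p : T.D (inv g) × H y => rep hR y (p.1 : A y) p.2)
    (fun p : T.D (inv g) × H y => R.op g (T.act g (p.1 : A y)) p.2) (by
      intro p q
      rw [inner_op_op hR (T.act_mem_D _ _) (T.act_mem_D _ _), ← T.act_star p.1.2,
        ← T.act_mul (star_mem p.1.2) q.1.2, T.actInv_act (mul_mem (star_mem p.1.2) q.1.2),
        inner_apply_left, apply_apply])
  refine ⟨((LinearIsometryEquiv.ofEq _ _ (essSub_eq_span_range (φ := rep hR y) (T.D (inv g)))).trans
    Φ).trans (LinearIsometryEquiv.ofEq _ _ (essSub_rep_eq hR g).symm), fun a ha ξ => ?_⟩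
  exact hΦ (⟨a, ha⟩, ξ) _

/-- The covariant representation that corresponds to a Fell-bundle representation. -/
def toCovRep : CovRepData T H where
  φ := rep hR
  U g := (exists_U hR g).choose

theorem toCovRep_Ubar_rep {a : A y} (ha : a ∈ T.D (inv g)) (ξ : H y) :
    (toCovRep hR).Ubar g (rep hR y a ξ) = R.op g (T.act g a) ξ := by
  rw [(toCovRep hR).Ubar_apply (apply_mem_essSub (rep hR y) ha ξ)]
  exact (exists_U hR g).choose_spec a ha ξ

/-- On φ(b)ξ with b in D_{g⁻¹} both operators give S_g(a𝔞_g(b))ξ, and both vanish on the orthogonal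
complement. This is the surjectivity part of the bijection. -/
theorem rep_toCovRep_Ubar {a : A z} (ha : a ∈ T.D g) (ξ : H y) :
    rep hR z a ((toCovRep hR).Ubar g ξ) = R.op g a ξ := by
  have h1 : (rep hR z a).comp ((toCovRep hR).Ubar g) = R.op g a := by
    refine continuousLinearMap_ext_essSub (φ := rep hR y) (I := T.D (inv g))
      (fun b hb ξ => ?_) fun ξ hξ => ?_
    · rw [ContinuousLinearMap.comp_apply, toCovRep_Ubar_rep hR hb, rep_op hR a (T.act_mem_D _ _),
        op_rep hR ha hb]
    · rw [ContinuousLinearMap.comp_apply, (toCovRep hR).Ubar_orthogonal hξ, map_zero,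
        op_orthogonal hR ha hξ]
  exact DFunLike.congr_fun h1 ξ

theorem toFellRep_toCovRep : (toCovRep hR).toFellRep = R := by
  refine FellRepData.ext ?_
  funext x y g
  refine LinearMap.ext fun a => ContinuousLinearMap.ext fun ξ => ?_
  exact (rep_toCovRep_Ubar hR a.2 ξ).trans (by rw [R.op_of_mem a.2]; rfl)

theorem rep_toCovRep_Ubar_eq {a : A z} (ha : a ∈ T.D g) (ξ : H y) :
    rep hR z a ((toCovRep hR).Ubar g ξ) =
      (toCovRep hR).Ubar g (rep hR y (T.actInv g a) ξ) := by
  rw [rep_toCovRep_Ubar hR ha, toCovRep_Ubar_rep hR (T.actInv_mem_D _ _), T.act_actInv ha]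

theorem toCovRep_covariance (g : y ⟶ z) (a : A y) (ha : a ∈ T.D (inv g))
    (ξ : essSub ((toCovRep hR).φ z) (T.D g)) :
    ((toCovRep hR).U g ⟨(toCovRep hR).φ y a (((toCovRep hR).U g).symm ξ),
      apply_mem_essSub ((toCovRep hR).φ y) ha _⟩ : H z) =
      (toCovRep hR).φ z (T.act g a) ξ := by
  rw [← (toCovRep hR).Ubar_apply]
  refine (toCovRep_Ubar_rep hR ha _).trans ?_
  rw [← rep_toCovRep_Ubar hR (T.act_mem_D _ _), (toCovRep hR).Ubar_symm]
  rfl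

/-- If Ū_h ξ lies in φ(D_h)H and in φ(D_{g⁻¹})H, it lies in φ(D_h ∩ D_{g⁻¹})H. The adjoint of Ū_h
carries φ(b) to φ(𝔞_h⁻¹(b)), with 𝔞_h⁻¹(b) in D_{h⁻¹} ∩ D_{(gh)⁻¹}, and it returns Ū_h ξ to ξ. -/
theorem mem_essSub_of_Ubar_mem {ξ : H x} (h₁ : ξ ∈ essSub (rep hR x) (T.D (inv h)))
    (h₂ : (toCovRep hR).Ubar h ξ ∈ essSub (rep hR y) (T.D (inv g))) :
    ξ ∈ essSub (rep hR x) (T.D (inv h) ⊓ T.D (inv (h ≫ g))) := by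
  have h3 : (toCovRep hR).Ubar h ξ ∈ essSub (rep hR y) (T.D h ⊓ T.D (inv g)) := by
    rw [essSub_inf (T.isClosedIdeal _) (T.isClosedIdeal _)]
    exact ⟨(toCovRep hR).Ubar_mem ξ, h₂⟩
  have h4 : essSub (rep hR y) (T.D h ⊓ T.D (inv g)) ≤
      (essSub (rep hR x) (T.D (inv h) ⊓ T.D (inv (h ≫ g)))).comap
        (ContinuousLinearMap.adjoint ((toCovRep hR).Ubar h) : H y →ₗ[ℂ] H x) := by
    refine essSub_le (isClosed_essSub.preimage (ContinuousLinearMap.continuous _))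
      fun b hb η => ?_
    change ContinuousLinearMap.adjoint ((toCovRep hR).Ubar h) (rep hR y b η) ∈
      essSub (rep hR x) (T.D (inv h) ⊓ T.D (inv (h ≫ g)))
    have e : ContinuousLinearMap.adjoint ((toCovRep hR).Ubar h) (rep hR y b η) =
        rep hR x (T.actInv h b) (ContinuousLinearMap.adjoint ((toCovRep hR).Ubar h) η) := by
      refine ext_inner_left ℂ fun ζ => ?_
      rw [ContinuousLinearMap.adjoint_inner_right, inner_apply_right,
        rep_toCovRep_Ubar_eq hR (star_mem hb.1), inner_apply_right,
        ContinuousLinearMap.adjoint_inner_right, T.actInv_star hb.1]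
    rw [e]
    have hb' : T.actInv h b ∈ T.D (inv h) ⊓ T.D (inv (h ≫ g)) :=
      ⟨T.actInv_mem_D _ _, T.actInv_mem _ hb.1 (by simpa using hb.2)⟩
    exact apply_mem_essSub _ hb' _
  have h5 : ContinuousLinearMap.adjoint ((toCovRep hR).Ubar h) ((toCovRep hR).Ubar h ξ) ∈
      essSub (rep hR x) (T.D (inv h) ⊓ T.D (inv (h ≫ g))) := h4 h3
  rwa [(toCovRep hR).adjoint_Ubar_Ubar h₁] at h5

/-- Tested on φ(nm)ξ: the factor m is absorbed into S_h or S_{gh}, while n supplies the coefficient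
φ on which Ū_g and V can be evaluated. Both sides become S_{gh}(w(g, h)𝔞_{gh}(nm))ξ. -/
theorem toCovRep_Ubar_Ubar {V : H z →L[ℂ] H z}
    (hV : IsMultiplierExtension (rep hR z) (T.D g ⊓ T.D (h ≫ g)) (T.w g h).1 V) {ξ : H x}
    (hξ : ξ ∈ essSub (rep hR x) (T.D (inv h) ⊓ T.D (inv (h ≫ g)))) :
    (toCovRep hR).Ubar g ((toCovRep hR).Ubar h ξ) = V ((toCovRep hR).Ubar (h ≫ g) ξ) := by
  let f := ((toCovRep hR).Ubar g).comp ((toCovRep hR).Ubar h)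
  let f' := V.comp ((toCovRep hR).Ubar (h ≫ g))
  refine essSub_le_of_mul (S := LinearMap.eqLocus (f : H x →ₗ[ℂ] H z) f')
    ((T.isClosedIdeal _).inf (T.isClosedIdeal _)) (isClosed_eq f.continuous f'.continuous)
    (fun n hn m hm ξ => ?_) hξ
  change (toCovRep hR).Ubar g ((toCovRep hR).Ubar h (rep hR x (n * m) ξ)) =
    V ((toCovRep hR).Ubar (h ≫ g) (rep hR x (n * m) ξ))
  have hnJ := T.act_comp_mem hn.1 hn.2
  have h1 := T.act_mem_left hn.1 hn.2
  rw [toCovRep_Ubar_rep hR (mul_mem hn.1 hm.1), toCovRep_Ubar_rep hR (mul_mem hn.2 hm.2),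
    T.act_mul hn.1 hm.1, T.act_mul hn.2 hm.2, ← rep_op hR _ (T.act_mem_D _ _),
    ← rep_op hR _ (T.act_mem_D _ _), toCovRep_Ubar_rep hR h1, hV.apply_apply _ hnJ,
    op_op hR (T.act_mem_D _ _) (T.act_mem_D _ _), rep_op hR _ (T.act_mem_D _ _),
    ← multL_mul_left _ (T.ideal_J g h) _ hnJ, ← T.act_mul hn.2 hm.2]
  unfold TwistedPartialAction.pmul
  rw [T.actInv_act h1, ← T.act_mul hn.1 hm.1, T.wR_act_act (mul_mem hn.1 hm.1)
    (mul_mem hn.2 hm.2)]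
  rfl

theorem toCovRep_cocycle (g : y ⟶ z) (h : x ⟶ y) : ∃ V : H z →L[ℂ] H z,
    IsMultiplierExtension ((toCovRep hR).φ z) (T.D g ⊓ T.D (h ≫ g)) (T.w g h).1 V ∧
    ∀ (ξ : H x) (h₁ : ξ ∈ essSub ((toCovRep hR).φ x) (T.D (inv h)))
      (h₂ : ((toCovRep hR).U h ⟨ξ, h₁⟩ : H y) ∈ essSub ((toCovRep hR).φ y) (T.D (inv g))),
      ∃ h₃ : ξ ∈ essSub ((toCovRep hR).φ x) (T.D (inv (h ≫ g))),
        ((toCovRep hR).U g ⟨(toCovRep hR).U h ⟨ξ, h₁⟩, h₂⟩ : H z) =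
          V ((toCovRep hR).U (h ≫ g) ⟨ξ, h₃⟩) := by
  obtain ⟨V, hV⟩ := exists_isMultiplierExtension (T.w_unitary g h) (rep hR z)
  refine ⟨V, hV, fun ξ h₁ h₂ => ?_⟩
  have h₂' := h₂
  rw [← (toCovRep hR).Ubar_apply h₁] at h₂'
  have h3 := mem_essSub_of_Ubar_mem hR h₁ h₂'
  have h4 : ξ ∈ essSub (rep hR x) (T.D (inv (h ≫ g))) := essSub_mono inf_le_right h3
  refine ⟨h4, ?_⟩
  rw [← (toCovRep hR).Ubar_apply h4, ← toCovRep_Ubar_Ubar hR hV h3,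
    ← (toCovRep hR).Ubar_apply h₂, (toCovRep hR).Ubar_apply h₁]

theorem toCovRep_nondegenerate (x : X) : essSub ((toCovRep hR).φ x) ⊤ = ⊤ := by
  rw [← hR.nondegenerate x]
  unfold essSub
  congr 2
  ext ζ
  constructor
  · rintro ⟨a, -, ξ, rfl⟩
    exact ⟨(⟨a, T.mem_D_unit a⟩ : T.D (𝟙 x)), ξ, by rw [← R.op_of_mem]; rfl⟩
  · rintro ⟨⟨a, ha⟩, ξ, rfl⟩
    exact ⟨a, trivial, ξ, by rw [← R.op_of_mem]; rfl⟩

theorem toCovRep_support : (toCovRep hR).support = R.support := by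
  have key : ∀ (g : Arr X) (a b : A g.rng) (ha : a ∈ T.D g.hom) (hb : b ∈ T.D g.hom) ξ,
      R.S (inv g.hom ≫ g.hom)
        (T.fellBundle.mul (⟨a, ha⟩ : T.D g.hom) (T.fellBundle.invol (⟨b, hb⟩ : T.D g.hom))) ξ =
        rep hR g.rng (a * star b) ξ := by
    intro g a b ha hb ξ
    rw [← op_adjoint_op hR ha hb, R.op_of_mem ha, R.op_of_mem hb]
    have h1 := hR.multiplicative g.hom (inv g.hom) (⟨a, ha⟩ : T.D g.hom)
      (T.fellBundle.invol (⟨b, hb⟩ : T.D g.hom))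
    have h2 := hR.adjoint g.hom (⟨b, hb⟩ : T.D g.hom)
    exact (DFunLike.congr_fun h1 ξ).symm.trans (congrArg _ (DFunLike.congr_fun h2 ξ).symm)
  ext g
  constructor
  · rintro ⟨a, ha, ξ, h⟩
    refine ⟨⟨star a, star_mem ha⟩, ⟨star a, star_mem ha⟩, ξ, ?_⟩
    rw [key g _ _ (star_mem ha) (star_mem ha), star_star, ← apply_apply]
    intro h2
    apply h
    change rep hR g.rng a ξ = 0
    rw [← inner_self_eq_zero (𝕜 := ℂ), inner_apply_left, h2, inner_zero_right]
  · rintro ⟨⟨a, ha⟩, ⟨b, hb⟩, ξ, h⟩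
    rw [key g a b ha hb] at h
    exact ⟨_, mul_mem ha (star_mem hb), ξ, h⟩

end

end FellRepData

/-! ### Measurability -/

section Measurability

variable {X : Type u} [Groupoid.{v} X] [TopologicalSpace X] [TopologicalSpace (Arr X)]
  [hG : IsTopologicalGroupoid X] [T2Space (Arr X)] [LocallyCompactSpace (Arr X)]
  [SecondCountableTopology (Arr X)]
  [MeasurableSpace X] [BorelSpace X] [MeasurableSpace (Arr X)] [BorelSpace (Arr X)]
  {H : X → Type*} [∀ x, NormedAddCommGroup (H x)] [∀ x, InnerProductSpace ℂ (H x)]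
  [∀ x, CompleteSpace (H x)]
  {α : HaarSystem X} {ν : Measure X} {𝒮 : Submodule ℂ (∀ x, H x)}
  {A : X → Type t} [∀ x, NonUnitalCStarAlgebra (A x)] {T : TwistedPartialAction X A}

omit [BorelSpace X] in
-- Written as Ū_g φ(𝔞_g⁻¹(f(g)))ξ(g), the section first has a continuous section of s^*B applied to
-- it, which puts it into the domains of the U_g; the measurability axiom for U then applies.
theorem CovRepData.toFellRep_measurable {c : CovRepData T H} (hc : IsCovRep α ν 𝒮 T c)
    {f : ∀ g : Arr X, T.D g.hom} (hf : f ∈ T.fellSections) {ξ : ∀ g : Arr X, H g.src}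
    (hξ : IsMeasurableSection 𝒮 (α.compTilde ν) Arr.src ξ) :
    IsMeasurableSection 𝒮 (α.comp ν) Arr.rng
      fun g => c.φ g.rng (f g : A g.rng) (c.Ubar g.hom (ξ g)) := by
  have := t2Space_obj X
  have := locallyCompactSpace_obj X
  have h1 := T.actInv_contSection hf fun g => (f g).2
  have h2 := isMeasurableSection_rep hc.measurable_φ hG.continuous_src h1 hξ
  have h3 := hc.measurable_U (fun g => ⟨_, apply_mem_essSub (c.φ g.src)
    (T.actInv_mem_D g.hom (f g : A g.rng)) (ξ g)⟩) h2
  refine (funext fun g => ?_ : _ = fun g : Arr X => _) ▸ h3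
  rw [φ_Ubar hc (f g).2, c.Ubar_apply]

omit [BorelSpace X] in
theorem CovRepData.isFellRep_toFellRep {c : CovRepData T H} (hc : IsCovRep α ν 𝒮 T c) :
    IsFellRep α ν 𝒮 T.fellBundle c.toFellRep where
  multiplicative _ _ a b := toFellRep_multiplicative hc a b
  adjoint _ a := toFellRep_adjoint hc a
  nondegenerate := toFellRep_nondegenerate hc
  measurable _ hf _ _ hξ := toFellRep_measurable hc hf hξ
  nontrivial := hc.nontrivial
  quasiInvariant := by rw [toFellRep_support hc]; exact hc.quasiInvariant

/-! ### Measurability of φ and U for a Fell-bundle representation -/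

namespace FellRepData

variable {R : FellRepData T.fellBundle H}

omit [T2Space (Arr X)] [LocallyCompactSpace (Arr X)] [SecondCountableTopology (Arr X)]
  [MeasurableSpace X] [BorelSpace X] [MeasurableSpace (Arr X)] [BorelSpace (Arr X)] in
theorem pmul_pairInv_contSection {f₁ f₂ : ∀ g : Arr X, A g.rng}
    (hf₁ : T.field.IsContSection Arr.rng f₁) (hf₂ : T.field.IsContSection Arr.rng f₂)
    (hD₁ : ∀ g, f₁ g ∈ T.D g.hom) (hD₂ : ∀ g, f₂ g ∈ T.D g.hom) :
    T.field.IsContSection Arr.rng fun g => T.pmul g.hom (inv g.hom) (f₁ g) (f₂ g.inverse) := by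
  have hq : Continuous fun g : Arr X => (⟨g.hom, inv g.hom⟩ : CompPair X) :=
    continuous_induced_rng.2 (continuous_id.prodMk hG.continuous_inverse)
  intro g ε hε
  obtain ⟨e, he, h⟩ := T.pmul_contSection hf₁ hf₂ hD₁ hD₂ ⟨g.hom, inv g.hom⟩ ε hε
  exact ⟨e, he, (hq.tendsto g).eventually h⟩

omit [SecondCountableTopology (Arr X)]
  [MeasurableSpace X] [BorelSpace X] [MeasurableSpace (Arr X)] [BorelSpace (Arr X)] in
/-- Near a unit, a continuous section of the field of C*-algebras is approximated by products
`f₁(g) · f₂(g⁻¹)` of sections of the Fell bundle. -/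
theorem exists_approx_near_unit {a : ∀ x, A x} (ha : a ∈ T.field.sections) (x : X) {ε : ℝ}
    (hε : 0 < ε) : ∃ f₁ ∈ T.fellSections, HasCompactSupp f₁ ∧ ∃ f₂ ∈ T.fellSections,
      HasCompactSupp f₂ ∧ ∀ᶠ g in 𝓝 (Arr.unit x),
        ‖T.pmul g.hom (inv g.hom) (f₁ g) (f₂ g.inverse : A g.src) - a g.rng‖ < ε := by
  -- At the unit the product f₁ · f₂ should be a(x)e with e from an approximate unit. The second
  -- factor sits over the inverse of the unit arrow, so e is taken in `T.D (inv (𝟙 x))`.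
  have ha' : a x ∈ T.D (inv (𝟙 x)) := by rw [IsIso.inv_id]; exact T.mem_D_unit _
  obtain ⟨l, hl, h1, -⟩ := mem_closure_mul (T.isClosedIdeal (inv (𝟙 x))) ha'
  obtain ⟨e, he⟩ := (h1.eventually (Metric.ball_mem_nhds _ hε)).exists
  have he' : ‖a x * (e : A x) - a x‖ < ε := by
    rw [dist_eq_norm] at he; exact he
  obtain ⟨f₁, hf₁, hc₁, h₁⟩ := T.fellSections_isBanachField.exists_hasCompactSupp (Arr.unit x)
    ⟨a x, T.mem_D_unit _⟩
  obtain ⟨f₂, hf₂, hc₂, h₂⟩ := T.fellSections_isBanachField.exists_hasCompactSupp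
    (Arr.unit x).inverse e
  refine ⟨f₁, hf₁, hc₁, f₂, hf₂, hc₂, ?_⟩
  have h3 := pmul_pairInv_contSection (T := T) (f₁ := fun g => (f₁ g : A g.rng))
    (f₂ := fun g => (f₂ g : A g.rng)) hf₁ hf₂ (fun g => (f₁ g).2) fun g => (f₂ g).2
  have h4 : T.field.IsContSection Arr.rng fun g : Arr X => a g.rng := fun g ε hε =>
    ⟨a, ha, Eventually.of_forall fun g' => by simpa using hε⟩
  refine (h3.sub h4).norm_lt hG.continuous_rng _ ?_
  change ‖T.pmul (𝟙 x) (inv (𝟙 x)) (f₁ (Arr.unit x)) (f₂ (Arr.unit x).inverse : A x) - a x‖ < ε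
  rw [h₁, h₂, T.pmul_unit e.2]
  exact he'

variable (h𝒮 : IsMeasurableField ν 𝒮) (hR : IsFellPreRep α ν 𝒮 T.fellBundle R)

include h𝒮 in
-- The operator is S_g(f₁(g))S_{g⁻¹}(f₂(g⁻¹)). The measurability axiom is used twice; in between,
-- inversion turns a section of r^*H for ν ∘ α into a section of s^*H for ν ∘ α̃, as the second use
-- requires.
theorem isMeasurableSection_rep_pmul {f₁ f₂ : ∀ g : Arr X, T.D g.hom} (hf₁ : f₁ ∈ T.fellSections)
    (hc₁ : HasCompactSupp f₁) (hf₂ : f₂ ∈ T.fellSections) (hc₂ : HasCompactSupp f₂)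
    {ξ : ∀ x, H x} (hξ : ξ ∈ 𝒮) : IsMeasurableSection 𝒮 (α.comp ν) Arr.rng fun g =>
      rep hR g.rng (T.pmul g.hom (inv g.hom) (f₁ g) (f₂ g.inverse : A g.src)) (ξ g.rng) := by
  have h1 := hR.measurable f₂ hf₂ hc₂ _
    (h𝒮.isMeasurableSection_comp hξ (α.quasiMeasurePreserving_src ν))
  have h2 : IsMeasurableSection 𝒮 (α.compTilde ν) Arr.src fun g : Arr X =>
      R.S (inv g.hom) (f₂ g.inverse) (ξ g.rng) := fun η hη =>
    (h1 η hη).comp_quasiMeasurePreserving (α.quasiMeasurePreserving_inverse ν)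
  have h3 := hR.measurable f₁ hf₁ hc₁ _ h2
  refine (funext fun g => ?_ : _ = fun g : Arr X => _) ▸ h3
  rw [rep_apply, R.op_congr (IsIso.inv_hom_id g.hom).symm, ← op_op hR (f₁ g).2 (f₂ g.inverse).2,
    R.op_of_mem (f₁ g).2, R.op_of_mem (f₂ g.inverse).2]

include h𝒮 in
-- The values over the objects cannot be obtained by restricting to the units, which may be null.
-- Instead a is approximated near the units by the products f₁(g) · f₂(g⁻¹), with countably many
-- neighbourhoods for each accuracy, and measurability descends along the range map.
theorem rep_measurable {a : ∀ x, A x} (ha : a ∈ T.field.sections) {ξ : ∀ x, H x} (hξ : ξ ∈ 𝒮) :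
    (fun x => rep hR x (a x) (ξ x)) ∈ 𝒮 := by
  refine h𝒮.maximal _ fun η hη => ?_
  have : SecondCountableTopology X := isClosedEmbedding_unit.isEmbedding.secondCountableTopology
  have hpos : ∀ n : ℕ, 0 < 1 / ((n : ℝ) + 1) := fun n => by positivity
  choose f₁ hf₁ hc₁ f₂ hf₂ hc₂ hd using fun (n : ℕ) x => exists_approx_near_unit ha x (hpos n)
  let W : ℕ → X → Set (Arr X) := fun n x => interior {g : Arr X |
    ‖T.pmul g.hom (inv g.hom) (f₁ n x g) (f₂ n x g.inverse : A g.src) - a g.rng‖ <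
      1 / ((n : ℝ) + 1)}
  have hW : ∀ n x, (Arr.unit : X → Arr X) ⁻¹' W n x ∈ 𝓝 x := fun n x =>
    hG.continuous_unit.continuousAt (interior_mem_nhds.2 (hd n x))
  choose s hs hcov using fun n => TopologicalSpace.countable_cover_nhds (hW n)
  have := fun n => (hs n).to_subtype
  refine α.aemeasurable_of_approx_near_units (C := fun x => ‖η x‖ * ‖ξ x‖) (ι := fun n => s n)
    (W := fun n i => W n i) (m := fun n i g => inner ℂ (η g.rng) (rep hR g.rng
      (T.pmul g.hom (inv g.hom) (f₁ n i g) (f₂ n i g.inverse : A g.src)) (ξ g.rng)))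
    ((h𝒮.norm η hη).mul (h𝒮.norm ξ hξ)) (fun n i => isOpen_interior)
    (fun n i => isMeasurableSection_rep_pmul h𝒮 hR (hf₁ n i) (hc₁ n i) (hf₂ n i) (hc₂ n i) hξ η hη)
    (fun n x => ?_) fun n i g hg => ?_
  · have h1 : x ∈ ⋃ y ∈ s n, (Arr.unit : X → Arr X) ⁻¹' W n y := by rw [hcov]; trivial
    obtain ⟨y, hy, h2⟩ := Set.mem_iUnion₂.1 h1
    exact ⟨⟨y, hy⟩, h2⟩
  · have h1 : ‖T.pmul g.hom (inv g.hom) (f₁ n i g) (f₂ n i g.inverse : A g.src) - a g.rng‖ <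
        1 / ((n : ℝ) + 1) := interior_subset (s := {g : Arr X |
      ‖T.pmul g.hom (inv g.hom) (f₁ n i g) (f₂ n i g.inverse : A g.src) - a g.rng‖ <
        1 / ((n : ℝ) + 1)}) hg
    rw [dist_eq_norm, ← inner_sub_right, ← sub_apply, ← map_sub]
    refine (norm_inner_le_norm _ _).trans ?_
    rw [mul_assoc]
    refine mul_le_mul_of_nonneg_left ?_ (norm_nonneg _)
    refine (ContinuousLinearMap.le_opNorm _ _).trans ?_
    rw [mul_comm]
    refine mul_le_mul_of_nonneg_left ?_ (norm_nonneg _)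
    exact (NonUnitalStarAlgHom.norm_apply_le (rep hR g.rng) _).trans h1.le

omit [T2Space (Arr X)] [LocallyCompactSpace (Arr X)] [SecondCountableTopology (Arr X)]
  [BorelSpace X] [BorelSpace (Arr X)] in
-- Vanishing of φ(D_g) can be tested on countable dense families of coefficients and vectors,
-- because φ is contractive.
theorem support_toCovRep_eq_iUnion {d : ℕ → ∀ g : Arr X, T.D g.hom}
    (hd : ∀ (g : Arr X), ∀ b ∈ T.D g.hom, ∀ δ : ℝ, 0 < δ → ∃ n, ‖b - (d n g : A g.rng)‖ < δ)
    {ι : Type*} {c : ι → ∀ x, H x} (hc : ∀ x, DenseRange fun i => c i x) :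
    (toCovRep hR).support = ⋃ k, ⋃ i, ⋃ j, {g : Arr X |
      inner ℂ (c j g.rng) (rep hR g.rng (d k g : A g.rng) (c i g.rng)) ≠ 0} := by
  ext g
  simp only [Set.mem_iUnion, Set.mem_ofPred_eq]
  constructor
  · rintro ⟨a, ha, ζ, hζ⟩
    by_contra! h
    have h1 : ∀ k (ζ : H g.rng), rep hR g.rng (d k g : A g.rng) ζ = 0 := by
      intro k ζ
      refine (hc g.rng).induction_on
        (p := fun ζ => rep hR g.rng (d k g : A g.rng) ζ = 0) ζ
        (isClosed_eq (by fun_prop) continuous_const) fun i => ?_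
      rw [← inner_self_eq_zero (𝕜 := ℂ)]
      exact (hc g.rng).induction_on
        (p := fun θ => inner ℂ θ (rep hR g.rng (d k g : A g.rng) (c i g.rng)) = 0) _
        (isClosed_eq (by fun_prop) continuous_const) fun j => h k i j
    apply hζ
    change rep hR g.rng a ζ = 0
    by_contra h2
    -- With this accuracy, ‖φ(a)ζ‖ = ‖φ(a - d_k)ζ‖ ≤ ‖a - d_k‖ ‖ζ‖ < ‖φ(a)ζ‖, a contradiction.
    obtain ⟨k, hk⟩ := hd g a ha (‖rep hR g.rng a ζ‖ / (‖ζ‖ + 1)) (by positivity)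
    rw [lt_div_iff₀ (by positivity)] at hk
    have h3 : rep hR g.rng (a - d k g) ζ = rep hR g.rng a ζ := by
      rw [map_sub, sub_apply, h1 k ζ, sub_zero]
    have h4 := (rep hR g.rng (a - d k g)).le_opNorm ζ
    have h5 := NonUnitalStarAlgHom.norm_apply_le (rep hR g.rng) (a - d k g)
    rw [h3] at h4
    nlinarith [norm_nonneg ζ, norm_nonneg (a - d k g)]
  · rintro ⟨k, i, j, h⟩
    exact ⟨d k g, (d k g).2, c i g.rng, fun h0 => h (by
      change rep hR g.rng _ _ = 0 at h0
      rw [h0, inner_zero_right])⟩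

include h𝒮 in
theorem nullMeasurableSet_support (hA : T.field.IsSeparable) :
    NullMeasurableSet (toCovRep hR).support (α.comp ν) := by
  have := t2Space_obj X
  have := locallyCompactSpace_obj X
  obtain ⟨d, hd, hdense⟩ := T.exists_dense_sections hA
  obtain ⟨c, hc, hcd⟩ := h𝒮.exists_denseRange
  rw [support_toCovRep_eq_iUnion hR hdense hcd]
  refine NullMeasurableSet.iUnion fun k => NullMeasurableSet.iUnion fun i =>
    NullMeasurableSet.iUnion fun j => ?_
  have hφ : ∀ a ∈ T.field.sections, VanishesAtInfinity a → ∀ ξ ∈ 𝒮,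
      (fun x => rep hR x (a x) (ξ x)) ∈ 𝒮 := fun a ha _ ξ hξ => rep_measurable h𝒮 hR ha hξ
  have hdk : T.field.IsContSection Arr.rng fun g => (d k g : A g.rng) := (hd k).1
  have hci : IsMeasurableSection 𝒮 (α.comp ν) Arr.rng fun g => c i g.rng :=
    h𝒮.isMeasurableSection_comp (hc i) (α.quasiMeasurePreserving_rng ν)
  have h1 : AEMeasurable (fun g : Arr X => inner ℂ (c j g.rng)
      (rep hR g.rng (d k g : A g.rng) (c i g.rng))) (α.comp ν) :=
    isMeasurableSection_rep hφ hG.continuous_rng hdk hci (c j) (hc j)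
  have h2 := h1.nullMeasurable (measurableSet_singleton (0 : ℂ)).compl
  exact h2

omit [T2Space (Arr X)] [LocallyCompactSpace (Arr X)] [SecondCountableTopology (Arr X)]
  [BorelSpace X] [BorelSpace (Arr X)] in
-- Some b in D_{g⁻¹} moves ξ by less than δ/2. As 𝔞_g is isometric, the elements 𝔞_g⁻¹(d_n(g)) are
-- dense in D_{g⁻¹}, and replacing b by one of them costs at most another δ/2.
theorem exists_dense_sections_approx {d : ℕ → ∀ g : Arr X, T.D g.hom}
    (hd : ∀ (g : Arr X), ∀ b ∈ T.D g.hom, ∀ δ : ℝ, 0 < δ → ∃ n, ‖b - (d n g : A g.rng)‖ < δ)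
    (g : Arr X) {ξ : H g.src} (hξ : ξ ∈ essSub (rep hR g.src) (T.D (inv g.hom))) {δ : ℝ}
    (hδ : 0 < δ) : ∃ n, ‖rep hR g.src (T.actInv g.hom (d n g)) ξ - ξ‖ ≤ δ := by
  obtain ⟨b, hb, h1⟩ := exists_norm_apply_sub_lt hξ (half_pos hδ)
  obtain ⟨n, hn⟩ := hd g _ (T.act_mem_D g.hom b) (δ / (2 * (‖ξ‖ + 1))) (by positivity)
  refine ⟨n, ?_⟩
  have hdn := T.actInv_mem_D g.hom (d n g : A g.rng)
  rw [← T.act_actInv (d n g).2, ← T.act_sub hb hdn, T.norm_act (sub_mem hb hdn),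
    lt_div_iff₀ (by positivity)] at hn
  have h2 : ‖rep hR g.src (T.actInv g.hom (d n g)) ξ - rep hR g.src b ξ‖ ≤
      ‖b - T.actInv g.hom (d n g)‖ * ‖ξ‖ := by
    rw [← sub_apply, ← map_sub, norm_sub_rev b]
    exact ((rep hR g.src _).le_opNorm ξ).trans (mul_le_mul_of_nonneg_right
      (NonUnitalStarAlgHom.norm_apply_le (rep hR g.src) _) (norm_nonneg _))
  have h3 := norm_add_le (rep hR g.src (T.actInv g.hom (d n g)) ξ - rep hR g.src b ξ)
    (rep hR g.src b ξ - ξ)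
  rw [sub_add_sub_cancel] at h3
  nlinarith [norm_nonneg ξ, norm_nonneg (b - T.actInv g.hom (d n g))]

include h𝒮 in
theorem toCovRep_measurable_U (hA : T.field.IsSeparable)
    (hq : IsSymmetricMeasure ((α.comp ν).restrict R.support))
    (ξ : ∀ g : Arr X, essSub (rep hR g.src) (T.D (inv g.hom)))
    (hξ : IsMeasurableSection 𝒮 (α.compTilde ν) Arr.src (fun g => (ξ g : H g.src))) :
    IsMeasurableSection 𝒮 (α.comp ν) Arr.rng
      fun g => (toCovRep hR).Ubar g.hom (ξ g : H g.src) := by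
  classical
  have := t2Space_obj X
  have := locallyCompactSpace_obj X
  intro η hη
  set s := (toCovRep hR).support with hs
  have hsm : NullMeasurableSet s (α.comp ν) := nullMeasurableSet_support h𝒮 hR hA
  -- The input ξ is measurable for ν ∘ α̃ but the output is tested against ν ∘ α; symmetry on the
  -- support provides the comparison.
  have hac : (α.comp ν).restrict s ≪ α.compTilde ν := by
    rw [← toCovRep_support hR] at hq
    exact hq.1.trans (Measure.restrict_le_self.absolutelyContinuous.map measurable_inverse)
  -- Off the support φ(D_g)H = 0, so Ū_g ξ(g) = 0 and the function may be restricted to the support.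
  have e : (fun g : Arr X => inner ℂ (η g.rng) ((toCovRep hR).Ubar g.hom (ξ g : H g.src))) =
      s.indicator fun g => inner ℂ (η g.rng) ((toCovRep hR).Ubar g.hom (ξ g : H g.src)) := by
    refine (Set.indicator_eq_self.2 fun g hg => ?_).symm
    by_contra h
    apply hg
    have h1 : (toCovRep hR).Ubar g.hom (ξ g : H g.src) ∈ (essSub (rep hR g.rng) (T.D g.hom))ᗮ := by
      refine mem_orthogonal_essSub_iff.2 fun a ha => ?_
      by_contra h2
      exact h ⟨a, ha, _, h2⟩
    change inner ℂ (η g.rng) _ = 0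
    rw [eq_zero_of_mem_orthogonal ((toCovRep hR).Ubar_mem _) h1, inner_zero_right]
  rw [e, aemeasurable_indicator_iff₀ hsm]
  obtain ⟨d, hd, hdense⟩ := T.exists_dense_sections hA
  refine aemeasurable_of_forall_approx (fun g => ‖η g.rng‖) fun n => ?_
  have hn : 0 < 1 / ((n : ℝ) + 1) := by positivity
  -- The k-th approximant S_g(d_k(g))ξ(g) equals Ū_g φ(𝔞_g⁻¹(d_k(g)))ξ(g). It is used where
  -- φ(𝔞_g⁻¹(d_k(g))) moves ξ(g) by at most 1/(n + 1); Ū_g preserves this error.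
  refine ⟨fun k g => inner ℂ (η g.rng) (R.op g.hom (d k g : A g.rng) (ξ g : H g.src)),
    fun k => {g | ‖rep hR g.src (T.actInv g.hom (d k g)) (ξ g : H g.src) - ξ g‖ ≤
      1 / ((n : ℝ) + 1)}, fun k => ?_, fun k => ?_, fun g =>
    exists_dense_sections_approx hR hdense g (ξ g).2 hn, fun k g hg => ?_⟩
  · have h1 := (hR.measurable (d k) (hd k).1 (hd k).2 _ hξ η hη).restrict (s := s)
    have e2 : (fun g => inner ℂ (η g.rng) (R.op g.hom (d k g : A g.rng) (ξ g : H g.src))) =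
        fun g : Arr X => inner ℂ (η g.rng) (R.S g.hom (d k g) (ξ g : H g.src)) :=
      funext fun g => by rw [R.op_of_mem (d k g).2]
    change AEMeasurable (fun g => inner ℂ (η g.rng)
      (R.op g.hom (d k g : A g.rng) (ξ g : H g.src))) _
    rw [e2]
    exact h1
  -- The sets for the choice of k are defined by norms of sections of s^*H, so they are null
  -- measurable for ν ∘ α̃ and must be transported by `hac`.
  · have h1 := isMeasurableSection_rep (φ := rep hR)
      (fun a ha _ ξ hξ => rep_measurable h𝒮 hR ha hξ) hG.continuous_src
      (T.actInv_contSection (hd k).1 fun g => (d k g).2) hξ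
    exact (h𝒮.nullMeasurableSet_norm_le (α.quasiMeasurePreserving_src ν)
      (h1.sub hξ) hn.le).mono_ac hac
  · rw [dist_eq_norm, ← inner_sub_right]
    refine (norm_inner_le_norm _ _).trans (mul_le_mul_of_nonneg_left ?_ (norm_nonneg _))
    rw [← rep_toCovRep_Ubar hR (d k g).2, rep_toCovRep_Ubar_eq hR (d k g).2, ← map_sub]
    refine ((toCovRep hR).norm_Ubar ?_).le.trans hg
    exact sub_mem (apply_mem_essSub _ (T.actInv_mem_D _ _) _) (ξ g).2

include h𝒮 in
theorem isCovRep_toCovRep (hA : T.field.IsSeparable) (hR : IsFellRep α ν 𝒮 T.fellBundle R) :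
    IsCovRep α ν 𝒮 T (toCovRep hR.toIsFellPreRep) where
  nontrivial := hR.nontrivial
  nondegenerate := toCovRep_nondegenerate hR.toIsFellPreRep
  quasiInvariant := by rw [toCovRep_support]; exact hR.quasiInvariant
  covariance g a ha ξ := toCovRep_covariance hR.toIsFellPreRep g a ha ξ
  cocycle g h := toCovRep_cocycle hR.toIsFellPreRep g h
  measurable_φ _ ha _ _ hξ := rep_measurable h𝒮 hR.toIsFellPreRep ha hξ
  measurable_U ξ hξ := by
    have h1 := toCovRep_measurable_U h𝒮 hR.toIsFellPreRep hA hR.quasiInvariant ξ hξ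
    refine (funext fun g => ?_ : _ = fun g : Arr X => _) ▸ h1
    exact (toCovRep hR.toIsFellPreRep).Ubar_apply (ξ g).2

end FellRepData

/-! ### Equivalent measures -/

variable {μ : Measure X}

theorem IsMeasurableField.mono_ac {X : Type u} {H : X → Type*} [∀ x, NormedAddCommGroup (H x)]
    [∀ x, InnerProductSpace ℂ (H x)] [MeasurableSpace X] {ν μ : Measure X}
    {𝒮 : Submodule ℂ (∀ x, H x)} (h𝒮 : IsMeasurableField ν 𝒮) (h1 : ν ≪ μ) (h2 : μ ≪ ν) :
    IsMeasurableField μ 𝒮 where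
  norm ξ hξ := (h𝒮.norm ξ hξ).mono_ac h2
  maximal η h := h𝒮.maximal η fun ξ hξ => (h ξ hξ).mono_ac h1
  total := h𝒮.total

theorem IsSymmetricMeasure.congr_ac {X : Type u} [Groupoid.{v} X] [TopologicalSpace X]
    [TopologicalSpace (Arr X)] [IsTopologicalGroupoid X] [MeasurableSpace (Arr X)]
    [BorelSpace (Arr X)] {μ μ' : Measure (Arr X)} (h : IsSymmetricMeasure μ) (h1 : μ ≪ μ')
    (h2 : μ' ≪ μ) : IsSymmetricMeasure μ' :=
  ⟨(h2.trans h.1).trans (h1.map measurable_inverse),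
    ((h2.map measurable_inverse).trans h.2).trans h1⟩

theorem IsCovRep.mono_ac {c : CovRepData T H} (hc : IsCovRep α ν 𝒮 T c)
    (h1 : ν ≪ μ) (h2 : μ ≪ ν) : IsCovRep α μ 𝒮 T c where
  nontrivial := h2.ae_le hc.nontrivial
  nondegenerate := hc.nondegenerate
  quasiInvariant := hc.quasiInvariant.congr_ac ((α.comp_absolutelyContinuous h1).restrict _)
    ((α.comp_absolutelyContinuous h2).restrict _)
  covariance := hc.covariance
  cocycle := hc.cocycle
  measurable_φ := hc.measurable_φ
  measurable_U ξ hξ := (hc.measurable_U ξ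
    (hξ.mono_ac (α.compTilde_absolutelyContinuous h1))).mono_ac (α.comp_absolutelyContinuous h2)

theorem IsFellRep.mono_ac {R : FellRepData T.fellBundle H} (hR : IsFellRep α ν 𝒮 T.fellBundle R)
    (h1 : ν ≪ μ) (h2 : μ ≪ ν) : IsFellRep α μ 𝒮 T.fellBundle R where
  multiplicative := hR.multiplicative
  adjoint := hR.adjoint
  nondegenerate := hR.nondegenerate
  measurable f hf hfc ξ hξ := (hR.measurable f hf hfc ξ
    (hξ.mono_ac (α.compTilde_absolutelyContinuous h1))).mono_ac (α.comp_absolutelyContinuous h2)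
  nontrivial := h2.ae_le hR.nontrivial
  quasiInvariant := hR.quasiInvariant.congr_ac ((α.comp_absolutelyContinuous h1).restrict _)
    ((α.comp_absolutelyContinuous h2).restrict _)

end Measurability

end FellBundles

end

/-! ### The equivalence of the two kinds of representations -/

theorem mainTheorem9 {X : Type*} [CategoryTheory.Groupoid X] [TopologicalSpace X]
    [TopologicalSpace (FellBundles.Arr X)] [FellBundles.IsTopologicalGroupoid X]
    [T2Space (FellBundles.Arr X)] [LocallyCompactSpace (FellBundles.Arr X)]
    [SecondCountableTopology (FellBundles.Arr X)]
    [MeasurableSpace X] [BorelSpace X]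
    [MeasurableSpace (FellBundles.Arr X)] [BorelSpace (FellBundles.Arr X)]
    (α : FellBundles.HaarSystem X)
    {A : X → Type*} [∀ x, NonUnitalCStarAlgebra (A x)]
    (T : FellBundles.TwistedPartialAction X A) (hA : T.field.IsSeparable)
    {H : X → Type*} [∀ x, NormedAddCommGroup (H x)] [∀ x, InnerProductSpace ℂ (H x)]
    [∀ x, CompleteSpace (H x)] (ν : Measure X) [SigmaFinite ν]
    (𝒮 : Submodule ℂ (∀ x, H x)) (h𝒮 : FellBundles.IsMeasurableField ν 𝒮)
    {H' : X → Type*} [∀ x, NormedAddCommGroup (H' x)] [∀ x, InnerProductSpace ℂ (H' x)]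
    [∀ x, CompleteSpace (H' x)] (ν' : Measure X) [SigmaFinite ν']
    (𝒮' : Submodule ℂ (∀ x, H' x)) (h𝒮' : FellBundles.IsMeasurableField ν' 𝒮') :
    -- `S_g(a) = φ_{r(g)}(a) Ū_g` is a bijection between the two kinds of representations
    Set.BijOn (fun c => c.toFellRep)
      {c : FellBundles.CovRepData T H | FellBundles.IsCovRep α ν 𝒮 T c}
      {R : FellBundles.FellRepData T.fellBundle H |
        FellBundles.IsFellRep α ν 𝒮 T.fellBundle R} ∧
    -- `φ_x` and `U_g` are recovered from `S`
    (∀ c : FellBundles.CovRepData T H, FellBundles.IsCovRep α ν 𝒮 T c →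
      (∀ (x : X) (a : A x) (ha : a ∈ T.D (𝟙 x)),
        c.toFellRep.S (𝟙 x) (⟨a, ha⟩ : T.D (𝟙 x)) = c.φ x a) ∧
      ∀ {x y : X} (g : x ⟶ y) (a : A x) (ha : a ∈ T.D (inv g)) (ξ : H x),
        (c.U g ⟨c.φ x a ξ, FellBundles.apply_mem_essSub (c.φ x) ha ξ⟩ : H y) =
          c.toFellRep.S g (T.iso g ⟨a, ha⟩) ξ) ∧
    -- the bijection is compatible with intertwining operators
    (∀ (c : FellBundles.CovRepData T H) (c' : FellBundles.CovRepData T H'),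
      FellBundles.IsCovRep α ν 𝒮 T c → FellBundles.IsCovRep α ν' 𝒮' T c' →
      ∀ (E : Set X) (V : ∀ x, H x →L[ℂ] H' x),
        c.Intertwines c' E V ↔ c.toFellRep.Intertwines c'.toFellRep E V) ∧
    -- both notions depend on the measure only through its measure class
    (∀ (μ : Measure X) [SigmaFinite μ], ν ≪ μ → μ ≪ ν →
      FellBundles.IsMeasurableField μ 𝒮 ∧
      (∀ c : FellBundles.CovRepData T H,
        FellBundles.IsCovRep α ν 𝒮 T c ↔ FellBundles.IsCovRep α μ 𝒮 T c) ∧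
      ∀ R : FellBundles.FellRepData T.fellBundle H,
        FellBundles.IsFellRep α ν 𝒮 T.fellBundle R ↔
          FellBundles.IsFellRep α μ 𝒮 T.fellBundle R) := by
  refine ⟨⟨fun c hc => FellBundles.CovRepData.isFellRep_toFellRep hc,
    fun c hc c' hc' h => FellBundles.CovRepData.toFellRep_injective hc hc' h,
    fun R hR => ⟨FellBundles.FellRepData.toCovRep hR.toIsFellPreRep,
      FellBundles.FellRepData.isCovRep_toCovRep h𝒮 hA hR,
      FellBundles.FellRepData.toFellRep_toCovRep hR.toIsFellPreRep⟩⟩,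
    fun c hc => ⟨fun x a ha => FellBundles.CovRepData.toFellRep_unit hc x a ha,
      fun g a ha ξ => FellBundles.CovRepData.toFellRep_iso hc a ha ξ⟩,
    fun c c' hc hc' E V => FellBundles.CovRepData.intertwines_iff hc hc' E V,
    fun μ _ h1 h2 => ⟨h𝒮.mono_ac h1 h2, fun c => ⟨fun hc => hc.mono_ac h1 h2,
      fun hc => hc.mono_ac h2 h1⟩, fun R => ⟨fun hR => hR.mono_ac h1 h2,
      fun hR => hR.mono_ac h2 h1⟩⟩⟩
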